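/- For $\mu>0$ and $x,y>0$ let $$Q_\mu(x,y)=x^{\frac12(1-\mu)}\int_y^\infty t^{\frac12(\mu-1)}e^{-t-x}I_{\mu-1}(2\sqrt{xt})\,dt,\qquad P_\mu(x,y)=x^{\frac12(1-\mu)}\int_0^y t^{\frac12(\mu-1)}e^{-t-x}I_{\mu-1}(2\sqrt{xt})\,dt$$ be the generalized Marcum functions, where $I_\nu$ is the modified Bessel function of the first kind, and let $\operatorname{erfc} z=\frac{2}{\sqrt\pi}\int_z^\infty e^{-t^2}dt$. For $x,y>0$ put $\xi=2\sqrt{xy}$, $\rho=\sqrt{y/x}$, $\phi(t)=\frac12\xi\left(t+\frac1t\right)-\ln t$ (principal logarithm) and $t_0=(1+\sqrt{1+\xi^2})/\xi$, the positive saddle point of $\phi$. Define $\zeta$ by $$\tfrac12\zeta^2=x+y-\sqrt{1+4xy}+\ln\frac{1+\sqrt{1+4xy}}{2y},\qquad \operatorname{sign}\zeta=\operatorname{sign}(y-x-1);$$ the right-hand side of the first equation is nonnegative, so $\zeta$ is well defined. Let $t(s)$ be the function with $\tfrac12 s^2=\phi(t)-\phi(t_0)$ that maps the real line increasingly onto $(0,\infty)$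 and maps the imaginary axis onto the path of steepest descent through $t_0$, $$t=re^{i\theta},\qquad r=\frac{\theta}{\xi\sin\theta}+\sqrt{1+\frac{\theta^2}{\xi^2\sin^2\theta}},\qquad -\pi<\theta<\pi,$$ where $s/i$ has the sign of $\theta$ on that path. Put $$f(s)=\frac{\zeta-s}{\rho-t(s)}\frac{dt}{ds},\quad f(\zeta)=1,\qquad g(s)=\frac{f(s)-f(\zeta)}{s-\zeta}=\sum_{k\ge0}g_ks^k,\qquad d_n(\zeta)=(-1)^n2^n\frac{\Gamma(n+\frac12)}{\Gamma(\frac12)}\,g_{2n},$$ where the value of $g$ at $s=\zeta$ is $f'(\zeta)$, and $$R_\mu(\zeta)=\frac{e^{-\frac12\mu\zeta^2}}{2\pi i}\int_{-i\infty}^{i\infty}e^{\frac12\mu s^2}g(s)\,ds .$$ (The quantities $R_\mu(\zeta)$, $d_n(\zeta)$, and $S_\mu(\zeta)$ below, depend on $x$ and $y$.) Then: 1. For all $\mu,x,y>0$ and $0<c<\rho$, with an absolutely convergent integral, $$Q_\mu(\mu x,\mu y)=\frac{e^{-\mu\phi(\rho)}}{2\pi i}\int_{c-i\infty}^{c+i\infty}e^{\mu\phi(t)}\frac{dt}{\rho-t}.$$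 2. For all $\mu,x,y>0$ the integral that defines $R_\mu(\zeta)$ converges absolutely, $R_\mu(\zeta)$ is real, and $$Q_\mu(\mu x,\mu y)=\tfrac12\operatorname{erfc}\left(\zeta\sqrt{\mu/2}\right)-R_\mu(\zeta),\qquad P_\mu(\mu x,\mu y)=\tfrac12\operatorname{erfc}\left(-\zeta\sqrt{\mu/2}\right)+R_\mu(\zeta).$$ 3. Write $R_\mu(\zeta)=\dfrac{e^{-\frac12\mu\zeta^2}}{\sqrt{2\pi\mu}}S_\mu(\zeta)$. Then $S_\mu(\zeta)\sim\sum_{n=0}^\infty d_n(\zeta)/\mu^n$ as $\mu\to\infty$, uniformly with respect to $x,y>0$: for every $N\ge0$ there are constants $C$ and $\mu_0>0$ that depend only on $N$ such that for all $\mu\ge\mu_0$ and all $x,y>0$ $$\Bigl|S_\mu(\zeta)-\sum_{n=0}^{N-1}\frac{d_n(\zeta)}{\mu^n}\Bigr|\le\frac{C}{\mu^N}.$$ 4. For $x,y>0$ with $y\ne x+1$, $$d_0(\zeta)=\frac1\zeta-\frac{1+2x+\sqrt{1+4xy}}{2(y-x-1)(1+4xy)^{1/4}}.$$ -/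

import Mathlib

open MeasureTheory Set

noncomputable section

namespace Marcum

/-- The modified Bessel function `I_ν(z)` of the first kind, for real order `ν` and `z > 0`. -/
def besselI (ν z : ℝ) : ℝ :=
  ∑' k : ℕ, (z / 2) ^ (ν + 2 * (k : ℝ)) / ((k.factorial : ℝ) * Real.Gamma (ν + k + 1))

/-- The integrand `x^{(1-μ)/2} t^{(μ-1)/2} e^{-t-x} I_{μ-1}(2√(xt))`. -/
def density (μ x t : ℝ) : ℝ :=
  x ^ ((1 - μ) / 2) *
    (t ^ ((μ - 1) / 2) * Real.exp (-t - x) * besselI (μ - 1) (2 * Real.sqrt (x * t)))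

/-- The generalized Marcum `Q`-function. -/
def Q (μ x y : ℝ) : ℝ := ∫ t in Ioi y, density μ x t

/-- The complementary function. -/
def P (μ x y : ℝ) : ℝ := ∫ t in Ioc 0 y, density μ x t

/-- The complementary error function. -/
def erfc (z : ℝ) : ℝ := 2 / Real.sqrt Real.pi * ∫ t in Ioi z, Real.exp (-t ^ 2)

/-- The right-hand side of the equation for `ζ ^ 2 / 2`. -/
def halfZetaSq (x y : ℝ) : ℝ :=
  x + y - Real.sqrt (1 + 4 * x * y) + Real.log ((1 + Real.sqrt (1 + 4 * x * y)) / (2 * y))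

/-- The quantity `ζ`, with the sign of `y - x - 1`. -/
def zeta (x y : ℝ) : ℝ := Real.sign (y - x - 1) * Real.sqrt (2 * halfZetaSq x y)

/-- `ξ = 2√(xy)`. -/
def xi (x y : ℝ) : ℝ := 2 * Real.sqrt (x * y)

/-- `ρ = √(y/x)`. -/
def rho (x y : ℝ) : ℝ := Real.sqrt (y / x)

/-- The phase function `φ(t) = ξ (t + 1/t) / 2 - ln t`, with the principal logarithm. -/
def phi (x y : ℝ) (t : ℂ) : ℂ := (xi x y : ℂ) / 2 * (t + 1 / t) - Complex.log t

/-- The positive saddle point `t₀` of `φ`. -/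
def saddle (x y : ℝ) : ℝ := (1 + Real.sqrt (1 + xi x y ^ 2)) / xi x y

/-- For real `t > 0`, the value of `s` with `s ^ 2 / 2 = φ(t) - φ(t₀)` and the sign of `t - t₀`. -/
def realCoord (x y t : ℝ) : ℝ :=
  Real.sign (t - saddle x y) *
    Real.sqrt (2 * ((phi x y (t : ℂ)).re - (phi x y (saddle x y : ℂ)).re))

/-- The map `s ↦ t(s)` for real `s`: the inverse of the bijection `realCoord` of `(0, ∞)`
onto the real line. -/
def tReal (x y s : ℝ) : ℝ := Function.invFunOn (realCoord x y) (Ioi 0) s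

/-- The function `f(s) = (ζ - s) / (ρ - t) * dt/ds` for real `s`, with `f(ζ) = 1`. -/
def fReal (x y s : ℝ) : ℝ :=
  if s = zeta x y then 1
  else (zeta x y - s) / (rho x y - tReal x y s) * deriv (tReal x y) s

/-- The function `g(s) = (f(s) - f(ζ)) / (s - ζ)` for real `s`, with `g(ζ) = f'(ζ)`. -/
def gReal (x y : ℝ) : ℝ → ℝ := dslope (fReal x y) (zeta x y)

/-- The coefficient `d_n = (-1)^n 2^n (1/2)_n g_{2n}`, where `g_k` is the coefficient of `s ^ k` in
the Taylor expansion of `g` at `0` and `(1/2)_n = Γ(n + 1/2) / Γ(1/2)`. -/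
def d (n : ℕ) (x y : ℝ) : ℝ :=
  (-1) ^ n * 2 ^ n * (Real.Gamma (n + 1 / 2) / Real.Gamma (1 / 2)) *
    (iteratedDeriv (2 * n) (gReal x y) 0 / ((2 * n).factorial : ℝ))

/-- The modulus `r = θ / (ξ sin θ) + √(1 + θ² / (ξ² sin² θ))` of the point with argument `θ` on the
path of steepest descent; `sinc θ = sin θ / θ` and `sinc 0 = 1`. -/
def pathRadius (x y θ : ℝ) : ℝ :=
  1 / (xi x y * Real.sinc θ) + Real.sqrt (1 + (1 / (xi x y * Real.sinc θ)) ^ 2)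

/-- The path of steepest descent through `t₀`, parametrized by the argument `θ ∈ (-π, π)`. -/
def path (x y θ : ℝ) : ℂ := (pathRadius x y θ : ℂ) * Complex.exp ((θ : ℂ) * Complex.I)

/-- For the point `t` with argument `θ` on the path, the real `σ` with the sign of `θ` such that
`s = i σ` satisfies `s ^ 2 / 2 = φ(t) - φ(t₀)`. -/
def pathCoord (x y θ : ℝ) : ℝ :=
  Real.sign θ *
    Real.sqrt (2 * ((phi x y (saddle x y : ℂ)).re - (phi x y (path x y θ)).re))

/-- The map `σ ↦ t(i σ)`: the point of the path of steepest descent that corresponds to `s = i σ`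
(`pathCoord` is a bijection of `(-π, π)` onto the real line). -/
def tImag (x y σ : ℝ) : ℂ :=
  path x y (Function.invFunOn (pathCoord x y) (Ioo (-Real.pi) Real.pi) σ)

/-- `f(i σ)`, where `f(s) = (ζ - s) / (ρ - t) * dt/ds` and `dt/ds = (1/i) dt/dσ`. -/
def fImag (x y σ : ℝ) : ℂ :=
  ((zeta x y : ℂ) - Complex.I * σ) / ((rho x y : ℂ) - tImag x y σ) *
    (deriv (tImag x y) σ / Complex.I)

/-- `g(i σ)`, where `g(s) = (f(s) - 1) / (s - ζ)`. -/
def gImag (x y σ : ℝ) : ℂ :=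
  (fImag x y σ - 1) / (Complex.I * σ - (zeta x y : ℂ))

/-- `e^{-μζ²/2} / (2πi) * ∫_{-i∞}^{i∞} e^{μs²/2} g(s) ds`, with `s = i σ` and `ds = i dσ`. -/
def remainderIntegral (μ x y : ℝ) : ℂ :=
  (Real.exp (-(μ * zeta x y ^ 2 / 2)) : ℂ) / (2 * Real.pi * Complex.I) *
    ∫ σ : ℝ, Complex.exp ((μ : ℂ) * (Complex.I * σ) ^ 2 / 2) * gImag x y σ * Complex.I

/-- The remainder `R_μ(ζ)`; `remainderIntegral` is a real number. -/
def R (μ x y : ℝ) : ℝ := (remainderIntegral μ x y).re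

/-- The function `S_μ(ζ)`, defined by `R_μ(ζ) = e^{-μζ²/2} / √(2πμ) * S_μ(ζ)`. -/
def S (μ x y : ℝ) : ℝ :=
  Real.sqrt (2 * Real.pi * μ) * Real.exp (μ * zeta x y ^ 2 / 2) * R μ x y

/-- The integrand, at `t = c + i v`, of `∫_{c-i∞}^{c+i∞} e^{μφ(t)} dt / (ρ - t)`, with
`dt = i dv`. -/
def contourIntegrand (μ x y c v : ℝ) : ℂ :=
  Complex.exp ((μ : ℂ) * phi x y ((c : ℂ) + Complex.I * v)) /
    ((rho x y : ℂ) - ((c : ℂ) + Complex.I * v)) * Complex.I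

end Marcum

end

/-! With v = log (t / t₀) the phase becomes φ(t₀) + ψ(v), where ψ(v) = A (cosh v - 1) + sinh v - v
and A = √(1 + 4xy) ≥ 1 (`phi_saddle_mul_exp`). So x and y enter only through A and the position b of
the pole, ρ = t₀ e^b. The variable s satisfies s² / 2 = ψ(v), and ζ is the value of s at v = b
(`zeta_eq`).

Exact representation. The density in Q and P is a Poisson mixture of Gamma densities, with Laplace
transform e^{-X} p^{-μ} e^{X/p} (`integral_density_mul_cexp`). Convolution with a one-sided
exponential divides the transform by 1 - p, and Fourier inversion gives Q from a line Re p < 1 and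
-P from a line Re p > 1 (`laplace_inversion`); the substitution t = ρ p yields the contour integral
(`Q_eq_contour`, `neg_P_eq_contour`). The vertical line through t₀ is moved onto the path of
steepest descent (`integral_deformation`). There the integrand is a Gaussian times (dt/ds) / (ρ - t)
= 1 / (ζ - s) - g(s). The first term integrates to the complementary error function
(`integral_gaussian_div_of_pos`), the second is the remainder. The sign of ρ - t₀ decides whether Q
or P appears, and P + Q = 1 reconciles the two cases. When ρ = t₀ the line meets the pole, and the
identity follows by letting ρ decrease to t₀ with ξ fixed (`remainderIntegral_of_saddle_eq`).

Uniformity. Two bounds on g with absolute constants suffice. Near the saddle, the root of 2ψ(v) / A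
is so close to v, for all A ≥ 1 at once (`norm_chart_sub_le`), that s ↦ v is holomorphic on |s| < √A
/ 50. There g has only a removable singularity at ζ. If ζ is far from 0, both terms of g are bounded
separately; if it is near, g is bounded on a circle around ζ and the origin and the maximum
principle applies (`norm_extension_le`). Away from the saddle, the argument θ of t is bounded away
from 0 and |θ| ≤ |ψ'(v)| on the path (`abs_pathArg_le_norm_psiDeriv`), so g grows at most linearly
(`norm_gImag_le`). The expansion is then Watson's lemma with explicit constants: the Taylor
polynomial of g is integrated against the Gaussian, odd moments vanish, even moments produce d_n,
and the Taylor remainder is dominated by moments of order 2N and 2N + 2 (`abs_S_sub_le`). The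
formula for d_0 is the value g(0), where dv/ds = 1 / √A. -/

noncomputable section

namespace Marcum

/-! ### The local chart at the saddle, uniformly in A ≥ 1 -/

/-- The phase function in the logarithmic coordinate `v = log (t / t₀)`, normalized to vanish
at the saddle point. -/
def psi (A : ℝ) (v : ℂ) : ℂ := A * (Complex.cosh v - 1) + Complex.sinh v - v

lemma hasDerivAt_psi (A : ℝ) (v : ℂ) :
    HasDerivAt (psi A) (A * Complex.sinh v + Complex.cosh v - 1) v := by
  unfold psi
  have h1 := ((Complex.hasDerivAt_cosh v).sub_const 1).const_mul (A : ℂ)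
  exact (h1.add (Complex.hasDerivAt_sinh v)).sub (hasDerivAt_id v)

@[simp] lemma psi_zero (A : ℝ) : psi A 0 = 0 := by simp [psi]

lemma psi_conj (A : ℝ) (v : ℂ) : psi A (starRingEnd ℂ v) = starRingEnd ℂ (psi A v) := by
  simp [psi, Complex.cosh_conj, Complex.sinh_conj]

/-- The holomorphic extension of `2 ψ(v) / (A v²)`. -/
def psiQuot (A : ℝ) : ℂ → ℂ := dslope (dslope (fun v => 2 * psi A v / A) 0) 0

lemma differentiable_psiQuot (A : ℝ) : Differentiable ℂ (psiQuot A) := by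
  have h0 : DifferentiableOn ℂ (fun v => 2 * psi A v / A) univ := fun v _ =>
    (((hasDerivAt_psi A v).const_mul 2).div_const _).differentiableAt.differentiableWithinAt
  have h1 := (Complex.differentiableOn_dslope (c := 0) Filter.univ_mem).2 h0
  have h2 := (Complex.differentiableOn_dslope (c := 0) Filter.univ_mem).2 h1
  exact differentiableOn_univ.1 h2

/-- `psi A` vanishes to second order at `0`, so the base values in both divided differences are
zero. -/
lemma psiQuot_of_ne {A : ℝ} {v : ℂ} (hv : v ≠ 0) :
    psiQuot A v = 2 * psi A v / A / v ^ 2 := by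
  have hd : deriv (fun v => 2 * psi A v / A) 0 = 0 := by
    rw [(((hasDerivAt_psi A 0).const_mul 2).div_const _).deriv]; simp
  rw [psiQuot, dslope_of_ne _ hv, slope_def_field, dslope_of_ne _ hv, dslope_same, hd,
    slope_def_field]
  simp only [psi_zero]
  field_simp
  simp
  ring

lemma norm_exp_sub_quadratic_le {v : ℂ} (hv : ‖v‖ ≤ 1) :
    ‖Complex.exp v - (1 + v + v ^ 2 / 2)‖ ≤ 2 / 9 * ‖v‖ ^ 3 := by
  have h := Complex.exp_bound hv (n := 3) (by norm_num)
  simp only [Finset.sum_range_succ, Finset.sum_range_zero, Nat.factorial] at h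
  norm_num at h
  linarith

/-- With `p`, `m` the cubic remainders of `e^v`, `e^{-v}`, the difference is `((p + m) + (p - m) /
A) / v²`. Since `A ≥ 1` it is at most `2 (‖p‖ + ‖m‖) / ‖v‖² ≤ (8/9) ‖v‖`, a bound free of `A`. -/
lemma norm_psiQuot_sub_one_le {A : ℝ} (hA : 1 ≤ A) {v : ℂ} (hv : ‖v‖ ≤ 1) :
    ‖psiQuot A v - 1‖ ≤ ‖v‖ := by
  have key : ∀ v : ℂ, v ≠ 0 → ‖v‖ ≤ 1 → ‖psiQuot A v - 1‖ ≤ ‖v‖ := by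
    intro v hv0 hv
    have hp := norm_exp_sub_quadratic_le hv
    have hm := norm_exp_sub_quadratic_le (v := -v) (by simpa using hv)
    rw [norm_neg] at hm
    set p := Complex.exp v - (1 + v + v ^ 2 / 2) with hpd
    set m := Complex.exp (-v) - (1 + -v + (-v) ^ 2 / 2) with hmd
    have hAc : (A : ℂ) ≠ 0 := by exact_mod_cast (by linarith : A ≠ 0)
    have hq : psiQuot A v - 1 = ((p + m) + (p - m) / A) / v ^ 2 := by
      rw [psiQuot_of_ne hv0, psi, Complex.cosh, Complex.sinh, hpd, hmd]
      field_simp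
      ring
    have hvp : 0 < ‖v‖ := norm_pos_iff.2 hv0
    have hAn : ‖(A : ℂ)‖ = A := by simp; linarith
    rw [hq, norm_div, norm_pow, div_le_iff₀ (by positivity)]
    have e1 : ‖(p - m) / (A : ℂ)‖ ≤ ‖p‖ + ‖m‖ := by
      rw [norm_div, hAn]
      calc ‖p - m‖ / A ≤ ‖p - m‖ / 1 := by gcongr
        _ ≤ _ := by rw [div_one]; exact norm_sub_le _ _
    calc ‖(p + m) + (p - m) / A‖ ≤ ‖p + m‖ + ‖(p - m) / (A : ℂ)‖ := norm_add_le _ _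
      _ ≤ (‖p‖ + ‖m‖) + (‖p‖ + ‖m‖) := add_le_add (norm_add_le _ _) e1
      _ ≤ ‖v‖ * ‖v‖ ^ 2 := by nlinarith [pow_pos hvp 3]
  -- At `v = 0` the bound is inherited by continuity from the punctured disc.
  rcases eq_or_ne v 0 with rfl | hv0
  · have hc : Continuous fun v : ℂ => ‖psiQuot A v - 1‖ - ‖v‖ := by
      have := (differentiable_psiQuot A).continuous
      fun_prop
    have : ‖psiQuot A 0 - 1‖ - ‖(0 : ℂ)‖ ≤ 0 := by
      refine le_of_tendsto (x := nhdsWithin 0 {0}ᶜ) (hc.continuousAt.mono_left nhdsWithin_le_nhds) ?_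
      have hb : Metric.ball (0 : ℂ) 1 ∈ nhdsWithin (0 : ℂ) {0}ᶜ :=
        mem_nhdsWithin_of_mem_nhds (Metric.ball_mem_nhds _ one_pos)
      filter_upwards [hb, self_mem_nhdsWithin] with w hw hw0
      have := key w hw0 (by simpa using (mem_ball_zero_iff.1 hw).le)
      linarith
    linarith
  · exact key v hv0 hv

lemma psiQuot_zero {A : ℝ} (hA : 1 ≤ A) : psiQuot A 0 = 1 := by
  have := norm_psiQuot_sub_one_le hA (v := 0) (by simp)
  rw [norm_zero, norm_le_zero_iff, sub_eq_zero] at this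
  exact this

lemma psiQuot_mem_slitPlane {A : ℝ} (hA : 1 ≤ A) {v : ℂ} (hv : ‖v‖ < 1) :
    psiQuot A v ∈ Complex.slitPlane := by
  have := Complex.mem_slitPlane_of_norm_lt_one
    ((norm_psiQuot_sub_one_le hA hv.le).trans_lt hv)
  simpa using this

/-- The local coordinate `v √(2 ψ(v) / (A v²))` at the saddle point. -/
def chart (A : ℝ) (v : ℂ) : ℂ := v * Complex.exp (Complex.log (psiQuot A v) / 2)

@[simp] lemma chart_zero (A : ℝ) : chart A 0 = 0 := by simp [chart]

lemma chart_sq {A : ℝ} (hA : 1 ≤ A) {v : ℂ} (hv : ‖v‖ < 1) :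
    chart A v ^ 2 = 2 * psi A v / A := by
  rw [chart, mul_pow, ← Complex.exp_nat_mul]
  have : ((2 : ℕ) : ℂ) * (Complex.log (psiQuot A v) / 2) = Complex.log (psiQuot A v) := by
    push_cast; ring
  rw [this, Complex.exp_log (Complex.slitPlane_ne_zero (psiQuot_mem_slitPlane hA hv))]
  rcases eq_or_ne v 0 with rfl | h0
  · simp
  · rw [psiQuot_of_ne h0]; field_simp

/-- The principal root `q` of `psiQuot A v` has nonnegative real part, hence `‖q + 1‖ ≥ 1`, and
`psiQuot A v - 1 = (q - 1) (q + 1)` gives `‖q - 1‖ ≤ ‖v‖`. -/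
lemma norm_chart_sub_le {A : ℝ} (hA : 1 ≤ A) {v : ℂ} (hv : ‖v‖ < 1) :
    ‖chart A v - v‖ ≤ ‖v‖ ^ 2 := by
  set q := Complex.exp (Complex.log (psiQuot A v) / 2) with hq
  have hsl := psiQuot_mem_slitPlane hA hv
  have hqq : q ^ 2 = psiQuot A v := by
    rw [hq, ← Complex.exp_nat_mul]
    have : ((2 : ℕ) : ℂ) * (Complex.log (psiQuot A v) / 2) = Complex.log (psiQuot A v) := by
      push_cast; ring
    rw [this, Complex.exp_log (Complex.slitPlane_ne_zero hsl)]
  have hre : 0 ≤ q.re := by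
    rw [hq, Complex.exp_re]
    have him : (Complex.log (psiQuot A v) / 2).im = Complex.arg (psiQuot A v) / 2 := by
      simp [Complex.log_im]
    rw [him]
    have h1 := Complex.neg_pi_lt_arg (psiQuot A v)
    have h2 := Complex.arg_le_pi (psiQuot A v)
    have := Real.cos_nonneg_of_neg_pi_div_two_le_of_le (x := Complex.arg (psiQuot A v) / 2)
      (by linarith) (by linarith)
    positivity
  have h1 : 1 ≤ ‖q + 1‖ := by
    have := Complex.re_le_norm (q + 1)
    simp at this
    linarith
  have hfac : psiQuot A v - 1 = (q - 1) * (q + 1) := by rw [← hqq]; ring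
  have h2 : ‖q - 1‖ ≤ ‖v‖ := by
    have h3 := norm_psiQuot_sub_one_le hA hv.le
    rw [hfac, norm_mul] at h3
    nlinarith [norm_nonneg (q - 1)]
  have : chart A v - v = v * (q - 1) := by rw [chart, ← hq]; ring
  rw [this, norm_mul, sq]
  gcongr

lemma differentiableAt_chart {A : ℝ} (hA : 1 ≤ A) {v : ℂ} (hv : ‖v‖ < 1) :
    DifferentiableAt ℂ (chart A) v := by
  unfold chart
  have h := (differentiable_psiQuot A v).clog (psiQuot_mem_slitPlane hA hv)
  fun_prop

lemma hasDerivAt_chart_zero {A : ℝ} (hA : 1 ≤ A) : HasDerivAt (chart A) 1 0 := by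
  have h := (differentiable_psiQuot A 0).clog (psiQuot_mem_slitPlane hA (v := 0) (by simp))
  have h2 : DifferentiableAt ℂ (fun v => Complex.exp (Complex.log (psiQuot A v) / 2)) 0 := by
    fun_prop
  have h3 : HasDerivAt (chart A) _ 0 := (hasDerivAt_id (0 : ℂ)).mul h2.hasDerivAt
  simp only [psiQuot_zero hA] at h3
  convert h3 using 1
  simp

/-- Cauchy's estimate on the circle of radius `1/40` about `v`: there `‖z‖ ≤ 1/20`, so the function
is at most `1/400`. -/
lemma norm_deriv_chart_sub_one_le {A : ℝ} (hA : 1 ≤ A) {v : ℂ} (hv : ‖v‖ < 1 / 40) :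
    ‖deriv (fun z => chart A z - z) v‖ ≤ 1 / 10 := by
  have hin : ∀ z ∈ Metric.closedBall v (1 / 40), ‖z‖ ≤ 1 / 20 := by
    intro z hz
    rw [mem_closedBall_iff_norm] at hz
    calc ‖z‖ = ‖(z - v) + v‖ := by ring_nf
      _ ≤ ‖z - v‖ + ‖v‖ := norm_add_le _ _
      _ ≤ 1 / 20 := by linarith
  have hdiff : ∀ z ∈ Metric.closedBall v (1 / 40), DifferentiableAt ℂ (fun z => chart A z - z) z :=
    fun z hz => (differentiableAt_chart hA (by linarith [hin z hz])).sub differentiableAt_id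
  have := Complex.norm_deriv_le_of_forall_mem_sphere_norm_le (c := v) (R := 1 / 40) (C := 1 / 400)
    (f := fun z => chart A z - z) (by norm_num) ?_ ?_
  · norm_num at this ⊢; exact this
  · refine DifferentiableOn.diffContOnCl ?_
    rw [closure_ball _ (by norm_num)]
    exact fun z hz => (hdiff z hz).differentiableWithinAt
  · intro z hz
    have hz' := hin z (Metric.sphere_subset_closedBall hz)
    have := norm_chart_sub_le hA (v := z) (by linarith)
    nlinarith [norm_nonneg z]

lemma norm_chart_sub_chart_sub_le {A : ℝ} (hA : 1 ≤ A) {v w : ℂ} (hv : ‖v‖ < 1 / 40)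
    (hw : ‖w‖ < 1 / 40) : ‖chart A v - chart A w - (v - w)‖ ≤ 1 / 10 * ‖v - w‖ := by
  have := Convex.norm_image_sub_le_of_norm_deriv_le (f := fun z => chart A z - z)
    (s := Metric.ball (0 : ℂ) (1 / 40)) (C := 1 / 10) (x := w) (y := v)
    (fun z hz => (differentiableAt_chart hA (by
      have := mem_ball_zero_iff.1 hz; linarith)).sub differentiableAt_id)
    (fun z hz => norm_deriv_chart_sub_one_le hA (mem_ball_zero_iff.1 hz))
    (convex_ball _ _) (mem_ball_zero_iff.2 hw) (mem_ball_zero_iff.2 hv)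
  rw [show chart A v - chart A w - (v - w) = (chart A v - v) - (chart A w - w) by ring]
  exact this

lemma exists_chart_eq {A : ℝ} (hA : 1 ≤ A) {w : ℂ} (hw : ‖w‖ < 1 / 50) :
    ∃ v ∈ Metric.ball (0 : ℂ) (1 / 40), chart A v = w := by
  have happ : ApproximatesLinearOn (chart A) ((ContinuousLinearEquiv.refl ℂ ℂ : ℂ ≃L[ℂ] ℂ) : ℂ →L[ℂ] ℂ)
      (Metric.ball (0 : ℂ) (1 / 40)) (1 / 10) := by
    intro v hv z hz
    have := norm_chart_sub_chart_sub_le hA (mem_ball_zero_iff.1 hv) (mem_ball_zero_iff.1 hz)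
    simpa using this
  -- Any radius `ε < 1/40` with `(1 - 1/10) ε ≥ 1/50` would do: the image of the `ε`-ball contains
  -- the ball of radius `(1 - 1/10) ε`.
  have hsub : Metric.closedBall (0 : ℂ) (1 / 42) ⊆ Metric.ball 0 (1 / 40) :=
    Metric.closedBall_subset_ball (by norm_num)
  have hs := happ.surjOn_closedBall_of_nonlinearRightInverse
    (ContinuousLinearEquiv.toNonlinearRightInverse (ContinuousLinearEquiv.refl ℂ ℂ))
    (by norm_num : (0 : ℝ) ≤ 1 / 42) hsub
  have hn : ((ContinuousLinearEquiv.toNonlinearRightInverse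
      (ContinuousLinearEquiv.refl ℂ ℂ)).nnnorm : ℝ) = 1 := by
    show ‖((ContinuousLinearEquiv.refl ℂ ℂ).symm : ℂ →L[ℂ] ℂ)‖ = 1
    exact ContinuousLinearMap.norm_id
  rw [hn, chart_zero] at hs
  obtain ⟨v, hv, hvw⟩ := hs (a := w) (by rw [mem_closedBall_zero_iff]; norm_num; linarith)
  exact ⟨v, hsub hv, hvw⟩

/-- The local inverse of `chart A`. -/
def localInv (A : ℝ) (w : ℂ) : ℂ :=
  Function.invFunOn (chart A) (Metric.ball (0 : ℂ) (1 / 40)) w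

lemma norm_localInv_lt {A : ℝ} (hA : 1 ≤ A) {w : ℂ} (hw : ‖w‖ < 1 / 50) :
    ‖localInv A w‖ < 1 / 40 :=
  mem_ball_zero_iff.1 (Function.invFunOn_mem (exists_chart_eq hA hw))

lemma chart_localInv {A : ℝ} (hA : 1 ≤ A) {w : ℂ} (hw : ‖w‖ < 1 / 50) :
    chart A (localInv A w) = w := Function.invFunOn_eq (exists_chart_eq hA hw)

lemma chart_injOn {A : ℝ} (hA : 1 ≤ A) {v w : ℂ} (hv : ‖v‖ < 1 / 40) (hw : ‖w‖ < 1 / 40)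
    (h : chart A v = chart A w) : v = w := by
  have := norm_chart_sub_chart_sub_le hA hv hw
  rw [h, sub_self, zero_sub, norm_neg] at this
  have h0 : ‖v - w‖ = 0 := by linarith [norm_nonneg (v - w)]
  exact sub_eq_zero.1 (norm_eq_zero.1 h0)

lemma localInv_eq {A : ℝ} (hA : 1 ≤ A) {v w : ℂ} (hw : ‖w‖ < 1 / 50) (hv : ‖v‖ < 1 / 40)
    (h : chart A v = w) : localInv A w = v :=
  chart_injOn hA (norm_localInv_lt hA hw) hv (by rw [chart_localInv hA hw, h])

lemma localInv_zero {A : ℝ} (hA : 1 ≤ A) : localInv A 0 = 0 :=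
  localInv_eq hA (by simp) (by simp) (by simp)

/-- The defect `1/10` of `chart` from the identity becomes `(1/10) / (1 - 1/10) = 1/9` for the
inverse. -/
lemma norm_localInv_sub_sub_le {A : ℝ} (hA : 1 ≤ A) {w z : ℂ} (hw : ‖w‖ < 1 / 50)
    (hz : ‖z‖ < 1 / 50) :
    ‖localInv A w - localInv A z - (w - z)‖ ≤ 1 / 9 * ‖w - z‖ := by
  have h := norm_chart_sub_chart_sub_le hA (norm_localInv_lt hA hw) (norm_localInv_lt hA hz)
  rw [chart_localInv hA hw, chart_localInv hA hz, norm_sub_rev] at h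
  have h2 : ‖localInv A w - localInv A z‖ ≤ ‖localInv A w - localInv A z - (w - z)‖ + ‖w - z‖ := by
    simpa using norm_add_le (localInv A w - localInv A z - (w - z)) (w - z)
  linarith

lemma norm_localInv_sub_le {A : ℝ} (hA : 1 ≤ A) {w : ℂ} (hw : ‖w‖ < 1 / 50) :
    ‖localInv A w - w‖ ≤ 1 / 9 * ‖w‖ := by
  have := norm_localInv_sub_sub_le hA hw (z := 0) (by simp)
  simpa [localInv_zero hA] using this

lemma continuousOn_localInv {A : ℝ} (hA : 1 ≤ A) :
    ContinuousOn (localInv A) (Metric.ball 0 (1 / 50)) := by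
  have : LipschitzOnWith 2 (localInv A) (Metric.ball 0 (1 / 50)) := by
    refine LipschitzOnWith.of_dist_le_mul fun w hw z hz => ?_
    have h := norm_localInv_sub_sub_le hA (mem_ball_zero_iff.1 hw) (mem_ball_zero_iff.1 hz)
    have h2 := norm_add_le (localInv A w - localInv A z - (w - z)) (w - z)
    rw [sub_add_cancel] at h2
    rw [dist_eq_norm, dist_eq_norm]
    push_cast
    linarith [norm_nonneg (w - z)]
  exact this.continuousOn

lemma deriv_chart_ne_zero {A : ℝ} (hA : 1 ≤ A) {v : ℂ} (hv : ‖v‖ < 1 / 40) :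
    9 / 10 ≤ ‖deriv (chart A) v‖ := by
  have h := norm_deriv_chart_sub_one_le hA hv
  change ‖deriv (chart A - id) v‖ ≤ _ at h
  rw [((differentiableAt_chart hA (by linarith)).hasDerivAt.sub (hasDerivAt_id v)).deriv] at h
  have h2 := norm_sub_norm_le (1 : ℂ) (1 - deriv (chart A) v)
  rw [norm_sub_rev] at h
  rw [norm_one, sub_sub_cancel] at h2
  linarith

lemma hasDerivAt_localInv {A : ℝ} (hA : 1 ≤ A) {w : ℂ} (hw : ‖w‖ < 1 / 50) :
    HasDerivAt (localInv A) (deriv (chart A) (localInv A w))⁻¹ w := by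
  have hn : Metric.ball (0 : ℂ) (1 / 50) ∈ nhds w :=
    Metric.isOpen_ball.mem_nhds (mem_ball_zero_iff.2 hw)
  have hl := norm_localInv_lt hA hw
  refine HasDerivAt.of_local_left_inverse ((continuousOn_localInv hA).continuousAt hn)
    (differentiableAt_chart hA (by linarith)).hasDerivAt ?_ ?_
  · intro h
    have := deriv_chart_ne_zero hA hl
    rw [h] at this
    norm_num at this
  · filter_upwards [hn] with z hz using chart_localInv hA (mem_ball_zero_iff.1 hz)

lemma norm_deriv_localInv_le {A : ℝ} (hA : 1 ≤ A) {w : ℂ} (hw : ‖w‖ < 1 / 50) :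
    ‖deriv (localInv A) w‖ ≤ 2 := by
  rw [(hasDerivAt_localInv hA hw).deriv, norm_inv]
  have := deriv_chart_ne_zero hA (norm_localInv_lt hA hw)
  exact (inv_anti₀ (by norm_num) this).trans (by norm_num)

lemma deriv_localInv_ne_zero {A : ℝ} (hA : 1 ≤ A) {w : ℂ} (hw : ‖w‖ < 1 / 50) :
    deriv (localInv A) w ≠ 0 := by
  rw [(hasDerivAt_localInv hA hw).deriv]
  have := deriv_chart_ne_zero hA (norm_localInv_lt hA hw)
  exact inv_ne_zero (norm_pos_iff.1 (by linarith))

lemma deriv_localInv_zero {A : ℝ} (hA : 1 ≤ A) : deriv (localInv A) 0 = 1 := by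
  rw [(hasDerivAt_localInv hA (w := 0) (by simp)).deriv, localInv_zero hA,
    (hasDerivAt_chart_zero hA).deriv, inv_one]

/-- The coordinate `v` as a function of `s`, near the saddle point. -/
def localV (A : ℝ) (s : ℂ) : ℂ := localInv A (s / Real.sqrt A)

lemma norm_div_sqrt {A : ℝ} (s : ℂ) : ‖s / Real.sqrt A‖ = ‖s‖ / Real.sqrt A := by
  rw [norm_div, Complex.norm_real, Real.norm_of_nonneg (Real.sqrt_nonneg _)]

lemma norm_div_sqrt_lt {A c : ℝ} (hA : 1 ≤ A) {s : ℂ} (hs : ‖s‖ < c * Real.sqrt A) :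
    ‖s / Real.sqrt A‖ < c := by
  rw [norm_div_sqrt, div_lt_iff₀ (Real.sqrt_pos.2 (by linarith))]
  exact hs

/-- Dividing `s` by `√A` absorbs the factor `A` in `chart² = 2 ψ / A`; the disc for `s` therefore
only grows with `A`. -/
lemma psi_localV {A : ℝ} (hA : 1 ≤ A) {s : ℂ} (hs : ‖s‖ < 1 / 50 * Real.sqrt A) :
    psi A (localV A s) = s ^ 2 / 2 := by
  have hw := norm_div_sqrt_lt hA hs
  have hl := norm_localInv_lt hA hw
  have h := chart_sq hA (v := localV A s) (by unfold localV; linarith)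
  unfold localV at h ⊢
  rw [chart_localInv hA hw, div_pow] at h
  have h2 : ((Real.sqrt A : ℝ) : ℂ) ^ 2 = A := by
    exact_mod_cast congrArg (fun x : ℝ => (x : ℂ)) (Real.sq_sqrt (by linarith : (0 : ℝ) ≤ A))
  have hAc : (A : ℂ) ≠ 0 := by exact_mod_cast (by linarith : A ≠ 0)
  rw [h2] at h
  field_simp at h
  rw [h]; ring

lemma hasDerivAt_localV {A : ℝ} (hA : 1 ≤ A) {s : ℂ} (hs : ‖s‖ < 1 / 50 * Real.sqrt A) :
    HasDerivAt (localV A) (deriv (localInv A) (s / Real.sqrt A) / Real.sqrt A) s := by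
  have h := (hasDerivAt_localInv hA (norm_div_sqrt_lt hA hs))
  have h2 : HasDerivAt (localV A) _ s := HasDerivAt.comp s h.differentiableAt.hasDerivAt
    ((hasDerivAt_id s).div_const ((Real.sqrt A : ℝ) : ℂ))
  convert h2 using 1
  simp [div_eq_mul_inv]

/-- `psi` has real coefficients, and the principal logarithm commutes with conjugation off the
negative axis. This makes `localV` real on the real axis. -/
lemma chart_conj {A : ℝ} (hA : 1 ≤ A) {v : ℂ} (hv : ‖v‖ < 1) :
    chart A (starRingEnd ℂ v) = starRingEnd ℂ (chart A v) := by
  rcases eq_or_ne v 0 with rfl | h0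
  · simp
  have h1 : psiQuot A (starRingEnd ℂ v) = starRingEnd ℂ (psiQuot A v) := by
    rw [psiQuot_of_ne h0, psiQuot_of_ne (by simpa using h0), psi_conj]
    simp [map_ofNat]
  have hsl := psiQuot_mem_slitPlane hA hv
  rw [chart, chart, h1, Complex.log_conj _ (Complex.slitPlane_arg_ne_pi hsl)]
  rw [map_mul, ← Complex.exp_conj]
  simp [map_ofNat]

lemma localInv_conj {A : ℝ} (hA : 1 ≤ A) {w : ℂ} (hw : ‖w‖ < 1 / 50) :
    localInv A (starRingEnd ℂ w) = starRingEnd ℂ (localInv A w) := by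
  have hl := norm_localInv_lt hA hw
  refine localInv_eq hA (by simpa using hw) (by simpa using hl) ?_
  rw [chart_conj hA (by linarith), chart_localInv hA hw]

/-! ### Identities between A, ξ, t₀, ρ and the pole coordinate -/

/-- The parameter `A = √(1 + 4xy) = √(1 + ξ²)`. -/
def amp (x y : ℝ) : ℝ := Real.sqrt (1 + 4 * x * y)

/-- The logarithmic coordinate of the pole, `ρ = t₀ e^b`. -/
def poleCoord (x y : ℝ) : ℝ := Real.log (rho x y / saddle x y)

section Parameters

variable {x y : ℝ}

lemma one_lt_amp (hx : 0 < x) (hy : 0 < y) : 1 < amp x y := by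
  rw [amp, Real.lt_sqrt (by norm_num)]
  nlinarith [mul_pos hx hy]

lemma amp_sq (hx : 0 < x) (hy : 0 < y) : amp x y ^ 2 = 1 + 4 * x * y :=
  Real.sq_sqrt (by nlinarith [mul_pos hx hy])

lemma xi_pos (hx : 0 < x) (hy : 0 < y) : 0 < xi x y :=
  mul_pos two_pos (Real.sqrt_pos.2 (mul_pos hx hy))

lemma xi_sq (hx : 0 < x) (hy : 0 < y) : xi x y ^ 2 = 4 * x * y := by
  rw [xi, mul_pow, Real.sq_sqrt (mul_pos hx hy).le]; ring

lemma xi_sq_eq_amp (hx : 0 < x) (hy : 0 < y) : xi x y ^ 2 = amp x y ^ 2 - 1 := by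
  rw [xi_sq hx hy, amp_sq hx hy]; ring

lemma saddle_eq (hx : 0 < x) (hy : 0 < y) : saddle x y = (1 + amp x y) / xi x y := by
  rw [saddle, xi_sq hx hy, amp, mul_assoc]

lemma saddle_pos (hx : 0 < x) (hy : 0 < y) : 0 < saddle x y := by
  rw [saddle_eq hx hy]
  exact div_pos (by linarith [one_lt_amp hx hy]) (xi_pos hx hy)

lemma xi_mul_saddle (hx : 0 < x) (hy : 0 < y) : xi x y * saddle x y = 1 + amp x y := by
  rw [saddle_eq hx hy]; field_simp [(xi_pos hx hy).ne']

lemma xi_div_saddle (hx : 0 < x) (hy : 0 < y) : xi x y / saddle x y = amp x y - 1 := by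
  rw [div_eq_iff (saddle_pos hx hy).ne', saddle_eq hx hy]
  field_simp [(xi_pos hx hy).ne']
  rw [xi_sq_eq_amp hx hy]; ring

lemma rho_pos (hx : 0 < x) (hy : 0 < y) : 0 < rho x y := Real.sqrt_pos.2 (div_pos hy hx)

lemma rho_eq (hx : 0 < x) (hy : 0 < y) :
    rho x y = saddle x y * Real.exp (poleCoord x y) := by
  rw [poleCoord, Real.exp_log (div_pos (rho_pos hx hy) (saddle_pos hx hy))]
  field_simp [(saddle_pos hx hy).ne']

lemma xi_mul_rho (hx : 0 < x) (hy : 0 < y) : xi x y * rho x y = 2 * y := by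
  rw [xi, rho, mul_assoc, ← Real.sqrt_mul (mul_pos hx hy).le]
  rw [show x * y * (y / x) = y ^ 2 by field_simp, Real.sqrt_sq hy.le]

lemma xi_div_rho (hx : 0 < x) (hy : 0 < y) : xi x y / rho x y = 2 * x := by
  have h := xi_mul_rho hx hy
  have h2 := xi_sq hx hy
  rw [div_eq_iff (rho_pos hx hy).ne']
  have h3 := xi_pos hx hy
  have : xi x y * (xi x y - 2 * x * rho x y) = 0 := by linear_combination h2 - 2 * x * h
  have := (mul_eq_zero.1 this).resolve_left h3.ne'
  linarith

lemma exp_poleCoord (hx : 0 < x) (hy : 0 < y) :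
    Real.exp (poleCoord x y) = 2 * y / (1 + amp x y) := by
  rw [poleCoord, Real.exp_log (div_pos (rho_pos hx hy) (saddle_pos hx hy)),
    ← xi_mul_rho hx hy, ← xi_mul_saddle hx hy]
  field_simp [(xi_pos hx hy).ne', (saddle_pos hx hy).ne']

/-- Links `y - x - 1` to `2y - (1 + A) = (1 + A) (e^b - 1)`. It decides the sign of ζ and later
brings `d 0` into closed form. -/
lemma sign_aux (hx : 0 < x) (hy : 0 < y) :
    2 * (1 + amp x y) * (y - x - 1) = (1 + 2 * x + amp x y) * (2 * y - (1 + amp x y)) := by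
  linear_combination amp_sq hx hy

/-- The phase function in the coordinate `u = log t`. -/
lemma phi_exp (x y : ℝ) {u : ℂ} (h1 : -Real.pi < u.im) (h2 : u.im ≤ Real.pi) :
    phi x y (Complex.exp u) = xi x y * Complex.cosh u - u := by
  rw [phi, Complex.log_exp h1 h2, Complex.cosh, one_div, Complex.exp_neg]
  ring

lemma exp_log_saddle (hx : 0 < x) (hy : 0 < y) (v : ℂ) :
    Complex.exp (v + Real.log (saddle x y)) = saddle x y * Complex.exp v := by
  rw [Complex.exp_add, ← Complex.ofReal_exp, Real.exp_log (saddle_pos hx hy), mul_comm]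

lemma xi_mul_cosh (hx : 0 < x) (hy : 0 < y) (v : ℂ) :
    xi x y * Complex.cosh (v + Real.log (saddle x y)) =
      amp x y * Complex.cosh v + Complex.sinh v := by
  have h1 : (xi x y : ℂ) * saddle x y = 1 + amp x y := by exact_mod_cast xi_mul_saddle hx hy
  have h2 : (xi x y : ℂ) / saddle x y = amp x y - 1 := by exact_mod_cast xi_div_saddle hx hy
  rw [Complex.cosh, Complex.exp_neg, exp_log_saddle hx hy, mul_inv, ← Complex.exp_neg,
    Complex.cosh, Complex.sinh]
  rw [div_eq_mul_inv] at h2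
  linear_combination Complex.exp v / 2 * h1 + Complex.exp (-v) / 2 * h2

lemma xi_mul_sinh (hx : 0 < x) (hy : 0 < y) (v : ℂ) :
    xi x y * Complex.sinh (v + Real.log (saddle x y)) =
      amp x y * Complex.sinh v + Complex.cosh v := by
  have h1 : (xi x y : ℂ) * saddle x y = 1 + amp x y := by exact_mod_cast xi_mul_saddle hx hy
  have h2 : (xi x y : ℂ) / saddle x y = amp x y - 1 := by exact_mod_cast xi_div_saddle hx hy
  rw [Complex.sinh, Complex.exp_neg, exp_log_saddle hx hy, mul_inv, ← Complex.exp_neg,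
    Complex.cosh, Complex.sinh]
  rw [div_eq_mul_inv] at h2
  linear_combination Complex.exp v / 2 * h1 - Complex.exp (-v) / 2 * h2

lemma phi_saddle (hx : 0 < x) (hy : 0 < y) :
    phi x y (saddle x y) = (amp x y - Real.log (saddle x y) : ℝ) := by
  have := phi_exp x y (u := ((0 : ℂ) + Real.log (saddle x y)))
    (by simp [Real.pi_pos]) (by simp [Real.pi_pos.le])
  rw [exp_log_saddle hx hy, xi_mul_cosh hx hy] at this
  simpa using this

/-- Shifting by the real number `log t₀` turns `ξ cosh` into `A cosh + sinh` and leaves the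
imaginary part alone, so the principal logarithm causes no jump. -/
lemma phi_saddle_mul_exp (hx : 0 < x) (hy : 0 < y) {v : ℂ} (h1 : -Real.pi < v.im)
    (h2 : v.im ≤ Real.pi) :
    phi x y (saddle x y * Complex.exp v) = phi x y (saddle x y) + psi (amp x y) v := by
  have := phi_exp x y (u := (v + Real.log (saddle x y))) (by simpa using h1) (by simpa using h2)
  rw [exp_log_saddle hx hy, xi_mul_cosh hx hy] at this
  rw [this, phi_saddle hx hy, psi]
  push_cast; ring

end Parameters

/-! ### The coordinate s on the real axis, and ζ -/

/-- The restriction of `psi` to the real line. -/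
def psiReal (A v : ℝ) : ℝ := A * (Real.cosh v - 1) + Real.sinh v - v

lemma psi_ofReal (A v : ℝ) : psi A v = psiReal A v := by
  simp [psi, psiReal]

lemma hasDerivAt_psiReal (A v : ℝ) :
    HasDerivAt (psiReal A) (A * Real.sinh v + Real.cosh v - 1) v := by
  have h1 := ((Real.hasDerivAt_cosh v).sub_const 1).const_mul A
  exact (h1.add (Real.hasDerivAt_sinh v)).sub (hasDerivAt_id v)

@[simp] lemma psiReal_zero (A : ℝ) : psiReal A 0 = 0 := by simp [psiReal]

lemma continuous_psiReal (A : ℝ) : Continuous (psiReal A) :=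
  continuous_iff_continuousAt.2 fun v => (hasDerivAt_psiReal A v).continuousAt

lemma psiReal_strictMonoOn {A : ℝ} (hA : 1 ≤ A) : StrictMonoOn (psiReal A) (Ici 0) := by
  refine strictMonoOn_of_deriv_pos (convex_Ici 0) (continuous_psiReal A).continuousOn ?_
  intro v hv
  rw [interior_Ici, mem_Ioi] at hv
  rw [(hasDerivAt_psiReal A v).deriv]
  nlinarith [Real.sinh_pos_iff.2 hv, Real.one_le_cosh v]

lemma psiReal_strictAntiOn {A : ℝ} (hA : 1 ≤ A) : StrictAntiOn (psiReal A) (Iic 0) := by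
  refine strictAntiOn_of_deriv_neg (convex_Iic 0) (continuous_psiReal A).continuousOn ?_
  intro v hv
  rw [interior_Iic, mem_Iio] at hv
  rw [(hasDerivAt_psiReal A v).deriv]
  -- The derivative is `(A - 1) sinh v + (e^v - 1)`, a sum of a nonpositive and a negative term.
  have h1 : Real.cosh v + Real.sinh v = Real.exp v := Real.cosh_add_sinh v
  have h2 : Real.exp v < 1 := Real.exp_lt_one_iff.2 hv
  nlinarith [Real.sinh_neg_iff.2 hv]

lemma psiReal_pos {A : ℝ} (hA : 1 ≤ A) {v : ℝ} (hv : v ≠ 0) : 0 < psiReal A v := by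
  rcases lt_or_gt_of_ne hv with h | h
  · simpa using psiReal_strictAntiOn hA (mem_Iic.2 h.le) (mem_Iic.2 le_rfl) h
  · simpa using psiReal_strictMonoOn hA (mem_Ici.2 le_rfl) (mem_Ici.2 h.le) h

lemma psiReal_nonneg {A : ℝ} (hA : 1 ≤ A) (v : ℝ) : 0 ≤ psiReal A v := by
  rcases eq_or_ne v 0 with rfl | h
  · simp
  · exact (psiReal_pos hA h).le

/-- The coordinate `s` of a real point with logarithmic coordinate `v`. -/
def sReal (A v : ℝ) : ℝ := Real.sign v * Real.sqrt (2 * psiReal A v)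

@[simp] lemma sReal_zero (A : ℝ) : sReal A 0 = 0 := by simp [sReal]

lemma sReal_of_pos {A v : ℝ} (hv : 0 < v) : sReal A v = Real.sqrt (2 * psiReal A v) := by
  rw [sReal, Real.sign_of_pos hv, one_mul]

lemma sReal_of_neg {A v : ℝ} (hv : v < 0) : sReal A v = -Real.sqrt (2 * psiReal A v) := by
  rw [sReal, Real.sign_of_neg hv]; ring

lemma sReal_pos {A : ℝ} (hA : 1 ≤ A) {v : ℝ} (hv : 0 < v) : 0 < sReal A v := by
  rw [sReal_of_pos hv]
  exact Real.sqrt_pos.2 (mul_pos two_pos (psiReal_pos hA hv.ne'))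

lemma sReal_neg {A : ℝ} (hA : 1 ≤ A) {v : ℝ} (hv : v < 0) : sReal A v < 0 := by
  rw [sReal_of_neg hv, neg_lt_zero]
  exact Real.sqrt_pos.2 (mul_pos two_pos (psiReal_pos hA hv.ne))

lemma sReal_sq {A : ℝ} (hA : 1 ≤ A) (v : ℝ) : sReal A v ^ 2 = 2 * psiReal A v := by
  have h0 := psiReal_nonneg hA v
  rcases lt_trichotomy v 0 with h | rfl | h
  · rw [sReal_of_neg h, neg_sq, Real.sq_sqrt (by linarith)]
  · simp
  · rw [sReal_of_pos h, Real.sq_sqrt (by linarith)]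

lemma sReal_strictMono {A : ℝ} (hA : 1 ≤ A) : StrictMono (sReal A) := by
  intro v w hvw
  rcases lt_or_ge v 0 with hv | hv
  · rcases lt_or_ge w 0 with hw | hw
    · rw [sReal_of_neg hv, sReal_of_neg hw, neg_lt_neg_iff]
      have := psiReal_strictAntiOn hA (mem_Iic.2 hv.le) (mem_Iic.2 hw.le) hvw
      exact Real.sqrt_lt_sqrt (by linarith [psiReal_nonneg hA w]) (by linarith)
    · refine (sReal_neg hA hv).trans_le ?_
      rcases hw.eq_or_lt with h | h
      · rw [← h, sReal_zero]
      · exact (sReal_pos hA h).le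
  · have hw : 0 < w := hv.trans_lt hvw
    rcases hv.eq_or_lt with h | h
    · rw [← h, sReal_zero]; exact sReal_pos hA hw
    · rw [sReal_of_pos h, sReal_of_pos hw]
      have := psiReal_strictMonoOn hA (mem_Ici.2 hv) (mem_Ici.2 hw.le) hvw
      exact Real.sqrt_lt_sqrt (by linarith [psiReal_nonneg hA v]) (by linarith)

/-- Continuity at the saddle is all that the limit `ρ → t₀` requires. -/
lemma tendsto_sReal_zero {A : ℝ} (hA : 1 ≤ A) : Filter.Tendsto (sReal A) (nhds 0) (nhds 0) := by
  rw [tendsto_zero_iff_norm_tendsto_zero]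
  have h1 : ∀ v, ‖sReal A v‖ = Real.sqrt (2 * psiReal A v) := fun v => by
    rw [← sReal_sq hA, Real.sqrt_sq_eq_abs, Real.norm_eq_abs]
  simp_rw [h1]
  have : Continuous fun v => Real.sqrt (2 * psiReal A v) := by
    have := continuous_psiReal A
    fun_prop
  simpa using this.tendsto 0

section Parameters

variable {x y : ℝ}

lemma realCoord_saddle_mul_exp (hx : 0 < x) (hy : 0 < y) (v : ℝ) :
    realCoord x y (saddle x y * Real.exp v) = sReal (amp x y) v := by
  have hs := saddle_pos hx hy
  have h := phi_saddle_mul_exp hx hy (v := (v : ℂ)) (by simp [Real.pi_pos])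
    (by simp [Real.pi_pos.le])
  have hsign : Real.sign (saddle x y * Real.exp v - saddle x y) = Real.sign v := by
    rcases lt_trichotomy v 0 with hv | rfl | hv
    · have := Real.exp_lt_one_iff.2 hv
      rw [Real.sign_of_neg hv, Real.sign_of_neg (by nlinarith)]
    · simp
    · have := Real.one_lt_exp_iff.2 hv
      rw [Real.sign_of_pos hv, Real.sign_of_pos (by nlinarith)]
  rw [realCoord, sReal, hsign]
  congr 3
  push_cast
  rw [h, psi_ofReal]
  simp

lemma realCoord_injOn (hx : 0 < x) (hy : 0 < y) : InjOn (realCoord x y) (Ioi 0) := by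
  intro t ht u hu h
  have hs := saddle_pos hx hy
  have key : ∀ t, 0 < t → t = saddle x y * Real.exp (Real.log (t / saddle x y)) := fun t ht => by
    rw [Real.exp_log (div_pos ht hs)]; field_simp
  rw [key t ht, key u hu, realCoord_saddle_mul_exp hx hy, realCoord_saddle_mul_exp hx hy] at h
  rw [key t ht, key u hu, (sReal_strictMono (one_lt_amp hx hy).le).injective h]

lemma tReal_sReal (hx : 0 < x) (hy : 0 < y) (v : ℝ) :
    tReal x y (sReal (amp x y) v) = saddle x y * Real.exp v := by
  rw [← realCoord_saddle_mul_exp hx hy]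
  exact (realCoord_injOn hx hy).leftInvOn_invFunOn
    (mul_pos (saddle_pos hx hy) (Real.exp_pos v))

/-- The logarithm is `-b`, and `e^{±b}` are rational in `y` and `A`. Together with `psiReal_nonneg`
this shows that the square root in `zeta` is taken of a nonnegative number. -/
lemma halfZetaSq_eq (hx : 0 < x) (hy : 0 < y) :
    halfZetaSq x y = psiReal (amp x y) (poleCoord x y) := by
  have hA := one_lt_amp hx hy
  have h1 := exp_poleCoord hx hy
  have hlog : Real.log ((1 + amp x y) / (2 * y)) = - poleCoord x y := by
    rw [← Real.log_exp (poleCoord x y), h1, ← Real.log_inv, inv_div]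
  rw [halfZetaSq, ← amp, hlog, psiReal, Real.cosh_eq, Real.sinh_eq, Real.exp_neg, h1]
  field_simp
  linear_combination (-(1 + amp x y)) * amp_sq hx hy

lemma sign_poleCoord (hx : 0 < x) (hy : 0 < y) :
    Real.sign (y - x - 1) = Real.sign (poleCoord x y) := by
  have hA := one_lt_amp hx hy
  have h := sign_aux hx hy
  have hb := exp_poleCoord hx hy
  have h1 : (0 : ℝ) < 1 + amp x y := by linarith
  have h2 : (0 : ℝ) < 1 + 2 * x + amp x y := by linarith
  rcases lt_trichotomy (poleCoord x y) 0 with hv | hv | hv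
  · have := Real.exp_lt_one_iff.2 hv
    rw [hb, div_lt_one h1] at this
    rw [Real.sign_of_neg hv, Real.sign_of_neg]
    by_contra hc
    push Not at hc
    have : 0 ≤ 2 * (1 + amp x y) * (y - x - 1) := by positivity
    nlinarith
  · rw [hv, Real.exp_zero, eq_div_iff h1.ne'] at hb
    have : (1 + amp x y) * (y - x - 1) = 0 := by
      linear_combination h / 2 + (1 + 2 * x + amp x y) / 2 * (-hb)
    rw [hv, (mul_eq_zero.1 this).resolve_left h1.ne']
  · have := Real.one_lt_exp_iff.2 hv
    rw [hb, one_lt_div h1] at this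
    rw [Real.sign_of_pos hv, Real.sign_of_pos]
    by_contra hc
    push Not at hc
    have : 0 < (1 + 2 * x + amp x y) * (2 * y - (1 + amp x y)) := mul_pos h2 (by linarith)
    nlinarith

lemma zeta_eq (hx : 0 < x) (hy : 0 < y) : zeta x y = sReal (amp x y) (poleCoord x y) := by
  rw [zeta, sign_poleCoord hx hy, halfZetaSq_eq hx hy, sReal]

lemma sign_zeta (hx : 0 < x) (hy : 0 < y) :
    Real.sign (zeta x y) = Real.sign (poleCoord x y) := by
  have hA := (one_lt_amp hx hy).le
  rw [zeta_eq hx hy]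
  rcases lt_trichotomy (poleCoord x y) 0 with hv | hv | hv
  · rw [Real.sign_of_neg hv, Real.sign_of_neg (sReal_neg hA hv)]
  · simp [hv]
  · rw [Real.sign_of_pos hv, Real.sign_of_pos (sReal_pos hA hv)]

lemma zeta_sq (hx : 0 < x) (hy : 0 < y) :
    zeta x y ^ 2 / 2 = psiReal (amp x y) (poleCoord x y) := by
  rw [zeta_eq hx hy, sReal_sq (one_lt_amp hx hy).le]; ring

end Parameters

/-! ### Agreement of the local inverse with the real coordinate -/

lemma localV_ofReal_im {A : ℝ} (hA : 1 ≤ A) {s : ℝ} (hs : |s| < 1 / 50 * Real.sqrt A) :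
    (localV A s).im = 0 := by
  have hs' : ‖(s : ℂ) / Real.sqrt A‖ < 1 / 50 :=
    norm_div_sqrt_lt hA (by rwa [Complex.norm_real, Real.norm_eq_abs])
  have h := localInv_conj hA hs'
  rw [map_div₀, Complex.conj_ofReal, Complex.conj_ofReal] at h
  exact Complex.conj_eq_iff_im.1 h.symm

lemma norm_localV_sub_le {A : ℝ} (hA : 1 ≤ A) {s : ℂ} (hs : ‖s‖ < 1 / 50 * Real.sqrt A) :
    ‖localV A s - s / Real.sqrt A‖ ≤ 1 / 9 * (‖s‖ / Real.sqrt A) := by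
  have := norm_localInv_sub_le hA (norm_div_sqrt_lt hA hs)
  rwa [norm_div_sqrt] at this

/-- `psi_localV` determines the value only up to sign; the estimate `|v - s/√A| ≤ |s| / (9√A)`
forces `v` to have the sign of `s`. -/
lemma sReal_localV {A : ℝ} (hA : 1 ≤ A) {s : ℝ} (hs : |s| < 1 / 50 * Real.sqrt A) :
    sReal A (localV A s).re = s := by
  have hsn : ‖(s : ℂ)‖ < 1 / 50 * Real.sqrt A := by rwa [Complex.norm_real, Real.norm_eq_abs]
  have him := localV_ofReal_im hA hs
  have hre : localV A s = ((localV A s).re : ℂ) := by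
    apply Complex.ext <;> simp [him]
  have hpsi := psi_localV hA hsn
  rw [hre, psi_ofReal] at hpsi
  have hp : 2 * psiReal A (localV A s).re = s ^ 2 := by
    have : ((2 * psiReal A (localV A s).re : ℝ) : ℂ) = (s ^ 2 : ℝ) := by
      push_cast; rw [hpsi]; ring
    exact_mod_cast this
  have hq := Real.sqrt_pos.2 (by linarith : 0 < A)
  have hd : |(localV A s).re - s / Real.sqrt A| ≤ 1 / 9 * (|s| / Real.sqrt A) := by
    have h1 := norm_localV_sub_le hA hsn
    have h2 := Complex.abs_re_le_norm (localV A s - s / Real.sqrt A)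
    rw [Complex.sub_re, ← Complex.ofReal_div, Complex.ofReal_re] at h2
    rw [Complex.norm_real, Real.norm_eq_abs, ← Complex.ofReal_div] at h1
    exact h2.trans h1
  rw [abs_le] at hd
  rcases lt_trichotomy s 0 with h | rfl | h
  · have h3 : s / Real.sqrt A < 0 := div_neg_of_neg_of_pos h hq
    rw [abs_of_neg h, neg_div] at hd
    rw [sReal_of_neg (by linarith), hp, Real.sqrt_sq_eq_abs, abs_of_neg h, neg_neg]
  · simp [localV, localInv_zero hA]
  · have h3 : 0 < s / Real.sqrt A := div_pos h hq
    rw [abs_of_pos h] at hd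
    rw [sReal_of_pos (by linarith), hp, Real.sqrt_sq h.le]

lemma tReal_eq {x y : ℝ} (hx : 0 < x) (hy : 0 < y) {s : ℝ}
    (hs : |s| < 1 / 50 * Real.sqrt (amp x y)) :
    (tReal x y s : ℂ) = saddle x y * Complex.exp (localV (amp x y) s) := by
  have hA := (one_lt_amp hx hy).le
  have h := tReal_sReal hx hy (localV (amp x y) s).re
  rw [sReal_localV hA hs] at h
  have hre : localV (amp x y) s = ((localV (amp x y) s).re : ℂ) := by
    apply Complex.ext <;> simp [localV_ofReal_im hA hs]
  rw [h, hre]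
  push_cast
  simp

/-! ### Geometry of the path of steepest descent -/

lemma sinc_pos {θ : ℝ} (h1 : -Real.pi < θ) (h2 : θ < Real.pi) : 0 < Real.sinc θ := by
  rcases lt_trichotomy θ 0 with h | rfl | h
  · rw [← Real.sinc_neg, Real.sinc_of_ne_zero (by linarith)]
    exact div_pos (Real.sin_pos_of_pos_of_lt_pi (by linarith) (by linarith)) (by linarith)
  · simp
  · rw [Real.sinc_of_ne_zero h.ne']
    exact div_pos (Real.sin_pos_of_pos_of_lt_pi h h2) h

/-- The real part of the logarithm of the point with argument `θ` on the path. -/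
def pathLog (x y θ : ℝ) : ℝ := Real.arsinh (1 / (xi x y * Real.sinc θ))

/-- The coordinate `v = log (t / t₀)` of the point with argument `θ` on the path. -/
def pathV (x y θ : ℝ) : ℂ := (pathLog x y θ - Real.log (saddle x y) : ℝ) + θ * Complex.I

/-- The decrease of the phase along the path. -/
def drop (x y θ : ℝ) : ℝ :=
  (phi x y (saddle x y : ℂ)).re - (phi x y (path x y θ)).re

section

variable {x y : ℝ}

lemma exp_pathLog (x y θ : ℝ) : Real.exp (pathLog x y θ) = pathRadius x y θ := by
  rw [pathLog, Real.exp_arsinh, pathRadius]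

lemma pathRadius_pos (x y θ : ℝ) : 0 < pathRadius x y θ := by
  rw [← exp_pathLog]; exact Real.exp_pos _

lemma path_eq (x y θ : ℝ) : path x y θ = Complex.exp (pathLog x y θ + θ * Complex.I) := by
  rw [path, ← exp_pathLog, Complex.exp_add]; push_cast; rfl

lemma path_eq_saddle_mul (hx : 0 < x) (hy : 0 < y) (θ : ℝ) :
    path x y θ = saddle x y * Complex.exp (pathV x y θ) := by
  rw [← exp_log_saddle hx hy, path_eq, pathV]
  congr 1; push_cast; ring

@[simp] lemma pathV_im (x y θ : ℝ) : (pathV x y θ).im = θ := by simp [pathV]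

lemma phi_path {θ : ℝ} (h1 : -Real.pi < θ) (h2 : θ < Real.pi) :
    phi x y (path x y θ) =
      xi x y * Complex.cosh (pathLog x y θ + θ * Complex.I) - (pathLog x y θ + θ * Complex.I) := by
  rw [path_eq, phi_exp x y (by simpa using h1) (by simpa using h2.le)]

lemma cosh_add_mul_I (a θ : ℝ) : Complex.cosh (a + θ * Complex.I) =
    (Real.cosh a * Real.cos θ : ℝ) + (Real.sinh a * Real.sin θ : ℝ) * Complex.I := by
  rw [Complex.cosh_add, Complex.cosh_mul_I, Complex.sinh_mul_I]
  push_cast; ring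

lemma sinh_add_mul_I (a θ : ℝ) : Complex.sinh (a + θ * Complex.I) =
    (Real.sinh a * Real.cos θ : ℝ) + (Real.cosh a * Real.sin θ : ℝ) * Complex.I := by
  rw [Complex.sinh_add, Complex.cosh_mul_I, Complex.sinh_mul_I]
  push_cast; ring

lemma cosh_add_mul_I_re (a θ : ℝ) :
    (Complex.cosh (a + θ * Complex.I)).re = Real.cosh a * Real.cos θ := by
  rw [cosh_add_mul_I, Complex.add_re, Complex.ofReal_re, Complex.re_ofReal_mul, Complex.I_re]
  ring

lemma cosh_add_mul_I_im (a θ : ℝ) :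
    (Complex.cosh (a + θ * Complex.I)).im = Real.sinh a * Real.sin θ := by
  rw [cosh_add_mul_I, Complex.add_im, Complex.ofReal_im, Complex.im_ofReal_mul, Complex.I_im]
  ring

lemma sinh_add_mul_I_im (a θ : ℝ) :
    (Complex.sinh (a + θ * Complex.I)).im = Real.cosh a * Real.sin θ := by
  rw [sinh_add_mul_I, Complex.add_im, Complex.ofReal_im, Complex.im_ofReal_mul, Complex.I_im]
  ring

/-- This is the equation `Im φ = 0` at the point with logarithm `a + iθ`, which `arsinh` solves for
`a`. -/
lemma xi_mul_sinh_pathLog (hx : 0 < x) (hy : 0 < y) {θ : ℝ} (h1 : -Real.pi < θ)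
    (h2 : θ < Real.pi) : xi x y * Real.sinh (pathLog x y θ) * Real.sin θ = θ := by
  rw [pathLog, Real.sinh_arsinh]
  have h := sinc_pos h1 h2
  have hxi := xi_pos hx hy
  rcases eq_or_ne θ 0 with rfl | h0
  · simp
  have hs : Real.sin θ ≠ 0 := by
    intro hs
    rw [Real.sinc_of_ne_zero h0, hs] at h
    simp at h
  rw [Real.sinc_of_ne_zero h0]
  field_simp

lemma phi_path_im (hx : 0 < x) (hy : 0 < y) {θ : ℝ} (h1 : -Real.pi < θ) (h2 : θ < Real.pi) :
    (phi x y (path x y θ)).im = 0 := by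
  rw [phi_path h1 h2, Complex.sub_im, Complex.im_ofReal_mul, cosh_add_mul_I_im]
  have := xi_mul_sinh_pathLog hx hy h1 h2
  simp only [Complex.add_im, Complex.ofReal_im, Complex.im_ofReal_mul, Complex.I_im]
  linarith

lemma phi_path_re {θ : ℝ} (h1 : -Real.pi < θ) (h2 : θ < Real.pi) :
    (phi x y (path x y θ)).re =
      xi x y * (Real.cosh (pathLog x y θ) * Real.cos θ) - pathLog x y θ := by
  rw [phi_path h1 h2, Complex.sub_re, Complex.re_ofReal_mul, cosh_add_mul_I_re]
  simp

lemma psi_pathV (hx : 0 < x) (hy : 0 < y) {θ : ℝ} (h1 : -Real.pi < θ) (h2 : θ < Real.pi) :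
    psi (amp x y) (pathV x y θ) = -(drop x y θ : ℝ) := by
  have h := phi_saddle_mul_exp hx hy (v := pathV x y θ) (by simpa using h1) (by simpa using h2.le)
  rw [← path_eq_saddle_mul hx hy] at h
  have hi := phi_path_im hx hy h1 h2
  have hs : (phi x y (saddle x y)).im = 0 := by rw [phi_saddle hx hy, Complex.ofReal_im]
  have : psi (amp x y) (pathV x y θ) = phi x y (path x y θ) - phi x y (saddle x y) := by
    rw [h]; ring
  rw [this]
  apply Complex.ext <;> simp [drop, hi, hs]

lemma pathLog_neg (x y θ : ℝ) : pathLog x y (-θ) = pathLog x y θ := by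
  rw [pathLog, Real.sinc_neg, pathLog]

lemma drop_neg {θ : ℝ} (h1 : -Real.pi < θ) (h2 : θ < Real.pi) :
    drop x y (-θ) = drop x y θ := by
  rw [drop, drop, phi_path_re h1 h2, phi_path_re (by linarith) (by linarith), pathLog_neg,
    Real.cos_neg]

lemma pathLog_zero (hx : 0 < x) (hy : 0 < y) : pathLog x y 0 = Real.log (saddle x y) := by
  rw [← Real.log_exp (pathLog x y 0), exp_pathLog, pathRadius, Real.sinc_zero, mul_one, saddle]
  have h := xi_pos hx hy
  congr 1
  rw [show 1 + (1 / xi x y) ^ 2 = (1 + xi x y ^ 2) / xi x y ^ 2 by field_simp; ring,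
    Real.sqrt_div' _ (by positivity), Real.sqrt_sq h.le, add_div]

lemma path_zero (hx : 0 < x) (hy : 0 < y) : path x y 0 = saddle x y := by
  rw [path_eq, pathLog_zero hx hy]
  have := exp_log_saddle hx hy 0
  simpa using this

lemma pathV_zero (hx : 0 < x) (hy : 0 < y) : pathV x y 0 = 0 := by
  simp [pathV, pathLog_zero hx hy]

lemma drop_zero (hx : 0 < x) (hy : 0 < y) : drop x y 0 = 0 := by
  rw [drop, path_zero hx hy, sub_self]

lemma continuousOn_pathLog (hx : 0 < x) (hy : 0 < y) :
    ContinuousOn (pathLog x y) (Ioo (-Real.pi) Real.pi) := by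
  unfold pathLog
  refine ContinuousOn.arsinh (ContinuousOn.div continuousOn_const ?_ ?_)
  · have := Real.continuous_sinc
    fun_prop
  · intro θ hθ
    exact (mul_pos (xi_pos hx hy) (sinc_pos hθ.1 hθ.2)).ne'

lemma continuousOn_pathV (hx : 0 < x) (hy : 0 < y) :
    ContinuousOn (pathV x y) (Ioo (-Real.pi) Real.pi) := by
  have := continuousOn_pathLog hx hy
  unfold pathV
  fun_prop

lemma continuousOn_drop (hx : 0 < x) (hy : 0 < y) :
    ContinuousOn (drop x y) (Ioo (-Real.pi) Real.pi) := by
  have h := continuousOn_pathLog hx hy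
  have h1 : ContinuousOn (fun θ => (phi x y (saddle x y : ℂ)).re -
      (xi x y * (Real.cosh (pathLog x y θ) * Real.cos θ) - pathLog x y θ))
      (Ioo (-Real.pi) Real.pi) := by
    have := Real.continuous_cosh.comp_continuousOn h
    fun_prop
  refine h1.congr fun θ hθ => ?_
  rw [drop, phi_path_re hθ.1 hθ.2]

/-- Put `q = θ / sin θ`, `z = q / ξ = sinh a`, `C = cosh a`. The derivative is `ξ C sin θ + a' (1 -
ξ z cos θ)` with `a' = q' / (ξ C)`, and `1 - ξ z cos θ = q' sin θ`. So the second term is `q'² sin θ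
/ (ξ C) ≥ 0`, whatever the sign of `q'`. -/
lemma deriv_drop_pos (hx : 0 < x) (hy : 0 < y) {θ : ℝ} (h0 : 0 < θ) (h2 : θ < Real.pi) :
    0 < deriv (drop x y) θ := by
  have hxi := xi_pos hx hy
  have hsin := Real.sin_pos_of_pos_of_lt_pi h0 h2
  set q' := (Real.sin θ - θ * Real.cos θ) / Real.sin θ ^ 2 with hq'
  have hq : HasDerivAt (fun θ => θ / Real.sin θ / xi x y) (q' / xi x y) θ := by
    have : HasDerivAt (fun θ => θ / Real.sin θ / xi x y) _ θ :=
      ((hasDerivAt_id θ).div (Real.hasDerivAt_sin θ) hsin.ne').div_const (xi x y)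
    exact this.congr_deriv (by rw [hq', one_mul, id])
  set z := θ / Real.sin θ / xi x y with hz
  have hzl : pathLog x y θ = Real.arsinh z := by
    rw [pathLog, Real.sinc_of_ne_zero h0.ne', hz]
    congr 1; field_simp
  have hnear : ∀ᶠ t in nhds θ, 0 < t ∧ t < Real.pi :=
    (Ioo_mem_nhds h0 h2)
  have ha : HasDerivAt (pathLog x y) ((Real.sqrt (1 + z ^ 2))⁻¹ * (q' / xi x y)) θ := by
    have h := hq.arsinh
    rw [smul_eq_mul] at h
    refine h.congr_of_eventuallyEq ?_
    filter_upwards [hnear] with t ht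
    rw [pathLog, Real.sinc_of_ne_zero ht.1.ne']
    congr 1; field_simp
  set a' := (Real.sqrt (1 + z ^ 2))⁻¹ * (q' / xi x y) with ha'
  have hC : 0 < Real.sqrt (1 + z ^ 2) := Real.sqrt_pos.2 (by positivity)
  have hd : HasDerivAt (drop x y) (-(xi x y * ((Real.sinh (pathLog x y θ) * a') * Real.cos θ +
      Real.cosh (pathLog x y θ) * (-Real.sin θ)) - a')) θ := by
    have h := (((ha.cosh.mul (Real.hasDerivAt_cos θ)).const_mul (xi x y)).sub ha).const_sub
      (phi x y (saddle x y : ℂ)).re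
    refine h.congr_of_eventuallyEq ?_
    filter_upwards [hnear] with t ht
    rw [drop, phi_path_re (by linarith) ht.2]
    rfl
  rw [hd.deriv, hzl, Real.sinh_arsinh, Real.cosh_arsinh]
  set C := Real.sqrt (1 + z ^ 2)
  have e1 : 1 - xi x y * z * Real.cos θ = q' * Real.sin θ := by
    rw [hz, hq']; field_simp
  have e2 : -(xi x y * (z * a' * Real.cos θ + C * -Real.sin θ) - a') =
      xi x y * C * Real.sin θ + q' ^ 2 * Real.sin θ / (C * xi x y) := by
    have : -(xi x y * (z * a' * Real.cos θ + C * -Real.sin θ) - a') =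
      xi x y * C * Real.sin θ + a' * (1 - xi x y * z * Real.cos θ) := by ring
    rw [this, e1, ha']
    field_simp
  rw [e2]
  positivity

lemma drop_strictMonoOn (hx : 0 < x) (hy : 0 < y) :
    StrictMonoOn (drop x y) (Ico 0 Real.pi) := by
  refine strictMonoOn_of_deriv_pos (convex_Ico _ _)
    ((continuousOn_drop hx hy).mono fun θ hθ => ⟨by linarith [hθ.1, Real.pi_pos], hθ.2⟩) ?_
  intro θ hθ
  rw [interior_Ico] at hθ
  exact deriv_drop_pos hx hy hθ.1 hθ.2

lemma drop_pos (hx : 0 < x) (hy : 0 < y) {θ : ℝ} (h0 : 0 < θ) (h2 : θ < Real.pi) :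
    0 < drop x y θ := by
  have := drop_strictMonoOn hx hy ⟨le_rfl, Real.pi_pos⟩ ⟨h0.le, h2⟩ h0
  rwa [drop_zero hx hy] at this

lemma pathCoord_eq (x y θ : ℝ) : pathCoord x y θ = Real.sign θ * Real.sqrt (2 * drop x y θ) := rfl

lemma pathCoord_of_nonneg (hx : 0 < x) (hy : 0 < y) {θ : ℝ} (h0 : 0 ≤ θ) :
    pathCoord x y θ = Real.sqrt (2 * drop x y θ) := by
  rcases h0.eq_or_lt with rfl | h
  · simp [pathCoord_eq, drop_zero hx hy]
  · rw [pathCoord_eq, Real.sign_of_pos h, one_mul]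

lemma pathCoord_neg {θ : ℝ} (h1 : -Real.pi < θ) (h2 : θ < Real.pi) :
    pathCoord x y (-θ) = -pathCoord x y θ := by
  rw [pathCoord_eq, pathCoord_eq, drop_neg h1 h2, Real.sign_neg]; ring

lemma pathCoord_strictMonoOn_Ico (hx : 0 < x) (hy : 0 < y) :
    StrictMonoOn (pathCoord x y) (Ico 0 Real.pi) := by
  intro a ha b hb hab
  rw [pathCoord_of_nonneg hx hy ha.1, pathCoord_of_nonneg hx hy hb.1]
  have h := drop_strictMonoOn hx hy ha hb hab
  have h0 : 0 ≤ drop x y a := by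
    rcases ha.1.eq_or_lt with h | h
    · rw [← h, drop_zero hx hy]
    · exact (drop_pos hx hy h ha.2).le
  exact Real.sqrt_lt_sqrt (by linarith) (by linarith)

lemma pathCoord_zero (x y : ℝ) : pathCoord x y 0 = 0 := by simp [pathCoord_eq]

lemma pathCoord_strictMonoOn (hx : 0 < x) (hy : 0 < y) :
    StrictMonoOn (pathCoord x y) (Ioo (-Real.pi) Real.pi) := by
  have hI : StrictMonoOn (pathCoord x y) (Ioc (-Real.pi) 0) := by
    intro a ha b hb hab
    have := pathCoord_strictMonoOn_Ico hx hy (a := -b) (b := -a) ⟨by linarith [hb.2], by linarith [hb.1]⟩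
      ⟨by linarith [ha.2], by linarith [ha.1]⟩ (by linarith)
    rw [pathCoord_neg hb.1 (by linarith [hb.2, Real.pi_pos]),
      pathCoord_neg ha.1 (by linarith [ha.2, Real.pi_pos])] at this
    linarith
  have := StrictMonoOn.union hI (pathCoord_strictMonoOn_Ico hx hy)
    (c := 0) ⟨⟨by linarith [Real.pi_pos], le_rfl⟩, fun _ h => h.2⟩
    ⟨⟨le_rfl, Real.pi_pos⟩, fun _ h => h.1⟩
  rwa [Ioc_union_Ico_eq_Ioo (by linarith [Real.pi_pos]) Real.pi_pos] at this

lemma tendsto_sinc_pi :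
    Filter.Tendsto Real.sinc (nhdsWithin Real.pi (Iio Real.pi)) (nhdsWithin 0 (Ioi 0)) := by
  have h0 : Real.sinc Real.pi = 0 := by rw [Real.sinc_of_ne_zero Real.pi_ne_zero]; simp
  refine tendsto_nhdsWithin_iff.2 ⟨?_, ?_⟩
  · have := Real.continuous_sinc.tendsto Real.pi
    rw [h0] at this
    exact this.mono_left nhdsWithin_le_nhds
  · have : Ioo (-Real.pi) Real.pi ∈ nhdsWithin Real.pi (Iio Real.pi) :=
      Ioo_mem_nhdsLT (by linarith [Real.pi_pos])
    filter_upwards [this] with θ hθ using sinc_pos hθ.1 hθ.2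

lemma tendsto_pathLog_pi (hx : 0 < x) (hy : 0 < y) :
    Filter.Tendsto (pathLog x y) (nhdsWithin Real.pi (Iio Real.pi)) Filter.atTop := by
  have h1 : Filter.Tendsto (fun θ => 1 / (xi x y * Real.sinc θ))
      (nhdsWithin Real.pi (Iio Real.pi)) Filter.atTop := by
    have := (tendsto_inv_nhdsGT_zero.comp tendsto_sinc_pi).const_mul_atTop
      (inv_pos.2 (xi_pos hx hy))
    refine this.congr fun θ => ?_
    simp [mul_comm]
  have h2 : Filter.Tendsto Real.arsinh Filter.atTop Filter.atTop :=
    Real.sinhOrderIso.symm.tendsto_atTop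
  exact h2.comp h1

/-- Beyond `π/2` the cosine is nonpositive, so the drop is at least `Re φ(t₀) + pathLog`, and
`pathLog` tends to infinity. -/
lemma tendsto_drop_pi (hx : 0 < x) (hy : 0 < y) :
    Filter.Tendsto (drop x y) (nhdsWithin Real.pi (Iio Real.pi)) Filter.atTop := by
  refine Filter.tendsto_atTop_mono' _ ?_
    (Filter.tendsto_atTop_add_const_left _ (phi x y (saddle x y : ℂ)).re (tendsto_pathLog_pi hx hy))
  filter_upwards [Ioo_mem_nhdsLT (show Real.pi / 2 < Real.pi by linarith [Real.pi_pos])] with θ hθ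
  have hc := Real.cos_nonpos_of_pi_div_two_le_of_le hθ.1.le (by linarith [hθ.2, Real.pi_pos])
  rw [drop, phi_path_re (by linarith [hθ.1, Real.pi_pos]) hθ.2]
  have := mul_nonneg (mul_nonneg (xi_pos hx hy).le (Real.cosh_pos (pathLog x y θ)).le)
    (neg_nonneg.2 hc)
  linarith

lemma pathCoord_surjOn (hx : 0 < x) (hy : 0 < y) :
    SurjOn (pathCoord x y) (Ioo (-Real.pi) Real.pi) univ := by
  have key : ∀ s : ℝ, 0 ≤ s → ∃ θ ∈ Ico 0 Real.pi, pathCoord x y θ = s := by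
    intro s hs
    obtain ⟨θ₁, hθ₁, hlt⟩ : ∃ θ ∈ Ioo 0 Real.pi, s ^ 2 / 2 < drop x y θ := by
      have h1 := (tendsto_drop_pi hx hy).eventually_gt_atTop (s ^ 2 / 2)
      have h2 := Ioo_mem_nhdsLT (a := 0) (b := Real.pi) Real.pi_pos
      obtain ⟨θ, h3, h4⟩ := (h1.and h2).exists
      exact ⟨θ, h4, h3⟩
    have hc : ContinuousOn (drop x y) (Icc 0 θ₁) := (continuousOn_drop hx hy).mono fun θ hθ =>
      ⟨by linarith [hθ.1, Real.pi_pos], by linarith [hθ.2, hθ₁.2]⟩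
    obtain ⟨θ, hθ, he⟩ := intermediate_value_Icc hθ₁.1.le hc
      (show s ^ 2 / 2 ∈ _ from ⟨by rw [drop_zero hx hy]; positivity, hlt.le⟩)
    refine ⟨θ, ⟨hθ.1, by linarith [hθ.2, hθ₁.2]⟩, ?_⟩
    rw [pathCoord_of_nonneg hx hy hθ.1, he, show 2 * (s ^ 2 / 2) = s ^ 2 by ring,
      Real.sqrt_sq hs]
  intro s _
  rcases le_total 0 s with h | h
  · obtain ⟨θ, hθ, he⟩ := key s h
    exact ⟨θ, ⟨by linarith [hθ.1, Real.pi_pos], hθ.2⟩, he⟩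
  · obtain ⟨θ, hθ, he⟩ := key (-s) (by linarith)
    refine ⟨-θ, ⟨by linarith [hθ.2], by linarith [hθ.1, Real.pi_pos]⟩, ?_⟩
    rw [pathCoord_neg (by linarith [hθ.1, Real.pi_pos]) hθ.2, he, neg_neg]

/-! ### The path parametrized by s = iσ -/

/-- The argument of the point of the path that corresponds to `s = i σ`. -/
def pathArg (x y σ : ℝ) : ℝ :=
  Function.invFunOn (pathCoord x y) (Ioo (-Real.pi) Real.pi) σ

lemma pathArg_mem (hx : 0 < x) (hy : 0 < y) (σ : ℝ) :
    pathArg x y σ ∈ Ioo (-Real.pi) Real.pi :=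
  Function.invFunOn_mem (pathCoord_surjOn hx hy (mem_univ σ))

lemma pathCoord_pathArg (hx : 0 < x) (hy : 0 < y) (σ : ℝ) :
    pathCoord x y (pathArg x y σ) = σ :=
  Function.invFunOn_eq (pathCoord_surjOn hx hy (mem_univ σ))

lemma pathArg_eq (hx : 0 < x) (hy : 0 < y) {θ σ : ℝ} (hθ : θ ∈ Ioo (-Real.pi) Real.pi)
    (h : pathCoord x y θ = σ) : pathArg x y σ = θ :=
  (pathCoord_strictMonoOn hx hy).injOn (pathArg_mem hx hy σ) hθ
    (by rw [pathCoord_pathArg hx hy, h])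

lemma pathArg_strictMono (hx : 0 < x) (hy : 0 < y) : StrictMono (pathArg x y) := by
  intro a b hab
  rw [← (pathCoord_strictMonoOn hx hy).lt_iff_lt (pathArg_mem hx hy a) (pathArg_mem hx hy b),
    pathCoord_pathArg hx hy, pathCoord_pathArg hx hy]
  exact hab

lemma pathArg_zero (hx : 0 < x) (hy : 0 < y) : pathArg x y 0 = 0 :=
  pathArg_eq hx hy ⟨by linarith [Real.pi_pos], Real.pi_pos⟩ (pathCoord_zero x y)

lemma pathArg_neg (hx : 0 < x) (hy : 0 < y) (σ : ℝ) : pathArg x y (-σ) = -pathArg x y σ := by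
  have h := pathArg_mem hx hy σ
  refine pathArg_eq hx hy ⟨by linarith [h.2], by linarith [h.1]⟩ ?_
  rw [pathCoord_neg h.1 h.2, pathCoord_pathArg hx hy]

lemma continuous_pathArg (hx : 0 < x) (hy : 0 < y) : Continuous (pathArg x y) := by
  have : Continuous fun σ => (⟨pathArg x y σ, pathArg_mem hx hy σ⟩ : Ioo (-Real.pi) Real.pi) := by
    refine Monotone.continuous_of_surjective (fun a b hab => ?_) fun θ => ?_
    · exact (pathArg_strictMono hx hy).monotone hab
    · exact ⟨pathCoord x y θ, Subtype.ext (pathArg_eq hx hy θ.2 rfl)⟩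
  exact continuous_subtype_val.comp this

lemma pathArg_pos (hx : 0 < x) (hy : 0 < y) {σ : ℝ} (h : 0 < σ) : 0 < pathArg x y σ := by
  have := pathArg_strictMono hx hy h
  rwa [pathArg_zero hx hy] at this

lemma tendsto_pathArg (hx : 0 < x) (hy : 0 < y) :
    Filter.Tendsto (pathArg x y) Filter.atTop (nhdsWithin Real.pi (Iio Real.pi)) := by
  refine tendsto_nhdsWithin_iff.2 ⟨?_, Filter.Eventually.of_forall fun σ => (pathArg_mem hx hy σ).2⟩
  refine tendsto_order.2 ⟨fun a ha => ?_, fun a ha => ?_⟩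
  · have hm : max a 0 ∈ Ioo (-Real.pi) Real.pi :=
      ⟨lt_max_of_lt_right (by linarith [Real.pi_pos]), max_lt ha Real.pi_pos⟩
    filter_upwards [Filter.eventually_gt_atTop (pathCoord x y (max a 0))] with σ hσ
    have := pathArg_strictMono hx hy hσ
    rw [pathArg_eq hx hy hm rfl] at this
    exact (le_max_left _ _).trans_lt this
  · exact Filter.Eventually.of_forall fun σ => (pathArg_mem hx hy σ).2.trans ha

/-- The coordinate `v` as a function of `σ`, where `s = i σ`. -/
def pathFun (x y σ : ℝ) : ℂ := pathV x y (pathArg x y σ)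

lemma tImag_eq (hx : 0 < x) (hy : 0 < y) (σ : ℝ) :
    tImag x y σ = saddle x y * Complex.exp (pathFun x y σ) :=
  path_eq_saddle_mul hx hy _

lemma continuous_pathFun (hx : 0 < x) (hy : 0 < y) : Continuous (pathFun x y) :=
  (continuousOn_pathV hx hy).comp_continuous (continuous_pathArg hx hy) (pathArg_mem hx hy)

lemma pathFun_zero (hx : 0 < x) (hy : 0 < y) : pathFun x y 0 = 0 := by
  rw [pathFun, pathArg_zero hx hy, pathV_zero hx hy]

lemma drop_nonneg (hx : 0 < x) (hy : 0 < y) {θ : ℝ} (h : θ ∈ Ioo (-Real.pi) Real.pi) :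
    0 ≤ drop x y θ := by
  rcases lt_trichotomy θ 0 with h0 | rfl | h0
  · rw [← drop_neg h.1 h.2]
    exact (drop_pos hx hy (by linarith) (by linarith [h.1])).le
  · rw [drop_zero hx hy]
  · exact (drop_pos hx hy h0 h.2).le

lemma psi_pathFun (hx : 0 < x) (hy : 0 < y) (σ : ℝ) :
    psi (amp x y) (pathFun x y σ) = -(σ : ℂ) ^ 2 / 2 := by
  have h := pathArg_mem hx hy σ
  have hc := pathCoord_pathArg hx hy σ
  have h0 := drop_nonneg hx hy h
  have : drop x y (pathArg x y σ) = σ ^ 2 / 2 := by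
    have h2 : pathCoord x y (pathArg x y σ) ^ 2 = 2 * drop x y (pathArg x y σ) := by
      rcases lt_trichotomy (pathArg x y σ) 0 with hs | hs | hs
      · rw [pathCoord_eq, Real.sign_of_neg hs, mul_pow, Real.sq_sqrt (by linarith)]; ring
      · rw [hs, pathCoord_zero, drop_zero hx hy]; ring
      · rw [pathCoord_eq, Real.sign_of_pos hs, mul_pow, Real.sq_sqrt (by linarith)]; ring
    rw [hc] at h2
    linarith
  rw [pathFun, psi_pathV hx hy h.1 h.2, this]
  push_cast; ring

lemma phi_tImag (hx : 0 < x) (hy : 0 < y) (σ : ℝ) :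
    phi x y (tImag x y σ) = phi x y (saddle x y) - (σ : ℂ) ^ 2 / 2 := by
  have h := pathArg_mem hx hy σ
  rw [tImag_eq hx hy, phi_saddle_mul_exp hx hy (by simpa [pathFun] using h.1)
    (by simpa [pathFun] using h.2.le), psi_pathFun hx hy]
  ring

/-- The derivative of `psi`. -/
def psiDeriv (A : ℝ) (v : ℂ) : ℂ := A * Complex.sinh v + Complex.cosh v - 1

/-- The imaginary part of `ψ'` on the path is `ξ cosh a sin θ`, which dominates `ξ sinh a sin θ =
θ`. It is a lower bound for `ψ'` away from the saddle that does not involve `x` and `y`. -/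
lemma abs_pathArg_le_norm_psiDeriv (hx : 0 < x) (hy : 0 < y) (σ : ℝ) :
    |pathArg x y σ| ≤ ‖psiDeriv (amp x y) (pathFun x y σ)‖ := by
  have h := pathArg_mem hx hy σ
  set θ := pathArg x y σ
  have hxi := xi_pos hx hy
  have h1 : psiDeriv (amp x y) (pathFun x y σ) =
      xi x y * Complex.sinh (pathLog x y θ + θ * Complex.I) - 1 := by
    rw [psiDeriv, ← xi_mul_sinh hx hy, pathFun, pathV]
    congr 3; push_cast; ring
  have h2 : (psiDeriv (amp x y) (pathFun x y σ)).im =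
      xi x y * (Real.cosh (pathLog x y θ) * Real.sin θ) := by
    rw [h1, Complex.sub_im, Complex.im_ofReal_mul, sinh_add_mul_I_im]; simp
  have h3 := Complex.abs_im_le_norm (psiDeriv (amp x y) (pathFun x y σ))
  refine le_trans ?_ h3
  have h4 := xi_mul_sinh_pathLog hx hy h.1 h.2
  have h5 : 0 ≤ Real.sinh (pathLog x y θ) := by
    rw [pathLog, Real.sinh_arsinh]
    have := sinc_pos h.1 h.2
    positivity
  rw [h2, ← h4]
  rw [abs_mul, abs_mul, abs_mul, abs_mul, mul_assoc]
  rw [abs_of_nonneg h5, abs_of_pos (Real.cosh_pos _), h4]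
  gcongr
  exact (Real.sinh_lt_cosh _).le

/-- Off the saddle `ψ' ≠ 0`, so `ψ` has a local inverse; by continuity the path is that inverse
composed with `σ ↦ -σ²/2`. At `σ = 0` this breaks down and `localV` takes over. -/
lemma hasDerivAt_pathFun (hx : 0 < x) (hy : 0 < y) {σ : ℝ} (hσ : σ ≠ 0) :
    HasDerivAt (pathFun x y) (-σ / psiDeriv (amp x y) (pathFun x y σ)) σ := by
  have hne : psiDeriv (amp x y) (pathFun x y σ) ≠ 0 := by
    have h := abs_pathArg_le_norm_psiDeriv hx hy σ
    have h0 : pathArg x y σ ≠ 0 := fun h0 => hσ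
      ((pathArg_strictMono hx hy).injective (by rw [h0, pathArg_zero hx hy]))
    exact norm_pos_iff.1 ((abs_pos.2 h0).trans_le h)
  have hstrict : HasStrictDerivAt (psi (amp x y)) (psiDeriv (amp x y) (pathFun x y σ))
      (pathFun x y σ) := by
    have hd : Differentiable ℂ (psi (amp x y)) := fun v => (hasDerivAt_psi _ v).differentiableAt
    have := (hd.contDiff (n := 1)).contDiffAt (x := pathFun x y σ) |>.hasStrictDerivAt one_ne_zero
    rwa [(hasDerivAt_psi _ _).deriv] at this
  set G := HasStrictDerivAt.localInverse _ _ _ hstrict hne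
  have hG : HasDerivAt G (psiDeriv (amp x y) (pathFun x y σ))⁻¹
      (psi (amp x y) (pathFun x y σ)) := (hstrict.to_localInverse hne).hasDerivAt
  have hq : HasDerivAt (fun τ : ℝ => -(τ : ℂ) ^ 2 / 2) (-(σ : ℂ)) σ := by
    have : HasDerivAt (fun τ : ℝ => -(τ : ℂ) ^ 2 / 2) _ σ :=
      ((((hasDerivAt_id σ).ofReal_comp).pow 2).neg).div_const (2 : ℂ)
    exact this.congr_deriv (by simp; ring)
  rw [psi_pathFun hx hy] at hG
  have hcomp := HasDerivAt.comp σ (h := fun τ : ℝ => -(τ : ℂ) ^ 2 / 2) hG hq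
  have hev := (continuous_pathFun hx hy).continuousAt.eventually
    (hstrict.eventually_left_inverse hne)
  refine (hcomp.congr_of_eventuallyEq ?_).congr_deriv (by rw [div_eq_mul_inv, mul_comm])
  filter_upwards [hev] with τ hτ
  rw [Function.comp_apply, ← psi_pathFun hx hy]
  exact hτ.symm

lemma hasDerivAt_tImag (hx : 0 < x) (hy : 0 < y) {σ : ℝ} (hσ : σ ≠ 0) :
    HasDerivAt (tImag x y)
      (tImag x y σ * (-σ / psiDeriv (amp x y) (pathFun x y σ))) σ := by
  have h := ((hasDerivAt_pathFun hx hy hσ).cexp).const_mul (saddle x y : ℂ)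
  have he : tImag x y = fun σ => saddle x y * Complex.exp (pathFun x y σ) :=
    funext (tImag_eq hx hy)
  rw [← mul_assoc, ← tImag_eq hx hy, ← he] at h
  exact h

/-- Off the real axis, `Im φ = 0` determines the modulus from the argument, so the point given by
`localV` lies on the path. Its imaginary part has the sign of `σ` because `localV` is close to `iσ /
√A`, and this selects the right half of the path. -/
lemma pathFun_eq_localV (hx : 0 < x) (hy : 0 < y) {σ : ℝ}
    (hσ : |σ| < 1 / 50 * Real.sqrt (amp x y)) :
    pathFun x y σ = localV (amp x y) (Complex.I * σ) := by
  have hA := (one_lt_amp hx hy).le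
  have hn : ‖Complex.I * (σ : ℂ)‖ < 1 / 50 * Real.sqrt (amp x y) := by simpa using hσ
  have hpsi := psi_localV hA hn
  have hq := Real.sqrt_pos.2 (by linarith : 0 < amp x y)
  set v := localV (amp x y) (Complex.I * σ) with hv
  have hlt : ‖v‖ < 1 / 40 := norm_localInv_lt hA (norm_div_sqrt_lt hA hn)
  have hdist : |v.im - σ / Real.sqrt (amp x y)| ≤ 1 / 9 * (|σ| / Real.sqrt (amp x y)) := by
    have h1 := norm_localV_sub_le hA hn
    have h2 := Complex.abs_im_le_norm (v - Complex.I * σ / Real.sqrt (amp x y))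
    have h3 : (v - Complex.I * σ / Real.sqrt (amp x y)).im = v.im - σ / Real.sqrt (amp x y) := by
      rw [Complex.sub_im, mul_div_assoc, ← Complex.ofReal_div]; simp
    rw [h3] at h2
    refine h2.trans (h1.trans_eq ?_)
    simp
  rcases eq_or_ne σ 0 with rfl | h0
  · rw [pathFun_zero hx hy, hv]; simp [localV, localInv_zero hA]
  have hsign : Real.sign v.im = Real.sign σ := by
    rw [abs_le] at hdist
    rcases lt_or_gt_of_ne h0 with h | h
    · have : σ / Real.sqrt (amp x y) < 0 := div_neg_of_neg_of_pos h hq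
      rw [abs_of_neg h, neg_div] at hdist
      rw [Real.sign_of_neg h, Real.sign_of_neg (by linarith)]
    · have : 0 < σ / Real.sqrt (amp x y) := div_pos h hq
      rw [abs_of_pos h] at hdist
      rw [Real.sign_of_pos h, Real.sign_of_pos (by linarith)]
  have him : |v.im| < 1 / 40 := (Complex.abs_im_le_norm v).trans_lt hlt
  rw [abs_lt] at him
  have hpi := Real.pi_gt_three
  have hmem : v.im ∈ Ioo (-Real.pi) Real.pi := ⟨by linarith, by linarith⟩
  have him0 : v.im ≠ 0 := by
    intro h; rw [h, Real.sign_zero] at hsign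
    exact h0 (Real.sign_eq_zero_iff.1 hsign.symm)
  have hphi : phi x y (saddle x y * Complex.exp v) = phi x y (saddle x y) - (σ : ℂ) ^ 2 / 2 := by
    rw [phi_saddle_mul_exp hx hy hmem.1 hmem.2.le, hpsi, mul_pow, Complex.I_sq]; ring
  have hphi2 := phi_exp x y (u := v + Real.log (saddle x y)) (by simpa using hmem.1)
    (by simpa using hmem.2.le)
  rw [exp_log_saddle hx hy, hphi, phi_saddle hx hy] at hphi2
  set a := v.re + Real.log (saddle x y) with ha
  have hva : v + Real.log (saddle x y) = (a : ℂ) + (v.im : ℂ) * Complex.I := by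
    rw [ha]; apply Complex.ext <;> simp
  rw [hva] at hphi2
  have himeq := congrArg Complex.im hphi2
  have hpow : ((σ : ℂ) ^ 2 / 2) = ((σ ^ 2 / 2 : ℝ) : ℂ) := by push_cast; ring
  rw [hpow, Complex.sub_im, Complex.sub_im, Complex.im_ofReal_mul, cosh_add_mul_I_im] at himeq
  simp only [Complex.add_im, Complex.ofReal_im, Complex.im_ofReal_mul, Complex.I_im] at himeq
  have hxi := xi_pos hx hy
  have hsin : Real.sin v.im ≠ 0 := by
    intro h; rw [h] at himeq; apply him0; linarith
  have hpl : pathLog x y v.im = a := by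
    rw [pathLog, ← Real.arsinh_sinh a]
    congr 1
    rw [Real.sinc_of_ne_zero him0]
    field_simp
    linarith
  have hpv : pathV x y v.im = v := by
    rw [pathV, hpl, ha]; apply Complex.ext <;> simp
  have hdrop : drop x y v.im = σ ^ 2 / 2 := by
    rw [drop, path_eq_saddle_mul hx hy, hpv, hphi, hpow, Complex.sub_re, Complex.ofReal_re]; ring
  have hcoord : pathCoord x y v.im = σ := by
    rw [pathCoord_eq, hdrop, hsign, show 2 * (σ ^ 2 / 2) = σ ^ 2 by ring, Real.sqrt_sq_eq_abs]
    rcases lt_or_gt_of_ne h0 with h | h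
    · rw [Real.sign_of_neg h, abs_of_neg h]; ring
    · rw [Real.sign_of_pos h, abs_of_pos h]; ring
  rw [pathFun, pathArg_eq hx hy hmem hcoord, hpv]

end

/-! ### Real restrictions of holomorphic functions, and lower bounds for |e^z - 1| -/

lemma hasDerivAt_of_ofReal_eq {f : ℝ → ℝ} {F : ℂ → ℂ} {F' : ℂ} {s : ℝ}
    (hF : HasDerivAt F F' s) (h : ∀ᶠ t : ℝ in nhds s, (f t : ℂ) = F t) :
    HasDerivAt f F'.re s ∧ (F'.re : ℂ) = F' := by
  have h1 : HasDerivAt f F'.re s := by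
    refine hF.real_of_complex.congr_of_eventuallyEq ?_
    filter_upwards [h] with t ht
    rw [← ht, Complex.ofReal_re]
  refine ⟨h1, ?_⟩
  have h2 : HasDerivAt (fun t : ℝ => (f t : ℂ)) (F'.re : ℂ) s := h1.ofReal_comp
  have h3 : HasDerivAt (fun t : ℝ => (f t : ℂ)) F' s := hF.comp_ofReal.congr_of_eventuallyEq h
  exact h2.unique h3

lemma half_le_norm_exp_sub_one {δ : ℝ} (h0 : 0 < δ) (h1 : δ ≤ 1) {z : ℂ} (hz : δ ≤ |z.re|) :
    δ / 2 ≤ ‖Complex.exp z - 1‖ := by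
  have h := abs_norm_sub_norm_le (Complex.exp z) 1
  rw [Complex.norm_exp, norm_one] at h
  refine le_trans ?_ h
  rcases le_total 0 z.re with hp | hn
  · rw [abs_of_nonneg hp] at hz
    have := Real.add_one_le_exp z.re
    rw [abs_of_nonneg (by linarith)]
    linarith
  · rw [abs_of_nonpos hn] at hz
    have h2 : Real.exp z.re * (1 + δ) ≤ 1 := by
      calc Real.exp z.re * (1 + δ) ≤ Real.exp z.re * Real.exp δ := by
            gcongr; linarith [Real.add_one_le_exp δ]
        _ = Real.exp (z.re + δ) := (Real.exp_add _ _).symm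
        _ ≤ 1 := Real.exp_le_one_iff.2 (by linarith)
    have h3 : Real.exp z.re ≤ 1 := Real.exp_le_one_iff.2 hn
    rw [abs_of_nonpos (by linarith)]
    nlinarith [Real.exp_pos z.re]

lemma half_norm_le_norm_exp_sub_one {z : ℂ} (hz : ‖z‖ ≤ 1 / 2) :
    ‖z‖ / 2 ≤ ‖Complex.exp z - 1‖ := by
  have h := Complex.norm_exp_sub_one_sub_id_le (x := z) (by linarith)
  have h2 := norm_sub_norm_le z (-(Complex.exp z - 1 - z))
  rw [norm_neg, sub_neg_eq_add, add_sub_cancel] at h2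
  nlinarith [norm_nonneg z]

/-- With `E = e^{Re z}`, `‖e^z - 1‖² = E² - 2E cos θ + 1 ≥ (E - cos θ₀)² + sin² θ₀`. No control of
`Re z` is needed, which matters because the pole coordinate is unbounded. -/
lemma sin_le_norm_exp_sub_one {θ₀ θ : ℝ} (h0 : 0 < θ₀) (h1 : θ₀ ≤ |θ|) (h2 : |θ| ≤ Real.pi)
    (h3 : θ₀ ≤ Real.pi / 2) {z : ℂ} (hz : z.im = θ) : Real.sin θ₀ ≤ ‖Complex.exp z - 1‖ := by
  have hc : Real.cos θ ≤ Real.cos θ₀ := by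
    rw [← Real.cos_abs θ]
    exact Real.cos_le_cos_of_nonneg_of_le_pi h0.le h2 h1
  have hc0 : 0 ≤ Real.cos θ₀ := Real.cos_nonneg_of_neg_pi_div_two_le_of_le (by linarith) h3
  have hn : ‖Complex.exp z - 1‖ ^ 2 = (Real.exp z.re * Real.cos θ - 1) ^ 2 +
      (Real.exp z.re * Real.sin θ) ^ 2 := by
    rw [Complex.sq_norm, Complex.normSq_apply]
    simp [Complex.exp_re, Complex.exp_im, hz]
    ring
  refine abs_le_of_sq_le_sq' ?_ (norm_nonneg _) |>.2
  rw [hn]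
  have e1 := Real.sin_sq_add_cos_sq θ
  have e2 := Real.sin_sq_add_cos_sq θ₀
  set E := Real.exp z.re
  have hE : 0 < E := Real.exp_pos _
  have e3 : (E * Real.cos θ - 1) ^ 2 + (E * Real.sin θ) ^ 2 = E ^ 2 - 2 * (E * Real.cos θ) + 1 := by
    linear_combination E ^ 2 * e1
  have e4 := mul_le_mul_of_nonneg_left hc hE.le
  nlinarith [sq_nonneg (E - Real.cos θ₀)]

/-! ### Holomorphic extension of g near the saddle, bounded uniformly -/

section LocalExtension

variable {A : ℝ}

lemma norm_localV_sub_localV_le (hA : 1 ≤ A) {s z : ℂ} (hs : ‖s‖ < 1 / 50 * Real.sqrt A)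
    (hz : ‖z‖ < 1 / 50 * Real.sqrt A) :
    8 / 9 * (‖s - z‖ / Real.sqrt A) ≤ ‖localV A s - localV A z‖ ∧
      ‖localV A s - localV A z‖ ≤ 10 / 9 * (‖s - z‖ / Real.sqrt A) := by
  have h := norm_localInv_sub_sub_le hA (norm_div_sqrt_lt hA hs) (norm_div_sqrt_lt hA hz)
  rw [← sub_div, norm_div_sqrt] at h
  have h1 := norm_sub_norm_le (localV A s - localV A z) ((s - z) / Real.sqrt A)
  have h2 := norm_sub_norm_le ((s - z) / Real.sqrt A) (localV A s - localV A z)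
  rw [norm_sub_rev ((s - z) / (Real.sqrt A : ℂ))] at h2
  rw [norm_div_sqrt] at h1 h2
  unfold localV at h1 h2 ⊢
  constructor <;> linarith

lemma norm_localV_le (hA : 1 ≤ A) {s : ℂ} (hs : ‖s‖ < 1 / 50 * Real.sqrt A) :
    ‖localV A s‖ ≤ 10 / 9 * (‖s‖ / Real.sqrt A) := by
  have hq := Real.sqrt_pos.2 (by linarith : 0 < A)
  have := (norm_localV_sub_localV_le hA hs (z := 0) (by simpa using hq)).2
  simpa [localV, localInv_zero hA] using this

lemma norm_deriv_localV_le (hA : 1 ≤ A) {s : ℂ} (hs : ‖s‖ < 1 / 50 * Real.sqrt A) :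
    ‖deriv (localV A) s‖ ≤ 2 := by
  have h1 : 1 ≤ Real.sqrt A := Real.one_le_sqrt.2 hA
  rw [(hasDerivAt_localV hA hs).deriv, norm_div_sqrt, div_le_iff₀ (by linarith)]
  have := norm_deriv_localInv_le hA (norm_div_sqrt_lt hA hs)
  linarith

lemma localV_re_eq (hA : 1 ≤ A) {s : ℝ} (hs : |s| < 1 / 50 * Real.sqrt A) :
    ((localV A s).re : ℂ) = localV A s := by
  apply Complex.ext <;> simp [localV_ofReal_im hA hs]

lemma localV_sReal (hA : 1 ≤ A) {b : ℝ} (hb : |sReal A b| < 1 / 50 * Real.sqrt A) :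
    localV A (sReal A b) = b := by
  have h := (sReal_strictMono hA).injective (sReal_localV hA hb)
  rw [← localV_re_eq hA hb, h]

/-- By monotonicity it suffices to look at `s = ±√A/100`, where `v` is within `1/900` of `±1/100`;
and `1/100 - 1/900 = 8/900`. -/
lemma le_abs_of_le_abs_sReal (hA : 1 ≤ A) {b : ℝ} (hb : 1 / 100 * Real.sqrt A ≤ |sReal A b|) :
    8 / 900 ≤ |b| := by
  have hq := Real.sqrt_pos.2 (by linarith : 0 < A)
  have key : ∀ c : ℝ, |c| = 1 / 100 * Real.sqrt A →
      |(localV A c).re - c / Real.sqrt A| ≤ 1 / 900 ∧ sReal A (localV A c).re = c := by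
    intro c hc
    have hc' : |c| < 1 / 50 * Real.sqrt A := by rw [hc]; linarith
    have hcn : ‖(c : ℂ)‖ < 1 / 50 * Real.sqrt A := by rwa [Complex.norm_real, Real.norm_eq_abs]
    refine ⟨?_, sReal_localV hA hc'⟩
    have h1 := norm_localV_sub_le hA hcn
    have h2 := Complex.abs_re_le_norm (localV A c - c / Real.sqrt A)
    rw [Complex.sub_re, ← Complex.ofReal_div, Complex.ofReal_re] at h2
    rw [Complex.norm_real, Real.norm_eq_abs, ← Complex.ofReal_div, hc,
      mul_div_assoc, div_self hq.ne'] at h1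
    linarith
  rcases le_total 0 (sReal A b) with h | h
  · rw [abs_of_nonneg h] at hb
    have hc : |1 / 100 * Real.sqrt A| = 1 / 100 * Real.sqrt A := abs_of_pos (by positivity)
    obtain ⟨h1, h2⟩ := key _ hc
    rw [← h2] at hb
    have h3 := (sReal_strictMono hA).le_iff_le.1 hb
    rw [mul_div_assoc, div_self hq.ne', abs_le] at h1
    refine le_trans ?_ (le_abs_self b)
    linarith
  · rw [abs_of_nonpos h] at hb
    have hc : |-(1 / 100 * Real.sqrt A)| = 1 / 100 * Real.sqrt A := by
      rw [abs_neg]; exact abs_of_pos (by positivity)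
    obtain ⟨h1, h2⟩ := key _ hc
    have hb' : sReal A b ≤ -(1 / 100 * Real.sqrt A) := by linarith
    rw [← h2] at hb'
    have h3 := (sReal_strictMono hA).le_iff_le.1 hb'
    rw [neg_div, mul_div_assoc, div_self hq.ne', abs_le] at h1
    refine le_trans ?_ (neg_le_abs b)
    linarith

/-- The function `g(s) = 1 / (ζ - s) - v'(s) / (e^{b - v(s)} - 1)` near the saddle point, without
its value at the removable singularity `s = ζ`. -/
def gLocal (A b : ℝ) (s : ℂ) : ℂ :=
  1 / (sReal A b - s) - deriv (localV A) s / (Complex.exp (b - localV A s) - 1)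

lemma differentiableOn_deriv_localV (hA : 1 ≤ A) :
    DifferentiableOn ℂ (deriv (localV A)) (Metric.ball 0 (1 / 50 * Real.sqrt A)) :=
  DifferentiableOn.deriv (fun _ hs => (hasDerivAt_localV hA
    (mem_ball_zero_iff.1 hs)).differentiableAt.differentiableWithinAt) Metric.isOpen_ball

/-- The imaginary part of `v` is small, so `e^{b - v} = 1` forces `v = b` and hence `s² = ζ²`. The
root `s = -ζ` is excluded by injectivity of `localV`, since then `ζ` also lies in the disc and has
the same image `b`. -/
lemma exp_sub_localV_ne_one (hA : 1 ≤ A) {b : ℝ} {s : ℂ} (hs : ‖s‖ < 1 / 50 * Real.sqrt A)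
    (hne : s ≠ sReal A b) : Complex.exp (b - localV A s) - 1 ≠ 0 := by
  intro h
  have hlt : ‖localV A s‖ < 1 / 40 := norm_localInv_lt hA (norm_div_sqrt_lt hA hs)
  have h1 : Complex.exp b = Complex.exp (localV A s) := by
    rw [← sub_add_cancel (b : ℂ) (localV A s), Complex.exp_add, sub_eq_zero.1 h, one_mul]
  have hpi := Real.pi_gt_three
  have him := abs_lt.1 ((Complex.abs_im_le_norm _).trans_lt hlt)
  have h2 : (b : ℂ) = localV A s := by
    have := congrArg Complex.log h1
    rwa [Complex.log_exp (by simp; linarith) (by simp; linarith),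
      Complex.log_exp (by linarith) (by linarith)] at this
  have hpsi := psi_localV hA hs
  rw [← h2, psi_ofReal] at hpsi
  have hsq := sReal_sq hA b
  have hs2 : s ^ 2 = (sReal A b : ℂ) ^ 2 := by
    have : ((sReal A b : ℝ) : ℂ) ^ 2 = ((2 * psiReal A b : ℝ) : ℂ) := by
      rw [← hsq]; push_cast; rfl
    rw [this]; push_cast; rw [hpsi]; ring
  rcases sq_eq_sq_iff_eq_or_eq_neg.1 hs2 with h3 | h3
  · exact hne h3
  · have habs : |-sReal A b| < 1 / 50 * Real.sqrt A := by
      rw [h3, ← Complex.ofReal_neg, Complex.norm_real] at hs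
      exact hs
    have h4 := localV_sReal hA (b := b) (by rwa [abs_neg] at habs)
    have h5 := (norm_localV_sub_localV_le hA hs (z := sReal A b)
      (by rw [abs_neg] at habs; rwa [Complex.norm_real])).1
    rw [h4, h2, sub_self, norm_zero] at h5
    have hq := Real.sqrt_pos.2 (by linarith : 0 < A)
    have h6 : ‖s - sReal A b‖ / Real.sqrt A ≤ 0 := by linarith
    rw [div_le_iff₀ hq, zero_mul, norm_le_zero_iff, sub_eq_zero] at h6
    exact hne h6

lemma differentiableAt_gLocal (hA : 1 ≤ A) {b : ℝ} {s : ℂ} (hs : ‖s‖ < 1 / 50 * Real.sqrt A)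
    (hne : s ≠ sReal A b) : DifferentiableAt ℂ (gLocal A b) s := by
  have h1 := (hasDerivAt_localV hA hs).differentiableAt
  have h2 : DifferentiableAt ℂ (deriv (localV A)) s :=
    (differentiableOn_deriv_localV hA).differentiableAt
      (Metric.isOpen_ball.mem_nhds (mem_ball_zero_iff.2 hs))
  have h3 := exp_sub_localV_ne_one hA (b := b) hs hne
  have h4 : (sReal A b : ℂ) - s ≠ 0 := sub_ne_zero.2 hne.symm
  unfold gLocal
  refine DifferentiableAt.sub (DifferentiableAt.div (by fun_prop) (by fun_prop) h4)
    (DifferentiableAt.div h2 (by fun_prop) h3)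

/-- With `E = e^v` and `z = ζ`, the function `F = E v' / dslope E z` equals `(s - z) E v' / (E - E
z)`, which is `f`. The denominator never vanishes, `F z = 1`, and `g` is the divided difference of
`F` at `z`. When `ζ` lies outside the disc, `gLocal` is already holomorphic. -/
lemma exists_extension_gLocal (hA : 1 ≤ A) (b : ℝ) :
    ∃ G : ℂ → ℂ, DifferentiableOn ℂ G (Metric.ball 0 (1 / 50 * Real.sqrt A)) ∧
      ∀ s ∈ Metric.ball (0 : ℂ) (1 / 50 * Real.sqrt A), s ≠ sReal A b → G s = gLocal A b s := by
  rcases lt_or_ge |sReal A b| (1 / 50 * Real.sqrt A) with hb | hb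
  · set U := Metric.ball (0 : ℂ) (1 / 50 * Real.sqrt A) with hU
    set z : ℂ := ((sReal A b : ℝ) : ℂ) with hz
    have hzU : z ∈ U := by
      rw [hU, mem_ball_zero_iff, hz, Complex.norm_real]; exact hb
    have hUz : U ∈ nhds z := Metric.isOpen_ball.mem_nhds hzU
    set E := fun s => Complex.exp (localV A s) with hE
    have hEd : ∀ s ∈ U, HasDerivAt E (Complex.exp (localV A s) * deriv (localV A) s) s := by
      intro s hs
      exact ((hasDerivAt_localV hA
        (mem_ball_zero_iff.1 hs)).differentiableAt.hasDerivAt).cexp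
    have hEon : DifferentiableOn ℂ E U := fun s hs =>
      (hEd s hs).differentiableAt.differentiableWithinAt
    have hVz : localV A z = b := localV_sReal hA hb
    set D := dslope E z with hD
    have hDon : DifferentiableOn ℂ D U := (Complex.differentiableOn_dslope hUz).2 hEon
    have hne : ∀ s ∈ U, s ≠ z → E s - E z ≠ 0 := by
      intro s hs hsz h
      refine exp_sub_localV_ne_one hA (mem_ball_zero_iff.1 hs) hsz ?_
      rw [Complex.exp_sub, ← hVz]
      change E z / E s - 1 = 0
      rw [← sub_eq_zero.1 h, div_self (Complex.exp_ne_zero _), sub_self]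
    have hDs : ∀ s, s ≠ z → D s = (E s - E z) / (s - z) := by
      intro s hsz
      rw [hD, dslope_of_ne _ hsz, slope_def_field]
    have hDz : D z = Complex.exp (localV A z) * deriv (localV A) z := by
      rw [hD, dslope_same, (hEd z hzU).deriv]
    have hV'z : deriv (localV A) z ≠ 0 := by
      have hzn := mem_ball_zero_iff.1 hzU
      rw [(hasDerivAt_localV hA hzn).deriv]
      have hq := Real.sqrt_pos.2 (by linarith : 0 < A)
      exact div_ne_zero (deriv_localInv_ne_zero hA (norm_div_sqrt_lt hA hzn))
        (by exact_mod_cast hq.ne')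
    have hD0 : ∀ s ∈ U, D s ≠ 0 := by
      intro s hs
      rcases eq_or_ne s z with rfl | hsz
      · rw [hDz]; exact mul_ne_zero (Complex.exp_ne_zero _) hV'z
      · rw [hDs s hsz]; exact div_ne_zero (hne s hs hsz) (sub_ne_zero.2 hsz)
    set F := fun s => (E s * deriv (localV A) s) / D s with hF
    have hFon : DifferentiableOn ℂ F U :=
      (hEon.mul (differentiableOn_deriv_localV hA)).div hDon hD0
    have hFz : F z = 1 := by
      rw [hF]; simp only
      rw [hDz]
      exact div_self (mul_ne_zero (Complex.exp_ne_zero _) hV'z)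
    refine ⟨dslope F z, (Complex.differentiableOn_dslope hUz).2 hFon, fun s hs hsz => ?_⟩
    rw [dslope_of_ne _ hsz, slope_def_field, hFz, gLocal, ← hz, Complex.exp_sub, ← hVz]
    change (F s - 1) / (s - z) = 1 / (z - s) - deriv (localV A) s / (E z / E s - 1)
    have h1 := hne s hs hsz
    have h2 : s - z ≠ 0 := sub_ne_zero.2 hsz
    have h3 : E s ≠ 0 := Complex.exp_ne_zero _
    have h4 : E z / E s - 1 = -(E s - E z) / E s := by field_simp; ring
    rw [hF]
    simp only
    rw [hDs s hsz, h4, ← neg_sub s z]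
    field_simp
    ring
  · have hne : ∀ s ∈ Metric.ball (0 : ℂ) (1 / 50 * Real.sqrt A), s ≠ sReal A b := by
      rintro s hs rfl
      rw [mem_ball_zero_iff, Complex.norm_real] at hs
      exact absurd hs (not_lt.2 hb)
    exact ⟨gLocal A b, fun s hs => (differentiableAt_gLocal hA (mem_ball_zero_iff.1 hs)
      (hne s hs)).differentiableWithinAt, fun _ _ _ => rfl⟩

lemma norm_gLocal_le {A b : ℝ} {s : ℂ} {c e V : ℝ} (hc : 0 < c) (he : 0 < e)
    (h1 : c ≤ ‖(sReal A b : ℂ) - s‖) (h2 : e ≤ ‖Complex.exp (b - localV A s) - 1‖)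
    (h3 : ‖deriv (localV A) s‖ ≤ V) : ‖gLocal A b s‖ ≤ 1 / c + V / e := by
  unfold gLocal
  refine (norm_sub_le _ _).trans (add_le_add ?_ ?_)
  · rw [norm_div, norm_one]
    gcongr
  · rw [norm_div]
    have : 0 ≤ V := (norm_nonneg _).trans h3
    gcongr

/-- The two terms of `gLocal` are each large near `ζ`, and only their difference is bounded. If `ζ`
lies within `√A/100`, both terms are bounded on the circle of radius `3√A/200`, at distance at least
`√A/200` from `ζ`, and the maximum principle transfers the bound inward. Otherwise `ζ` is far from
`s` and the terms are bounded directly. -/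
lemma norm_extension_le (hA : 1 ≤ A) (b : ℝ) {G : ℂ → ℂ}
    (hG : DifferentiableOn ℂ G (Metric.ball 0 (1 / 50 * Real.sqrt A)))
    (hGe : ∀ s ∈ Metric.ball (0 : ℂ) (1 / 50 * Real.sqrt A), s ≠ sReal A b → G s = gLocal A b s)
    {s : ℂ} (hs : ‖s‖ ≤ 1 / 400 * Real.sqrt A) : ‖G s‖ ≤ 2000 := by
  have h1 : 1 ≤ Real.sqrt A := Real.one_le_sqrt.2 hA
  have hz : ‖(sReal A b : ℂ)‖ = |sReal A b| := by rw [Complex.norm_real, Real.norm_eq_abs]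
  rcases lt_or_ge |sReal A b| (1 / 100 * Real.sqrt A) with hb | hb
  · have hcirc : ∀ z ∈ Metric.sphere (0 : ℂ) (3 / 200 * Real.sqrt A), ‖G z‖ ≤ 2000 := by
      intro z hzs
      rw [mem_sphere_zero_iff_norm] at hzs
      have hzlt : ‖z‖ < 1 / 50 * Real.sqrt A := by rw [hzs]; linarith
      have hd : 1 / 200 * Real.sqrt A ≤ ‖(sReal A b : ℂ) - z‖ := by
        have := norm_sub_norm_le z (sReal A b : ℂ)
        rw [norm_sub_rev, hz, hzs] at this
        linarith
      have hd2 : ‖(sReal A b : ℂ) - z‖ ≤ 1 / 40 * Real.sqrt A := by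
        have := norm_sub_le (sReal A b : ℂ) z
        rw [hz, hzs] at this
        linarith
      have hne : z ≠ sReal A b := by
        rintro rfl
        rw [sub_self, norm_zero] at hd
        linarith
      have hV := norm_localV_sub_localV_le hA (s := sReal A b) (z := z)
        (by rw [hz]; linarith) hzlt
      rw [localV_sReal hA (by linarith)] at hV
      have hl : 1 / 200 ≤ ‖(sReal A b : ℂ) - z‖ / Real.sqrt A := by
        rw [le_div_iff₀ (by linarith)]; exact hd
      have hu : ‖(sReal A b : ℂ) - z‖ / Real.sqrt A ≤ 1 / 40 := by
        rw [div_le_iff₀ (by linarith)]; exact hd2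
      have he := half_norm_le_norm_exp_sub_one (z := b - localV A z) (by linarith [hV.2])
      rw [hGe z (mem_ball_zero_iff.2 hzlt) hne]
      refine (norm_gLocal_le (c := 1 / 200) (e := 1 / 450) (V := 2) (by norm_num) (by norm_num)
        (by linarith) (by linarith [hV.1]) (norm_deriv_localV_le hA hzlt)).trans (by norm_num)
    have hcl : closure (Metric.ball (0 : ℂ) (3 / 200 * Real.sqrt A)) =
        Metric.closedBall 0 (3 / 200 * Real.sqrt A) := closure_ball _ (by positivity)
    refine Complex.norm_le_of_forall_mem_frontier_norm_le
      (U := Metric.ball 0 (3 / 200 * Real.sqrt A)) Metric.isBounded_ball ?_ ?_ ?_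
    · refine DifferentiableOn.diffContOnCl (hG.mono ?_)
      rw [hcl]
      exact Metric.closedBall_subset_ball (by linarith)
    · rw [frontier_ball _ (by positivity)]
      exact hcirc
    · rw [hcl, mem_closedBall_zero_iff]
      linarith
  · have hslt : ‖s‖ < 1 / 50 * Real.sqrt A := by linarith
    have hd : 3 / 400 * Real.sqrt A ≤ ‖(sReal A b : ℂ) - s‖ := by
      have := norm_sub_norm_le (sReal A b : ℂ) s
      rw [hz] at this
      linarith
    have hne : s ≠ sReal A b := by
      rintro rfl
      rw [sub_self, norm_zero] at hd
      linarith
    have hbl := le_abs_of_le_abs_sReal hA hb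
    have hV := norm_localV_le hA hslt
    have hs' : ‖s‖ / Real.sqrt A ≤ 1 / 400 := by
      rw [div_le_iff₀ (by linarith)]; exact hs
    -- `|b| ≥ 8/900` and `‖v‖ ≤ (10/9) (1/400) = 1/360`, with difference `11/1800`.
    have hre : 11 / 1800 ≤ |((b : ℂ) - localV A s).re| := by
      rw [Complex.sub_re, Complex.ofReal_re]
      have h2 := Complex.abs_re_le_norm (localV A s)
      have h3 := abs_sub_abs_le_abs_sub b (localV A s).re
      linarith
    have he := half_le_norm_exp_sub_one (by norm_num) (by norm_num) hre
    rw [hGe s (mem_ball_zero_iff.2 hslt) hne]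
    refine (norm_gLocal_le (c := 3 / 400) (e := 11 / 1800 / 2) (V := 2) (by norm_num)
      (by norm_num) (by linarith) he (norm_deriv_localV_le hA hslt)).trans (by norm_num)

end LocalExtension

/-! ### The function g on the imaginary axis -/

section

variable {x y : ℝ}

lemma pathArg_ne_zero (hx : 0 < x) (hy : 0 < y) {σ : ℝ} (hσ : σ ≠ 0) : pathArg x y σ ≠ 0 :=
  fun h0 => hσ ((pathArg_strictMono hx hy).injective (by rw [h0, pathArg_zero hx hy]))

lemma psiDeriv_pathFun_ne_zero (hx : 0 < x) (hy : 0 < y) {σ : ℝ} (hσ : σ ≠ 0) :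
    psiDeriv (amp x y) (pathFun x y σ) ≠ 0 :=
  norm_pos_iff.1 ((abs_pos.2 (pathArg_ne_zero hx hy hσ)).trans_le
    (abs_pathArg_le_norm_psiDeriv hx hy σ))

lemma pathFun_im (x y σ : ℝ) : (pathFun x y σ).im = pathArg x y σ := pathV_im _ _ _

lemma exp_sub_pathFun_ne_one (hx : 0 < x) (hy : 0 < y) (b : ℝ) {σ : ℝ} (hσ : σ ≠ 0) :
    Complex.exp (b - pathFun x y σ) - 1 ≠ 0 := by
  have hm := pathArg_mem hx hy σ
  have h0 := pathArg_ne_zero hx hy hσ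
  have habs : |pathArg x y σ| < Real.pi := abs_lt.2 ⟨hm.1, hm.2⟩
  have hmin : 0 < min |pathArg x y σ| (Real.pi / 2) :=
    lt_min (abs_pos.2 h0) (by linarith [Real.pi_pos])
  have h := sin_le_norm_exp_sub_one hmin (θ := -pathArg x y σ)
    (by rw [abs_neg]; exact min_le_left _ _) (by rw [abs_neg]; exact habs.le) (min_le_right _ _)
    (z := b - pathFun x y σ) (by simp [pathFun_im])
  have hs := Real.sin_pos_of_pos_of_lt_pi hmin ((min_le_left _ _).trans_lt habs)
  exact norm_pos_iff.1 (hs.trans_le h)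

lemma rho_sub_tImag (hx : 0 < x) (hy : 0 < y) (σ : ℝ) :
    (rho x y : ℂ) - tImag x y σ =
      tImag x y σ * (Complex.exp (poleCoord x y - pathFun x y σ) - 1) := by
  have h : (rho x y : ℂ) = saddle x y * Complex.exp (poleCoord x y) := by
    exact_mod_cast congrArg (fun r : ℝ => (r : ℂ)) (rho_eq hx hy)
  rw [h, tImag_eq hx hy, mul_sub, mul_assoc (saddle x y : ℂ), ← Complex.exp_add,
    add_sub_cancel, mul_one]

lemma tImag_ne_zero (hx : 0 < x) (hy : 0 < y) (σ : ℝ) : tImag x y σ ≠ 0 := by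
  rw [tImag_eq hx hy]
  exact mul_ne_zero (by exact_mod_cast (saddle_pos hx hy).ne') (Complex.exp_ne_zero _)

/-- The integrand `(dt/dσ) / (ρ - t)` along the path of steepest descent. -/
lemma deriv_tImag_div (hx : 0 < x) (hy : 0 < y) {σ : ℝ} (hσ : σ ≠ 0) :
    deriv (tImag x y) σ / (rho x y - tImag x y σ) =
      -σ / psiDeriv (amp x y) (pathFun x y σ) /
        (Complex.exp (poleCoord x y - pathFun x y σ) - 1) := by
  rw [(hasDerivAt_tImag hx hy hσ).deriv, rho_sub_tImag hx hy]
  have h1 := tImag_ne_zero hx hy σ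
  have h2 := psiDeriv_pathFun_ne_zero hx hy hσ
  have h3 := exp_sub_pathFun_ne_one hx hy (poleCoord x y) hσ
  field_simp

lemma ofReal_sub_I_mul_ne_zero (z : ℝ) {σ : ℝ} (hσ : σ ≠ 0) : (z : ℂ) - Complex.I * σ ≠ 0 := by
  intro h
  have := congrArg Complex.im h
  simp at this
  exact hσ this

/-- Read backwards, `(dt/ds) / (ρ - t) = 1 / (ζ - s) - g(s)`: the pole is split off explicitly. -/
lemma gImag_eq_sub {σ : ℝ} (hσ : σ ≠ 0) :
    gImag x y σ = 1 / (zeta x y - Complex.I * σ) -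
      deriv (tImag x y) σ / (rho x y - tImag x y σ) / Complex.I := by
  have h0 := ofReal_sub_I_mul_ne_zero (zeta x y) hσ
  have h1 : Complex.I * σ - (zeta x y : ℂ) ≠ 0 := by
    rw [← neg_sub]; exact neg_ne_zero.2 h0
  rw [gImag, fImag]
  rw [← neg_sub (zeta x y : ℂ)] at h1 ⊢
  generalize deriv (tImag x y) σ = d
  generalize (rho x y : ℂ) - tImag x y σ = r
  generalize (zeta x y : ℂ) - Complex.I * σ = z at *
  have hI := Complex.I_ne_zero
  -- The case `r = 0` is harmless: as `w / 0 = 0`, both sides are then `1 / z`.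
  rcases eq_or_ne r 0 with rfl | hr
  · simp
  · field_simp
    ring

lemma gImag_eq (hx : 0 < x) (hy : 0 < y) {σ : ℝ} (hσ : σ ≠ 0) :
    gImag x y σ = 1 / (zeta x y - Complex.I * σ) -
      (Complex.I * σ / psiDeriv (amp x y) (pathFun x y σ)) /
        (Complex.exp (poleCoord x y - pathFun x y σ) - 1) := by
  rw [gImag_eq_sub hσ, deriv_tImag_div hx hy hσ]
  congr 1
  rw [div_right_comm]
  congr 1
  rw [div_right_comm]
  congr 1
  rw [div_eq_iff Complex.I_ne_zero]
  linear_combination (-(σ : ℂ)) * Complex.I_mul_I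

lemma psiDeriv_localV {A : ℝ} (hA : 1 ≤ A) {s : ℂ} (hs : ‖s‖ < 1 / 50 * Real.sqrt A) :
    psiDeriv A (localV A s) * deriv (localV A) s = s := by
  have h1 : HasDerivAt (fun z => psi A (localV A z))
      (psiDeriv A (localV A s) * deriv (localV A) s) s :=
    (hasDerivAt_psi A (localV A s)).comp s
      (hasDerivAt_localV hA hs).differentiableAt.hasDerivAt
  have h2 : HasDerivAt (fun z : ℂ => z ^ 2 / 2) s s :=
    ((hasDerivAt_pow 2 s).div_const 2).congr_deriv (by simp)
  refine h1.unique (h2.congr_of_eventuallyEq ?_)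
  filter_upwards [Metric.isOpen_ball.mem_nhds (mem_ball_zero_iff.2 hs)] with z hz
  exact psi_localV hA (mem_ball_zero_iff.1 hz)

lemma gImag_eq_gLocal (hx : 0 < x) (hy : 0 < y) {σ : ℝ} (hσ : σ ≠ 0)
    (hs : |σ| < 1 / 50 * Real.sqrt (amp x y)) :
    gImag x y σ = gLocal (amp x y) (poleCoord x y) (Complex.I * σ) := by
  have hA := (one_lt_amp hx hy).le
  have hn : ‖Complex.I * (σ : ℂ)‖ < 1 / 50 * Real.sqrt (amp x y) := by simpa using hs
  have hp := psiDeriv_localV hA hn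
  have hne := psiDeriv_pathFun_ne_zero hx hy hσ
  rw [gImag_eq hx hy hσ, gLocal, ← zeta_eq hx hy]
  rw [pathFun_eq_localV hx hy hs] at hne ⊢
  rw [div_eq_iff hne |>.2 (show Complex.I * σ = deriv (localV (amp x y)) (Complex.I * σ) *
    psiDeriv (amp x y) (localV (amp x y) (Complex.I * σ)) from
      (hp.symm.trans (mul_comm _ _)))]

/-- The argument is monotone in `σ`, and at `σ = √A/400` it differs from `1/400` by at most a ninth;
`(8/9) / 400 = 1/450`. -/
lemma le_abs_pathArg (hx : 0 < x) (hy : 0 < y) {σ : ℝ}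
    (hs : 1 / 400 * Real.sqrt (amp x y) ≤ |σ|) : 1 / 450 ≤ |pathArg x y σ| := by
  have hA := (one_lt_amp hx hy).le
  have hq := Real.sqrt_pos.2 (by linarith : 0 < amp x y)
  set τ := 1 / 400 * Real.sqrt (amp x y) with hτ
  have hτ0 : 0 < τ := by positivity
  have hτl : |τ| < 1 / 50 * Real.sqrt (amp x y) := by rw [abs_of_pos hτ0, hτ]; linarith
  have h1 : 1 / 450 ≤ pathArg x y τ := by
    rw [← pathFun_im, pathFun_eq_localV hx hy hτl]
    have hn : ‖Complex.I * (τ : ℂ)‖ = τ := by simp [abs_of_pos hτ0]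
    have h2 := norm_localV_sub_le hA (s := Complex.I * τ) (by rw [hn, ← abs_of_pos hτ0]; exact hτl)
    have hdiv : τ / Real.sqrt (amp x y) = 1 / 400 := by
      rw [hτ, mul_div_assoc, div_self hq.ne', mul_one]
    rw [hn, hdiv] at h2
    have h3 := Complex.abs_im_le_norm
      (localV (amp x y) (Complex.I * τ) - Complex.I * τ / Real.sqrt (amp x y))
    have h4 : (Complex.I * (τ : ℂ) / Real.sqrt (amp x y)).im = 1 / 400 := by
      rw [mul_div_assoc, ← Complex.ofReal_div, hdiv]; simp
    rw [Complex.sub_im, h4] at h3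
    have := (abs_le.1 (h3.trans h2)).1
    linarith
  have hmono := (pathArg_strictMono hx hy).monotone
  rcases le_total 0 σ with h | h
  · rw [abs_of_nonneg h] at hs
    exact (h1.trans (hmono hs)).trans (le_abs_self _)
  · rw [abs_of_nonpos h] at hs
    have := hmono hs
    rw [pathArg_neg hx hy] at this
    exact (h1.trans this).trans (neg_le_abs _)

/-- For `|σ| < √A/400` the holomorphic extension gives `2000`. Beyond, `|ζ - iσ| ≥ 1/400`, `‖ψ'‖ ≥
1/450` and `‖e^{b - v} - 1‖ ≥ sin (1/450) ≥ 1/900`, whence `400 + 450 · 900 |σ|`. The constant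
depends on neither `x` nor `y`, which drives both the expansion and the limit `ρ → t₀`. -/
lemma norm_gImag_le (hx : 0 < x) (hy : 0 < y) {σ : ℝ} (hσ : σ ≠ 0) :
    ‖gImag x y σ‖ ≤ 405000 * (1 + |σ|) := by
  have hA := (one_lt_amp hx hy).le
  have h1 : 1 ≤ Real.sqrt (amp x y) := Real.one_le_sqrt.2 hA
  have hσ0 := abs_pos.2 hσ
  rcases lt_or_ge |σ| (1 / 400 * Real.sqrt (amp x y)) with hs | hs
  · have hn : ‖Complex.I * (σ : ℂ)‖ = |σ| := by simp
    obtain ⟨G, hG, hGe⟩ := exists_extension_gLocal hA (poleCoord x y)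
    have hb := norm_extension_le hA (poleCoord x y) hG hGe (s := Complex.I * σ) (by rw [hn]; exact hs.le)
    have hne : Complex.I * (σ : ℂ) ≠ sReal (amp x y) (poleCoord x y) := fun h =>
      ofReal_sub_I_mul_ne_zero _ hσ (sub_eq_zero.2 h.symm)
    rw [hGe _ (mem_ball_zero_iff.2 (by rw [hn]; linarith)) hne,
      ← gImag_eq_gLocal hx hy hσ (by linarith)] at hb
    linarith
  · rw [gImag_eq hx hy hσ]
    have hθ := le_abs_pathArg hx hy hs
    have hm := pathArg_mem hx hy σ
    have hpi := Real.pi_gt_three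
    have he := sin_le_norm_exp_sub_one (θ₀ := 1 / 450) (by norm_num) (θ := -pathArg x y σ)
      (by rw [abs_neg]; exact hθ) (by rw [abs_neg]; exact (abs_lt.2 ⟨hm.1, hm.2⟩).le) (by linarith)
      (z := poleCoord x y - pathFun x y σ) (by simp [pathFun_im])
    have hsin : 1 / 900 ≤ Real.sin (1 / 450) := by
      have := Real.sin_gt_sub_cube (x := 1 / 450) (by norm_num)
      norm_num at this ⊢
      linarith
    have hp := hθ.trans (abs_pathArg_le_norm_psiDeriv hx hy σ)
    have hz : |σ| ≤ ‖(zeta x y : ℂ) - Complex.I * σ‖ := by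
      have := Complex.abs_im_le_norm ((zeta x y : ℂ) - Complex.I * σ)
      simpa using this
    have e1 : ‖1 / ((zeta x y : ℂ) - Complex.I * σ)‖ ≤ 400 := by
      rw [norm_div, norm_one, div_le_iff₀ (hσ0.trans_le hz)]
      linarith
    have e2 : ‖Complex.I * σ / psiDeriv (amp x y) (pathFun x y σ) /
        (Complex.exp (poleCoord x y - pathFun x y σ) - 1)‖ ≤ |σ| / (1 / 450) / (1 / 900) := by
      rw [norm_div, norm_div]
      have hn : ‖Complex.I * (σ : ℂ)‖ = |σ| := by simp
      rw [hn]
      gcongr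
      exact hsin.trans he
    refine (norm_sub_le _ _).trans ((add_le_add e1 e2).trans ?_)
    linarith

lemma continuousOn_gImag (hx : 0 < x) (hy : 0 < y) : ContinuousOn (gImag x y) {0}ᶜ := by
  have hc := continuous_pathFun hx hy
  have h : ContinuousOn (fun σ : ℝ => 1 / ((zeta x y : ℂ) - Complex.I * σ) -
      (Complex.I * σ / psiDeriv (amp x y) (pathFun x y σ)) /
        (Complex.exp (poleCoord x y - pathFun x y σ) - 1)) {0}ᶜ := by
    have hp : Continuous fun σ : ℝ => psiDeriv (amp x y) (pathFun x y σ) := by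
      unfold psiDeriv
      have h1 := Complex.continuous_sinh.comp hc
      have h2 := Complex.continuous_cosh.comp hc
      fun_prop
    refine ContinuousOn.sub (ContinuousOn.div (by fun_prop) (by fun_prop) fun σ hσ =>
      ofReal_sub_I_mul_ne_zero _ hσ) (ContinuousOn.div (ContinuousOn.div (by fun_prop)
      hp.continuousOn fun σ hσ => psiDeriv_pathFun_ne_zero hx hy hσ) (by fun_prop)
      fun σ hσ => exp_sub_pathFun_ne_one hx hy _ hσ)
  exact h.congr fun σ hσ => gImag_eq hx hy hσ

/-! ### One holomorphic function behind the real and the imaginary definition of g -/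

lemma ofReal_deriv_tReal (hx : 0 < x) (hy : 0 < y) {s : ℝ}
    (hs : |s| < 1 / 50 * Real.sqrt (amp x y)) :
    ((deriv (tReal x y) s : ℝ) : ℂ) =
      tReal x y s * deriv (localV (amp x y)) s := by
  have hA := (one_lt_amp hx hy).le
  have hn : ‖(s : ℂ)‖ < 1 / 50 * Real.sqrt (amp x y) := by
    rwa [Complex.norm_real, Real.norm_eq_abs]
  have h1 := (((hasDerivAt_localV hA hn).differentiableAt.hasDerivAt).cexp).const_mul
    (saddle x y : ℂ)
  have hev : ∀ᶠ t : ℝ in nhds s,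
      (tReal x y t : ℂ) = saddle x y * Complex.exp (localV (amp x y) t) := by
    filter_upwards [(continuous_abs.tendsto s).eventually_lt_const hs] with t ht
    exact tReal_eq hx hy ht
  obtain ⟨h2, h3⟩ := hasDerivAt_of_ofReal_eq h1 hev
  rw [h2.deriv, h3, tReal_eq hx hy hs]
  ring

lemma fReal_eq (hx : 0 < x) (hy : 0 < y) {s : ℝ} (hs : |s| < 1 / 50 * Real.sqrt (amp x y))
    (hne : s ≠ zeta x y) :
    (fReal x y s : ℂ) = 1 + (s - zeta x y) * gLocal (amp x y) (poleCoord x y) s := by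
  have hA := (one_lt_amp hx hy).le
  have hn : ‖(s : ℂ)‖ < 1 / 50 * Real.sqrt (amp x y) := by
    rwa [Complex.norm_real, Real.norm_eq_abs]
  have hne' : (s : ℂ) ≠ sReal (amp x y) (poleCoord x y) := by
    rw [← zeta_eq hx hy]; exact_mod_cast hne
  have he := exp_sub_localV_ne_one hA hn hne'
  have ht : (tReal x y s : ℂ) ≠ 0 := by
    rw [tReal_eq hx hy hs]
    exact mul_ne_zero (by exact_mod_cast (saddle_pos hx hy).ne') (Complex.exp_ne_zero _)
  have hrho : (rho x y : ℂ) - tReal x y s = tReal x y s *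
      (Complex.exp (poleCoord x y - localV (amp x y) s) - 1) := by
    have h : (rho x y : ℂ) = saddle x y * Complex.exp (poleCoord x y) := by
      exact_mod_cast congrArg (fun r : ℝ => (r : ℂ)) (rho_eq hx hy)
    rw [h, tReal_eq hx hy hs, mul_sub, mul_assoc (saddle x y : ℂ), ← Complex.exp_add,
      add_sub_cancel, mul_one]
  have hz : (zeta x y : ℂ) - s ≠ 0 := sub_ne_zero.2 (by rw [zeta_eq hx hy]; exact hne'.symm)
  rw [fReal, if_neg hne, gLocal, ← zeta_eq hx hy]
  push_cast
  rw [ofReal_deriv_tReal hx hy hs, hrho]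
  have h2 : (s : ℂ) - zeta x y = -(zeta x y - s) := by ring
  rw [h2]
  field_simp
  ring

lemma fReal_zeta (x y : ℝ) : fReal x y (zeta x y) = 1 := by simp [fReal]

/-- The holomorphic extension of `g` to a disc of fixed radius around the origin. -/
lemma exists_extension_g (hx : 0 < x) (hy : 0 < y) :
    ∃ G : ℂ → ℂ, DifferentiableOn ℂ G (Metric.ball 0 (1 / 400)) ∧
      (∀ s ∈ Metric.ball (0 : ℂ) (1 / 400), ‖G s‖ ≤ 2000) ∧
      (∀ σ : ℝ, σ ≠ 0 → |σ| < 1 / 400 → gImag x y σ = G (Complex.I * σ)) ∧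
      (∀ s : ℝ, |s| < 1 / 400 → (gReal x y s : ℂ) = G s) ∧
      (zeta x y ≠ 0 → G 0 = 1 / zeta x y -
        1 / Real.sqrt (amp x y) / (Complex.exp (poleCoord x y) - 1)) := by
  have hA := (one_lt_amp hx hy).le
  have h1 : 1 ≤ Real.sqrt (amp x y) := Real.one_le_sqrt.2 hA
  obtain ⟨G, hG, hGe⟩ := exists_extension_gLocal hA (poleCoord x y)
  have hsub : Metric.ball (0 : ℂ) (1 / 400) ⊆ Metric.ball 0 (1 / 50 * Real.sqrt (amp x y)) :=
    Metric.ball_subset_ball (by linarith)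
  refine ⟨G, hG.mono hsub, fun s hs => norm_extension_le hA (poleCoord x y) hG hGe
    (by have := mem_ball_zero_iff.1 hs; linarith), fun σ hσ hs => ?_, fun s hs => ?_, fun hz => ?_⟩
  · have hne : Complex.I * (σ : ℂ) ≠ sReal (amp x y) (poleCoord x y) := fun h =>
      ofReal_sub_I_mul_ne_zero _ hσ (sub_eq_zero.2 h.symm)
    rw [hGe _ (mem_ball_zero_iff.2 (by simp; linarith)) hne,
      ← gImag_eq_gLocal hx hy hσ (by linarith)]
  · have key : ∀ t : ℝ, |t| < 1 / 400 →
        (fReal x y t : ℂ) = 1 + (t - zeta x y) * G t := by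
      intro t ht
      rcases eq_or_ne t (zeta x y) with rfl | hne
      · simp [fReal_zeta]
      · have htm : (t : ℂ) ∈ Metric.ball (0 : ℂ) (1 / 50 * Real.sqrt (amp x y)) := by
          rw [mem_ball_zero_iff, Complex.norm_real, Real.norm_eq_abs]; linarith
        rw [fReal_eq hx hy (by linarith) hne, hGe t htm
          (by rw [← zeta_eq hx hy]; exact_mod_cast hne)]
    rcases eq_or_ne s (zeta x y) with hsz | hne
    · have hsm : (s : ℂ) ∈ Metric.ball (0 : ℂ) (1 / 400) := by
        rwa [mem_ball_zero_iff, Complex.norm_real, Real.norm_eq_abs]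
      have hGd : DifferentiableAt ℂ G s := (hG.mono hsub).differentiableAt
        (Metric.isOpen_ball.mem_nhds hsm)
      -- At `s = ζ` the divided difference is `f'(ζ)`, and differentiating `f = 1 + (z - ζ) G` there
      -- gives `G ζ`.
      have hF : HasDerivAt (fun z : ℂ => 1 + (z - zeta x y) * G z) (G s) s := by
        have h2 : HasDerivAt (fun z : ℂ => 1 + (z - zeta x y) * G z) _ s :=
          (((hasDerivAt_id (s : ℂ)).sub_const (zeta x y : ℂ)).mul hGd.hasDerivAt).const_add 1
        refine h2.congr_deriv ?_
        rw [hsz]; simp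
      obtain ⟨h3, h4⟩ := hasDerivAt_of_ofReal_eq hF (f := fReal x y) (by
        filter_upwards [(continuous_abs.tendsto s).eventually_lt_const hs] with t ht
        exact key t ht)
      rw [gReal, hsz, dslope_same, ← hsz, h3.deriv, h4]
    · have h5 : (s : ℂ) - zeta x y ≠ 0 := sub_ne_zero.2 (by exact_mod_cast hne)
      rw [gReal, dslope_of_ne _ hne, slope_def_field, fReal_zeta]
      push_cast
      rw [key s hs]
      field_simp
      ring
  · have h0 : (0 : ℂ) ≠ sReal (amp x y) (poleCoord x y) := by
      rw [← zeta_eq hx hy]; exact_mod_cast hz.symm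
    have hq : 0 < 1 / 50 * Real.sqrt (amp x y) := by linarith
    rw [hGe 0 (Metric.mem_ball_self hq) h0, gLocal, ← zeta_eq hx hy, sub_zero,
      (hasDerivAt_localV hA (s := 0) (by simpa using hq)).deriv]
    simp [localV, localInv_zero hA, deriv_localInv_zero hA]

end

/-! ### Taylor coefficients and remainders with explicit constants -/

section Taylor

lemma iteratedDeriv_differentiableOn {G : ℂ → ℂ} {U : Set ℂ} (hU : IsOpen U)
    (hG : DifferentiableOn ℂ G U) (n : ℕ) : DifferentiableOn ℂ (iteratedDeriv n G) U := by
  induction n with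
  | zero => simpa using hG
  | succ n ih => rw [iteratedDeriv_succ]; exact ih.deriv hU

lemma ofReal_iteratedDeriv {G : ℂ → ℂ} {g : ℝ → ℝ} {r : ℝ}
    (hG : DifferentiableOn ℂ G (Metric.ball 0 r)) (h : ∀ s : ℝ, |s| < r → (g s : ℂ) = G s)
    (n : ℕ) : ∀ s : ℝ, |s| < r → ((iteratedDeriv n g s : ℝ) : ℂ) = iteratedDeriv n G s := by
  induction n with
  | zero => simpa using h
  | succ n ih =>
    intro s hs
    rw [iteratedDeriv_succ, iteratedDeriv_succ]
    have hsm : (s : ℂ) ∈ Metric.ball (0 : ℂ) r := by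
      rwa [mem_ball_zero_iff, Complex.norm_real, Real.norm_eq_abs]
    have hd := ((iteratedDeriv_differentiableOn Metric.isOpen_ball hG n).differentiableAt
      (Metric.isOpen_ball.mem_nhds hsm)).hasDerivAt
    obtain ⟨h1, h2⟩ := hasDerivAt_of_ofReal_eq hd (f := iteratedDeriv n g) (by
      filter_upwards [(continuous_abs.tendsto s).eventually_lt_const hs] with t ht
      exact ih t ht)
    rw [h1.deriv, h2]

lemma norm_taylorCoeff_le {G : ℂ → ℂ} {r M : ℝ} (hr : 0 < r)
    (hG : DifferentiableOn ℂ G (Metric.ball 0 r)) (hM : ∀ s ∈ Metric.ball (0 : ℂ) r, ‖G s‖ ≤ M)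
    (k : ℕ) : ‖iteratedDeriv k G 0 / (k.factorial : ℂ)‖ ≤ M * (2 / r) ^ k := by
  have h := Complex.norm_iteratedDeriv_le_of_forall_mem_sphere_norm_le (c := 0) (R := r / 2)
    (C := M) (f := G) k (by positivity) ?_ ?_
  · have hk : (0 : ℝ) < k.factorial := by exact_mod_cast k.factorial_pos
    rw [norm_div, Complex.norm_natCast, div_le_iff₀ hk]
    refine h.trans_eq ?_
    rw [div_pow, div_pow]
    field_simp
  · refine DifferentiableOn.diffContOnCl (hG.mono ?_)
    rw [closure_ball _ (by positivity)]
    exact Metric.closedBall_subset_ball (by linarith)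
  · intro z hz
    refine hM z ?_
    rw [mem_sphere_zero_iff_norm] at hz
    rw [mem_ball_zero_iff]
    linarith

/-- Cauchy's estimate on radius `r/2` bounds the coefficients by `M (2/r)^k`; for `‖s‖ ≤ r/4` the
tail is geometric with ratio at most `1/2`, hence the factor `2`. -/
lemma norm_sub_taylor_le {G : ℂ → ℂ} {r M : ℝ} (hr : 0 < r)
    (hG : DifferentiableOn ℂ G (Metric.ball 0 r)) (hM : ∀ s ∈ Metric.ball (0 : ℂ) r, ‖G s‖ ≤ M)
    (n : ℕ) {s : ℂ} (hs : ‖s‖ ≤ r / 4) :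
    ‖G s - ∑ k ∈ Finset.range n, iteratedDeriv k G 0 / (k.factorial : ℂ) * s ^ k‖ ≤
      2 * M * (2 / r * ‖s‖) ^ n := by
  have hsum := Complex.hasSum_taylorSeries_on_ball (c := 0) hG (z := s)
    (by rw [mem_ball_zero_iff]; linarith)
  have hsum' : HasSum (fun k : ℕ => iteratedDeriv k G 0 / (k.factorial : ℂ) * s ^ k) (G s) := by
    have e : (fun k : ℕ => iteratedDeriv k G 0 / (k.factorial : ℂ) * s ^ k) =
        fun k : ℕ => (k.factorial : ℂ)⁻¹ • (s - 0) ^ k • iteratedDeriv k G 0 := by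
      funext k
      simp only [sub_zero, smul_eq_mul]
      ring
    rw [e]
    exact hsum
  have htail := (hasSum_nat_add_iff' n).2 hsum'
  have hM0 : 0 ≤ M := (norm_nonneg _).trans (hM 0 (Metric.mem_ball_self hr))
  have hq : 2 / r * ‖s‖ ≤ 1 / 2 := by
    calc 2 / r * ‖s‖ ≤ 2 / r * (r / 4) := by gcongr
      _ = 1 / 2 := by field_simp; norm_num
  have hgeom : HasSum (fun i : ℕ => M * (2 / r * ‖s‖) ^ n * (1 / 2 : ℝ) ^ i)
      (M * (2 / r * ‖s‖) ^ n * 2) := hasSum_geometric_two.mul_left _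
  rw [← htail.tsum_eq]
  refine (tsum_of_norm_bounded hgeom fun i => ?_).trans_eq (by ring)
  rw [norm_mul, norm_pow]
  calc _ ≤ M * (2 / r) ^ (i + n) * ‖s‖ ^ (i + n) := by
        gcongr
        exact norm_taylorCoeff_le hr hG hM _
    _ = M * (2 / r * ‖s‖) ^ n * (2 / r * ‖s‖) ^ i := by
        rw [mul_assoc, ← mul_pow, pow_add]; ring
    _ ≤ _ := by gcongr

end Taylor

/-! ### Gaussian moments -/

section Gaussian

variable {μ : ℝ}

lemma integrable_pow_mul_gaussian (hμ : 0 < μ) (k : ℕ) :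
    Integrable fun σ : ℝ => σ ^ k * Real.exp (-(μ / 2) * σ ^ 2) := by
  have h := integrable_rpow_mul_exp_neg_mul_sq (b := μ / 2) (by positivity) (s := k)
    (by have : (0 : ℝ) ≤ k := k.cast_nonneg
        linarith)
  refine h.congr (Filter.Eventually.of_forall fun σ => ?_)
  simp only [Real.rpow_natCast]

lemma integral_odd_pow_mul_gaussian {k : ℕ} (hk : Odd k) :
    ∫ σ : ℝ, σ ^ k * Real.exp (-(μ / 2) * σ ^ 2) = 0 := by
  have h := integral_neg_eq_self (fun σ : ℝ => σ ^ k * Real.exp (-(μ / 2) * σ ^ 2)) volume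
  have e : ∀ σ : ℝ, (-σ) ^ k * Real.exp (-(μ / 2) * (-σ) ^ 2) =
      -(σ ^ k * Real.exp (-(μ / 2) * σ ^ 2)) := fun σ => by rw [hk.neg_pow, neg_sq, neg_mul]
  rw [integral_congr_ae (Filter.Eventually.of_forall e), integral_neg] at h
  linarith

lemma integral_even_pow_mul_gaussian (hμ : 0 < μ) (n : ℕ) :
    ∫ σ : ℝ, σ ^ (2 * n) * Real.exp (-(μ / 2) * σ ^ 2) =
      Real.sqrt (2 / μ) * ((2 / μ) ^ n * Real.Gamma (n + 1 / 2)) := by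
  have h1 : ∀ σ : ℝ, σ ^ (2 * n) * Real.exp (-(μ / 2) * σ ^ 2) =
      (fun τ : ℝ => τ ^ (2 * n) * Real.exp (-(μ / 2) * τ ^ 2)) |σ| := by
    intro σ
    simp only [pow_mul, sq_abs]
  rw [integral_congr_ae (Filter.Eventually.of_forall h1)]
  refine (integral_comp_abs (f := fun τ : ℝ => τ ^ (2 * n) * Real.exp (-(μ / 2) * τ ^ 2))).trans ?_
  have h2 := integral_rpow_mul_exp_neg_mul_rpow (p := 2) (q := (2 * n : ℕ)) (b := μ / 2) two_pos
    (by have : (0 : ℝ) ≤ (2 * n : ℕ) := Nat.cast_nonneg _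
        linarith) (by positivity)
  have h3 : ∀ σ : ℝ, σ ^ (((2 * n : ℕ)) : ℝ) * Real.exp (-(μ / 2) * σ ^ (2 : ℝ)) =
      σ ^ (2 * n) * Real.exp (-(μ / 2) * σ ^ 2) := by
    intro σ
    rw [Real.rpow_natCast, Real.rpow_two]
  simp_rw [h3] at h2
  rw [h2]
  have h4 : (((2 * n : ℕ) : ℝ) + 1) / 2 = n + 1 / 2 := by push_cast; ring
  have h5 : -(((2 * n : ℕ) : ℝ) + 1) / 2 = -(n + 1 / 2) := by push_cast; ring
  rw [h4, h5, Real.rpow_neg (by positivity), ← Real.inv_rpow (by positivity), inv_div,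
    Real.rpow_add (by positivity), Real.rpow_natCast, ← Real.sqrt_eq_rpow]
  ring

/-- Normalized even Gaussian moments. -/
lemma normalized_even_moment (hμ : 0 < μ) (n : ℕ) :
    Real.sqrt (2 * Real.pi * μ) / (2 * Real.pi) *
      ∫ σ : ℝ, σ ^ (2 * n) * Real.exp (-(μ / 2) * σ ^ 2) =
      2 ^ n * (Real.Gamma (n + 1 / 2) / Real.Gamma (1 / 2)) / μ ^ n := by
  have hpi := Real.pi_pos
  have h1 : Real.sqrt (2 * Real.pi * μ) * Real.sqrt (2 / μ) = 2 * Real.sqrt Real.pi := by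
    rw [← Real.sqrt_mul (by positivity), show 2 * Real.pi * μ * (2 / μ) = 2 ^ 2 * Real.pi by
      field_simp, Real.sqrt_mul (by positivity), Real.sqrt_sq (by norm_num)]
  have h2 : Real.sqrt Real.pi * Real.sqrt Real.pi = Real.pi := Real.mul_self_sqrt hpi.le
  have h3 : Real.sqrt Real.pi ≠ 0 := (Real.sqrt_pos.2 hpi).ne'
  rw [integral_even_pow_mul_gaussian hμ, Real.Gamma_one_half_eq]
  calc _ = (Real.sqrt (2 * Real.pi * μ) * Real.sqrt (2 / μ)) / (2 * Real.pi) *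
        ((2 / μ) ^ n * Real.Gamma (n + 1 / 2)) := by ring
    _ = _ := by
      have h4 : 2 * Real.sqrt Real.pi / (2 * Real.pi) = 1 / Real.sqrt Real.pi := by
        rw [div_eq_div_iff (by positivity) h3]
        linear_combination 2 * h2
      rw [h1, h4, div_pow]
      ring

end Gaussian

/-! ### The uniform asymptotic expansion and its first coefficient -/

section

variable {μ x y : ℝ}

lemma cexp_I_mul_sq (μ σ : ℝ) :
    Complex.exp ((μ : ℂ) * (Complex.I * σ) ^ 2 / 2) = (Real.exp (-(μ / 2) * σ ^ 2) : ℝ) := by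
  rw [mul_pow, Complex.I_sq]
  push_cast
  congr 1; ring

lemma aestronglyMeasurable_gImag (hx : 0 < x) (hy : 0 < y) :
    AEStronglyMeasurable (gImag x y) volume := by
  have h := (continuousOn_gImag hx hy).aestronglyMeasurable (μ := volume)
    (measurableSet_singleton (0 : ℝ)).compl
  rwa [restrict_compl_singleton] at h

/-- At `σ = 0` the quotients in `gImag` may have denominator zero (when `ζ = 0`), so every estimate
of `gImag` is used off this null set. -/
lemma ae_ne_zero : ∀ᵐ σ : ℝ, σ ≠ 0 := by
  have := (measure_eq_zero_iff_ae_notMem (μ := (volume : Measure ℝ))).1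
    (Real.volume_singleton (a := 0))
  simpa using this

lemma integrable_gaussian_mul_gImag (hμ : 0 < μ) (hx : 0 < x) (hy : 0 < y) :
    Integrable fun σ : ℝ => ((Real.exp (-(μ / 2) * σ ^ 2) : ℝ) : ℂ) * gImag x y σ := by
  have hb : Integrable fun σ : ℝ => 405000 * (Real.exp (-(μ / 2) * σ ^ 2) +
      |σ| * Real.exp (-(μ / 2) * σ ^ 2)) := by
    have h0 := integrable_pow_mul_gaussian hμ 0
    have h1 := (integrable_pow_mul_gaussian hμ 1).norm
    simp only [pow_zero, one_mul, pow_one, norm_mul, Real.norm_eq_abs, Real.abs_exp] at h0 h1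
    exact (h0.add h1).const_mul _
  refine hb.mono' ?_ ?_
  · exact (Continuous.aestronglyMeasurable (by fun_prop)).mul (aestronglyMeasurable_gImag hx hy)
  · filter_upwards [ae_ne_zero] with σ hσ
    rw [norm_mul, Complex.norm_real, Real.norm_of_nonneg (Real.exp_pos _).le]
    have := norm_gImag_le hx hy hσ
    calc _ ≤ Real.exp (-(μ / 2) * σ ^ 2) * (405000 * (1 + |σ|)) := by gcongr
      _ = _ := by ring

lemma integrable_remainder (hμ : 0 < μ) (hx : 0 < x) (hy : 0 < y) :
    Integrable (fun σ : ℝ =>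
      Complex.exp ((μ : ℂ) * (Complex.I * σ) ^ 2 / 2) * gImag x y σ * Complex.I) := by
  simp_rw [cexp_I_mul_sq]
  exact (integrable_gaussian_mul_gImag hμ hx hy).mul_const _

lemma remainderIntegral_eq (μ x y : ℝ) :
    remainderIntegral μ x y = (Real.exp (-(μ * zeta x y ^ 2 / 2)) : ℂ) / (2 * Real.pi) *
      ∫ σ : ℝ, ((Real.exp (-(μ / 2) * σ ^ 2) : ℝ) : ℂ) * gImag x y σ := by
  rw [remainderIntegral]
  simp_rw [cexp_I_mul_sq]
  rw [integral_mul_const]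
  have hI := Complex.I_ne_zero
  field_simp

lemma S_eq_re (μ x y : ℝ) :
    S μ x y = ((Real.sqrt (2 * Real.pi * μ) / (2 * Real.pi) : ℝ) *
      ∫ σ : ℝ, ((Real.exp (-(μ / 2) * σ ^ 2) : ℝ) : ℂ) * gImag x y σ).re := by
  rw [S, R, ← Complex.re_ofReal_mul, remainderIntegral_eq]
  congr 1
  push_cast
  rw [show -((μ : ℂ) * zeta x y ^ 2 / 2) = -(μ * zeta x y ^ 2 / 2) by rfl, Complex.exp_neg]
  have := Complex.exp_ne_zero ((μ : ℂ) * zeta x y ^ 2 / 2)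
  have hpi : (Real.pi : ℂ) ≠ 0 := by exact_mod_cast Real.pi_ne_zero
  field_simp

/-- The constant in the uniform bound for the remainder of the Taylor expansion of `g`. -/
def taylorConst (N : ℕ) : ℝ := (405000 + 2 * N * 2000 + 4000) * 1600 ^ (2 * N)

/-- For `|σ| ≤ 1/1600`, a quarter of the radius `1/400`, this is the geometric tail. For larger `σ`
no cancellation is used: since `1600 |σ| ≥ 1`, the linear bound for `g` and all Taylor terms of
lower degree are dominated after multiplication by powers of `1600 |σ|`. -/
lemma norm_gImag_sub_taylor_le (hx : 0 < x) (hy : 0 < y) {G : ℂ → ℂ}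
    (hG : DifferentiableOn ℂ G (Metric.ball 0 (1 / 400)))
    (hM : ∀ s ∈ Metric.ball (0 : ℂ) (1 / 400), ‖G s‖ ≤ 2000)
    (hg : ∀ σ : ℝ, σ ≠ 0 → |σ| < 1 / 400 → gImag x y σ = G (Complex.I * σ))
    (N : ℕ) {σ : ℝ} (hσ : σ ≠ 0) :
    ‖gImag x y σ - ∑ k ∈ Finset.range (2 * N),
      iteratedDeriv k G 0 / (k.factorial : ℂ) * (Complex.I * σ) ^ k‖ ≤
      taylorConst N * (2 * σ ^ (2 * N) + σ ^ (2 * (N + 1))) := by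
  have hn : ‖Complex.I * (σ : ℂ)‖ = |σ| := by simp
  have hev : σ ^ (2 * N) = |σ| ^ (2 * N) := by rw [pow_mul, pow_mul, sq_abs]
  have hev' : σ ^ (2 * (N + 1)) = |σ| ^ (2 * N) * |σ| ^ 2 := by
    rw [mul_add, pow_add, hev, mul_one, sq_abs]
  have hp : 0 ≤ |σ| ^ (2 * N) := by positivity
  -- `1 + |σ| ≤ 2 + σ²` replaces the odd power by even ones, so that only even moments occur.
  have key : |σ| ^ (2 * N) * (1 + |σ|) ≤ 2 * σ ^ (2 * N) + σ ^ (2 * (N + 1)) := by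
    rw [hev, hev']
    nlinarith [mul_nonneg hp (sq_nonneg (|σ| - 1)), mul_nonneg hp (sq_nonneg |σ|)]
  have hc : 0 ≤ taylorConst N := by unfold taylorConst; positivity
  refine le_trans ?_ (mul_le_mul_of_nonneg_left key hc)
  rcases le_or_gt |σ| (1 / 1600) with hs | hs
  · rw [hg σ hσ (by linarith)]
    have h := norm_sub_taylor_le (by norm_num) hG hM (2 * N) (s := Complex.I * σ)
      (by rw [hn]; linarith)
    rw [hn] at h
    refine h.trans ?_
    rw [mul_pow]
    have h2 : (2 / (1 / 400) : ℝ) ^ (2 * N) ≤ 1600 ^ (2 * N) :=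
      pow_le_pow_left₀ (by norm_num) (by norm_num) _
    have hN : (0 : ℝ) ≤ N := N.cast_nonneg
    calc 2 * 2000 * ((2 / (1 / 400) : ℝ) ^ (2 * N) * |σ| ^ (2 * N))
        ≤ 2 * 2000 * (1600 ^ (2 * N) * |σ| ^ (2 * N)) := by gcongr
      _ ≤ (405000 + 2 * N * 2000 + 4000) * (1600 ^ (2 * N) * |σ| ^ (2 * N)) := by
          gcongr; linarith
      _ ≤ (405000 + 2 * N * 2000 + 4000) * (1600 ^ (2 * N) * |σ| ^ (2 * N)) * (1 + |σ|) :=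
          le_mul_of_one_le_right (by positivity) (by linarith [abs_nonneg σ])
      _ = _ := by unfold taylorConst; ring
  · have h1 : 1 ≤ 1600 * |σ| := by linarith
    have hpow : ∀ k ≤ 2 * N, (1600 * |σ|) ^ k ≤ (1600 * |σ|) ^ (2 * N) := fun k hk =>
      pow_le_pow_right₀ h1 hk
    have hT : ‖∑ k ∈ Finset.range (2 * N),
        iteratedDeriv k G 0 / (k.factorial : ℂ) * (Complex.I * σ) ^ k‖ ≤
        2 * N * (2000 * (1600 * |σ|) ^ (2 * N)) := by
      refine (norm_sum_le _ _).trans ?_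
      have : ∀ k ∈ Finset.range (2 * N), ‖iteratedDeriv k G 0 / (k.factorial : ℂ) *
          (Complex.I * σ) ^ k‖ ≤ 2000 * (1600 * |σ|) ^ (2 * N) := by
        intro k hk
        rw [norm_mul, norm_pow, hn]
        have h2 := norm_taylorCoeff_le (by norm_num) hG hM k
        calc _ ≤ 2000 * (2 / (1 / 400)) ^ k * |σ| ^ k := by gcongr
          _ = 2000 * (800 * |σ|) ^ k := by rw [mul_assoc, ← mul_pow]; norm_num
          _ ≤ 2000 * (1600 * |σ|) ^ k := by gcongr; norm_num
          _ ≤ _ := by gcongr ?_ * ?_; exact hpow k (Finset.mem_range.1 hk).le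
      refine (Finset.sum_le_sum this).trans_eq ?_
      simp
    have hg1 : ‖gImag x y σ‖ ≤ 405000 * (1 + |σ|) * (1600 * |σ|) ^ (2 * N) :=
      (norm_gImag_le hx hy hσ).trans (le_mul_of_one_le_right (by positivity) (one_le_pow₀ h1))
    refine (norm_sub_le _ _).trans ((add_le_add hg1 hT).trans ?_)
    rw [mul_pow]
    have hN : (0 : ℝ) ≤ N := N.cast_nonneg
    have hB : 0 ≤ (1600 : ℝ) ^ (2 * N) * |σ| ^ (2 * N) := by positivity
    unfold taylorConst
    have hN' : 0 ≤ (N : ℝ) * |σ| * ((1600 : ℝ) ^ (2 * N) * |σ| ^ (2 * N)) := by positivity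
    nlinarith [mul_nonneg hB (abs_nonneg σ)]

lemma ofReal_d_eq {G : ℂ → ℂ} (hG : DifferentiableOn ℂ G (Metric.ball 0 (1 / 400)))
    (h : ∀ s : ℝ, |s| < 1 / 400 → (gReal x y s : ℂ) = G s) (n : ℕ) :
    (d n x y : ℂ) = (-1) ^ n * (2 ^ n * (Real.Gamma (n + 1 / 2) / Real.Gamma (1 / 2)) : ℝ) *
      (iteratedDeriv (2 * n) G 0 / ((2 * n).factorial : ℂ)) := by
  have := ofReal_iteratedDeriv hG h (2 * n) 0 (by norm_num)
  rw [Complex.ofReal_zero] at this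
  rw [d, ← this]
  push_cast
  ring

lemma sum_range_two_mul_of_odd_zero (f : ℕ → ℂ) (h : ∀ k, Odd k → f k = 0) (N : ℕ) :
    ∑ k ∈ Finset.range (2 * N), f k = ∑ n ∈ Finset.range N, f (2 * n) := by
  induction N with
  | zero => simp
  | succ N ih =>
    rw [Finset.sum_range_succ, mul_add, mul_one, Finset.sum_range_succ, Finset.sum_range_succ, ih,
      h (2 * N + 1) ⟨N, rfl⟩, add_zero]

/-- Odd moments vanish. In the term of degree `2n`, `I^{2n}` supplies the sign `(-1)^n` of `d n` and
the normalized moment supplies `2^n (1/2)_n / μ^n`. -/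
lemma integral_taylor_eq {G : ℂ → ℂ} (hG : DifferentiableOn ℂ G (Metric.ball 0 (1 / 400)))
    (h : ∀ s : ℝ, |s| < 1 / 400 → (gReal x y s : ℂ) = G s) (hμ : 0 < μ) (N : ℕ) :
    ((Real.sqrt (2 * Real.pi * μ) / (2 * Real.pi) : ℝ) : ℂ) *
      ∫ σ : ℝ, ((Real.exp (-(μ / 2) * σ ^ 2) : ℝ) : ℂ) * ∑ k ∈ Finset.range (2 * N),
        iteratedDeriv k G 0 / (k.factorial : ℂ) * (Complex.I * σ) ^ k =
      ((∑ n ∈ Finset.range N, d n x y / μ ^ n : ℝ) : ℂ) := by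
  have hterm : ∀ (k : ℕ) (σ : ℝ), ((Real.exp (-(μ / 2) * σ ^ 2) : ℝ) : ℂ) *
      (iteratedDeriv k G 0 / (k.factorial : ℂ) * (Complex.I * σ) ^ k) =
      (iteratedDeriv k G 0 / (k.factorial : ℂ) * Complex.I ^ k) *
        ((σ ^ k * Real.exp (-(μ / 2) * σ ^ 2) : ℝ) : ℂ) := by
    intro k σ
    rw [mul_pow]; push_cast; ring
  simp_rw [Finset.mul_sum, hterm]
  rw [integral_finsetSum _ fun k _ => ((integrable_pow_mul_gaussian hμ k).ofReal).const_mul _]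
  simp_rw [integral_const_mul, integral_complex_ofReal]
  rw [sum_range_two_mul_of_odd_zero _ (fun k hk => by
    rw [integral_odd_pow_mul_gaussian hk]; simp), Finset.mul_sum]
  push_cast
  refine Finset.sum_congr rfl fun n _ => ?_
  have hm := congrArg (fun r : ℝ => (r : ℂ)) (normalized_even_moment hμ n)
  rw [Complex.ofReal_mul, Complex.ofReal_div _ (μ ^ n)] at hm
  rw [ofReal_d_eq hG h, pow_mul Complex.I, Complex.I_sq]
  calc _ = (iteratedDeriv (2 * n) G 0 / ((2 * n).factorial : ℂ) * (-1) ^ n) *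
        (((Real.sqrt (2 * Real.pi * μ) / (2 * Real.pi) : ℝ) : ℂ) *
          ((∫ σ : ℝ, σ ^ (2 * n) * Real.exp (-(μ / 2) * σ ^ 2) : ℝ) : ℂ)) := by
        push_cast; ring
    _ = _ := by rw [hm]; push_cast; ring

/-- The uniform asymptotic expansion. -/
theorem abs_S_sub_le (N : ℕ) (hμ : 1 ≤ μ) (hx : 0 < x) (hy : 0 < y) :
    |S μ x y - ∑ n ∈ Finset.range N, d n x y / μ ^ n| ≤
      taylorConst N * (2 * (2 ^ N * (Real.Gamma (N + 1 / 2) / Real.Gamma (1 / 2))) +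
        2 ^ (N + 1) * (Real.Gamma ((N + 1 : ℕ) + 1 / 2) / Real.Gamma (1 / 2))) / μ ^ N := by
  have hμ0 : 0 < μ := by linarith
  obtain ⟨G, hG, hM, hgi, hgr, -⟩ := exists_extension_g hx hy
  set c : ℝ := Real.sqrt (2 * Real.pi * μ) / (2 * Real.pi) with hc
  have hc0 : 0 ≤ c := by positivity
  set T : ℝ → ℂ := fun σ => ∑ k ∈ Finset.range (2 * N),
      iteratedDeriv k G 0 / (k.factorial : ℂ) * (Complex.I * σ) ^ k with hT
  have hTi : Integrable fun σ : ℝ => ((Real.exp (-(μ / 2) * σ ^ 2) : ℝ) : ℂ) * T σ := by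
    simp_rw [hT, Finset.mul_sum]
    refine integrable_finsetSum _ fun k _ => ?_
    have hr : Integrable fun σ : ℝ => ((σ ^ k * Real.exp (-(μ / 2) * σ ^ 2) : ℝ) : ℂ) :=
      (integrable_pow_mul_gaussian hμ0 k).ofReal
    refine (hr.const_mul
      (iteratedDeriv k G 0 / (k.factorial : ℂ) * Complex.I ^ k)).congr
      (Filter.Eventually.of_forall fun σ => ?_)
    simp only
    rw [mul_pow, Complex.ofReal_mul, Complex.ofReal_pow]
    ring
  have hdiff : S μ x y - ∑ n ∈ Finset.range N, d n x y / μ ^ n =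
      ((c : ℂ) * ∫ σ : ℝ, ((Real.exp (-(μ / 2) * σ ^ 2) : ℝ) : ℂ) * (gImag x y σ - T σ)).re := by
    simp_rw [mul_sub]
    rw [integral_sub (integrable_gaussian_mul_gImag hμ0 hx hy) hTi, mul_sub, Complex.sub_re,
      ← S_eq_re, hc, integral_taylor_eq hG hgr hμ0 N, Complex.ofReal_re]
  have hI1 := integrable_pow_mul_gaussian hμ0 (2 * N)
  have hI2 := integrable_pow_mul_gaussian hμ0 (2 * (N + 1))
  have hbound : ‖∫ σ : ℝ, ((Real.exp (-(μ / 2) * σ ^ 2) : ℝ) : ℂ) * (gImag x y σ - T σ)‖ ≤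
      ∫ σ : ℝ, taylorConst N * (2 * (σ ^ (2 * N) * Real.exp (-(μ / 2) * σ ^ 2)) +
        σ ^ (2 * (N + 1)) * Real.exp (-(μ / 2) * σ ^ 2)) := by
    refine norm_integral_le_of_norm_le (((hI1.const_mul 2).add hI2).const_mul _) ?_
    filter_upwards [ae_ne_zero] with σ hσ
    rw [norm_mul, Complex.norm_real, Real.norm_of_nonneg (Real.exp_pos _).le]
    have := norm_gImag_sub_taylor_le hx hy hG hM hgi N hσ
    calc _ ≤ Real.exp (-(μ / 2) * σ ^ 2) *
          (taylorConst N * (2 * σ ^ (2 * N) + σ ^ (2 * (N + 1)))) := by gcongr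
      _ = _ := by ring
  rw [integral_const_mul, integral_add (hI1.const_mul 2) hI2, integral_const_mul] at hbound
  have hm1 := normalized_even_moment hμ0 N
  have hm2 := normalized_even_moment hμ0 (N + 1)
  rw [← hc] at hm1 hm2
  rw [hdiff]
  refine (Complex.abs_re_le_norm _).trans ?_
  rw [norm_mul, Complex.norm_real, Real.norm_of_nonneg hc0]
  refine (mul_le_mul_of_nonneg_left hbound hc0).trans ?_
  have hC : 0 ≤ taylorConst N := by unfold taylorConst; positivity
  have hΓ : 0 ≤ 2 ^ (N + 1) * (Real.Gamma ((N + 1 : ℕ) + 1 / 2) / Real.Gamma (1 / 2)) :=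
    mul_nonneg (by positivity) (div_nonneg (Real.Gamma_pos_of_pos (by positivity)).le
      (Real.Gamma_pos_of_pos (by positivity)).le)
  calc _ = taylorConst N * (2 * (2 ^ N * (Real.Gamma (N + 1 / 2) / Real.Gamma (1 / 2)) / μ ^ N) +
        2 ^ (N + 1) * (Real.Gamma ((N + 1 : ℕ) + 1 / 2) / Real.Gamma (1 / 2)) / μ ^ (N + 1)) := by
        rw [← hm1, ← hm2]; ring
    -- Here `μ ≥ 1` absorbs the moment of order `2N + 2`, which is of size `μ^{-(N+1)}`.
    _ ≤ taylorConst N * (2 * (2 ^ N * (Real.Gamma (N + 1 / 2) / Real.Gamma (1 / 2)) / μ ^ N) +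
        2 ^ (N + 1) * (Real.Gamma ((N + 1 : ℕ) + 1 / 2) / Real.Gamma (1 / 2)) / μ ^ N) := by
        gcongr
        omega
    _ = _ := by ring

/-- The first coefficient of the expansion. -/
theorem d_zero_eq (hx : 0 < x) (hy : 0 < y) (hne : y ≠ x + 1) :
    d 0 x y = 1 / zeta x y - (1 + 2 * x + Real.sqrt (1 + 4 * x * y)) /
      (2 * (y - x - 1) * (1 + 4 * x * y) ^ (1 / 4 : ℝ)) := by
  obtain ⟨G, hG, -, -, hgr, h0⟩ := exists_extension_g hx hy
  have hA := one_lt_amp hx hy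
  have hyx : y - x - 1 ≠ 0 := fun h => hne (by linarith)
  have hz : zeta x y ≠ 0 := by
    intro h
    have := sign_zeta hx hy
    rw [h, Real.sign_zero, ← sign_poleCoord hx hy] at this
    exact hyx (Real.sign_eq_zero_iff.1 this.symm)
  have hd : (d 0 x y : ℂ) = G 0 := by
    rw [ofReal_d_eq hG hgr]
    have : Real.Gamma (1 / 2) ≠ 0 := (Real.Gamma_pos_of_pos (by norm_num)).ne'
    simp only [one_div] at this
    simp [this]
  have hd' : d 0 x y = 1 / zeta x y -
      1 / Real.sqrt (amp x y) / (Real.exp (poleCoord x y) - 1) := by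
    have := hd.trans (h0 hz)
    exact_mod_cast this
  have hq : Real.sqrt (amp x y) = (1 + 4 * x * y) ^ (1 / 4 : ℝ) := by
    rw [amp, Real.sqrt_eq_rpow, Real.sqrt_eq_rpow, ← Real.rpow_mul (by positivity)]
    norm_num
  have hq0 : 0 < (1 + 4 * x * y) ^ (1 / 4 : ℝ) := by positivity
  rw [hd', hq, exp_poleCoord hx hy, ← amp]
  congr 1
  -- Since `e^b - 1 = (2y - (1 + A)) / (1 + A)`, this factorization is exactly what exchanges it for
  -- `y - x - 1`.
  have hs := sign_aux hx hy
  have h1 : (0 : ℝ) < 1 + amp x y := by linarith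
  have h2 : (0 : ℝ) < 1 + 2 * x + amp x y := by linarith
  have h3 : 2 * y - (1 + amp x y) ≠ 0 := by
    intro h
    rw [h, mul_zero] at hs
    exact (mul_ne_zero (mul_ne_zero two_ne_zero h1.ne') hyx) hs
  rw [div_sub_one h1.ne']
  generalize (1 + 4 * x * y) ^ (1 / 4 : ℝ) = q at *
  rw [div_div_eq_mul_div, one_div_mul_eq_div, div_right_comm, div_mul_eq_div_div,
    div_left_inj' hq0.ne', div_eq_div_iff h3 (mul_ne_zero two_ne_zero hyx)]
  linarith

end

/-! ### Laplace transform of the density -/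

section Laplace

variable {μ X : ℝ}

/-- The terms of the series of the density. -/
def densityTerm (μ X : ℝ) (k : ℕ) (t : ℝ) : ℝ :=
  Real.exp (-X) * X ^ k / (k.factorial * Real.Gamma (μ + k)) *
    (t ^ (μ + k - 1) * Real.exp (-t))

lemma Gamma_add_pos (hμ : 0 < μ) (k : ℕ) : 0 < Real.Gamma (μ + k) :=
  Real.Gamma_pos_of_pos (by positivity)

lemma densityTerm_nonneg (hμ : 0 < μ) (hX : 0 < X) (k : ℕ) {t : ℝ} (ht : 0 < t) :
    0 ≤ densityTerm μ X k t := by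
  have := Gamma_add_pos hμ k
  unfold densityTerm
  positivity

/-- The fractional powers of `X` cancel, and what remains is a mixture of Gamma densities of shape
`μ + k` with Poisson weights `e^{-X} X^k / k!`. -/
lemma density_eq_tsum (hX : 0 < X) {t : ℝ} (ht : 0 < t) :
    density μ X t = ∑' k, densityTerm μ X k t := by
  rw [density, besselI, ← mul_assoc, ← tsum_mul_left]
  refine tsum_congr fun k => ?_
  have h1 : (2 * Real.sqrt (X * t) / 2) ^ (μ - 1 + 2 * (k : ℝ)) =
      X ^ ((μ - 1) / 2) * t ^ ((μ - 1) / 2) * (X ^ k * t ^ k) := by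
    rw [mul_div_cancel_left₀ _ two_ne_zero, Real.sqrt_eq_rpow, ← Real.rpow_mul (by positivity),
      show 1 / 2 * (μ - 1 + 2 * (k : ℝ)) = (μ - 1) / 2 + k by ring,
      Real.rpow_add (by positivity), Real.rpow_natCast, Real.mul_rpow hX.le ht.le, mul_pow]
  have h2 : X ^ ((1 - μ) / 2) * X ^ ((μ - 1) / 2) = 1 := by
    rw [← Real.rpow_add hX]
    convert Real.rpow_zero X using 2
    ring
  have h3 : t ^ (μ + k - 1) = t ^ ((μ - 1) / 2) * t ^ ((μ - 1) / 2) * t ^ k := by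
    rw [← Real.rpow_add ht, ← Real.rpow_natCast, ← Real.rpow_add ht]
    congr 1; ring
  have h4 : Real.exp (-t - X) = Real.exp (-X) * Real.exp (-t) := by
    rw [← Real.exp_add]; congr 1; ring
  rw [h1, densityTerm, h3, h4, show μ - 1 + (k : ℝ) + 1 = μ + k by ring]
  linear_combination (t ^ ((μ - 1) / 2) * (Real.exp (-X) * Real.exp (-t)) * (t ^ ((μ - 1) / 2) *
    (X ^ k * t ^ k)) / ((k.factorial : ℝ) * Real.Gamma (μ + k))) * h2

lemma density_nonneg (hμ : 0 < μ) (hX : 0 < X) {t : ℝ} (ht : 0 < t) : 0 ≤ density μ X t := by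
  rw [density_eq_tsum hX ht]
  exact tsum_nonneg fun k => densityTerm_nonneg hμ hX k ht

lemma integrableOn_rpow_mul_exp_neg {a p : ℝ} (ha : 0 < a) (hp : 0 < p) :
    IntegrableOn (fun t : ℝ => t ^ (a - 1) * Real.exp (-(p * t))) (Ioi 0) := by
  have h := integrableOn_rpow_mul_exp_neg_mul_rpow (s := a - 1) (p := 1) (b := p)
    (by linarith) one_pos hp
  simpa using h

lemma lintegral_densityTerm (hμ : 0 < μ) (hX : 0 < X) (k : ℕ) {p : ℝ} (hp : 0 < p) :
    ∫⁻ t in Ioi (0 : ℝ), ENNReal.ofReal (densityTerm μ X k t * Real.exp ((1 - p) * t)) =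
      ENNReal.ofReal (Real.exp (-X) * p ^ (-μ) * ((X / p) ^ k / k.factorial)) := by
  have hk : 0 < μ + k := by positivity
  have hΓ := Gamma_add_pos hμ k
  have he : ∀ t : ℝ, densityTerm μ X k t * Real.exp ((1 - p) * t) =
      Real.exp (-X) * X ^ k / (k.factorial * Real.Gamma (μ + k)) *
        (t ^ (μ + k - 1) * Real.exp (-(p * t))) := by
    intro t
    rw [densityTerm, mul_assoc, mul_assoc, ← Real.exp_add]
    congr 3
    ring
  simp_rw [he]
  rw [← ofReal_integral_eq_lintegral_ofReal
    ((integrableOn_rpow_mul_exp_neg hk hp).const_mul _)]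
  · rw [integral_const_mul, Real.integral_rpow_mul_exp_neg_mul_Ioi hk hp]
    congr 1
    rw [one_div, Real.inv_rpow hp.le, Real.rpow_add hp, Real.rpow_natCast, Real.rpow_neg hp.le,
      div_pow]
    field_simp
  · refine (ae_restrict_iff' measurableSet_Ioi).2 (Filter.Eventually.of_forall fun t ht => ?_)
    have ht' : (0 : ℝ) < t := ht
    positivity

lemma measurable_densityTerm (μ X : ℝ) (k : ℕ) : Measurable (densityTerm μ X k) := by
  unfold densityTerm
  fun_prop

lemma tsum_lintegral_densityTerm (hμ : 0 < μ) (hX : 0 < X) {p : ℝ} (hp : 0 < p) :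
    ∫⁻ t in Ioi (0 : ℝ), ∑' k, ENNReal.ofReal (densityTerm μ X k t * Real.exp ((1 - p) * t)) =
      ENNReal.ofReal (Real.exp (-X) * p ^ (-μ) * Real.exp (X / p)) := by
  rw [lintegral_tsum fun k => by
    have := measurable_densityTerm μ X k
    fun_prop]
  simp_rw [lintegral_densityTerm hμ hX _ hp]
  have hs : HasSum (fun k : ℕ => Real.exp (-X) * p ^ (-μ) * ((X / p) ^ k / k.factorial))
      (Real.exp (-X) * p ^ (-μ) * Real.exp (X / p)) := by
    have := NormedSpace.expSeries_div_hasSum_exp (𝔸 := ℝ) (X / p)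
    rw [← Real.exp_eq_exp_ℝ] at this
    exact this.mul_left _
  rw [← hs.tsum_eq, ENNReal.ofReal_tsum_of_nonneg (fun k => by positivity) hs.summable]

/-- A real `tsum` is `0` when it diverges, so summability must be known. It is read off, for almost
every `t`, from the finiteness of the integrated series. -/
lemma ae_ofReal_density (hμ : 0 < μ) (hX : 0 < X) {p : ℝ} (hp : 0 < p) :
    ∀ᵐ t ∂(volume.restrict (Ioi (0 : ℝ))),
      ENNReal.ofReal (density μ X t * Real.exp ((1 - p) * t)) =
        ∑' k, ENNReal.ofReal (densityTerm μ X k t * Real.exp ((1 - p) * t)) := by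
  have hm : Measurable fun t : ℝ =>
      ∑' k, ENNReal.ofReal (densityTerm μ X k t * Real.exp ((1 - p) * t)) := by
    refine Measurable.tsum fun k => ?_
    have := measurable_densityTerm μ X k
    fun_prop
  have hfin := ae_lt_top (μ := volume.restrict (Ioi (0 : ℝ))) hm
    (by rw [tsum_lintegral_densityTerm hμ hX hp]; exact ENNReal.ofReal_ne_top)
  filter_upwards [hfin, ae_restrict_mem measurableSet_Ioi] with t ht ht0
  have hnn : ∀ k, 0 ≤ densityTerm μ X k t * Real.exp ((1 - p) * t) := fun k =>
    mul_nonneg (densityTerm_nonneg hμ hX k ht0) (Real.exp_pos _).le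
  have hsum : Summable fun k => densityTerm μ X k t * Real.exp ((1 - p) * t) := by
    have := ENNReal.summable_toReal ht.ne
    simpa only [ENNReal.toReal_ofReal (hnn _)] using this
  rw [density_eq_tsum hX ht0, ← tsum_mul_right, ENNReal.ofReal_tsum_of_nonneg hnn hsum]

lemma aemeasurable_ofReal_density (hμ : 0 < μ) (hX : 0 < X) {p : ℝ} (hp : 0 < p) :
    AEMeasurable (fun t => ENNReal.ofReal (density μ X t * Real.exp ((1 - p) * t)))
      (volume.restrict (Ioi (0 : ℝ))) := by
  have hm : Measurable fun t : ℝ =>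
      ∑' k, ENNReal.ofReal (densityTerm μ X k t * Real.exp ((1 - p) * t)) := by
    refine Measurable.tsum fun k => ?_
    have := measurable_densityTerm μ X k
    fun_prop
  exact hm.aemeasurable.congr (Filter.EventuallyEq.symm (ae_ofReal_density hμ hX hp))

lemma lintegral_density (hμ : 0 < μ) (hX : 0 < X) {p : ℝ} (hp : 0 < p) :
    ∫⁻ t in Ioi (0 : ℝ), ENNReal.ofReal (density μ X t * Real.exp ((1 - p) * t)) =
      ENNReal.ofReal (Real.exp (-X) * p ^ (-μ) * Real.exp (X / p)) := by
  rw [lintegral_congr_ae (ae_ofReal_density hμ hX hp), tsum_lintegral_densityTerm hμ hX hp]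

lemma ae_density_mul_exp_nonneg (hμ : 0 < μ) (hX : 0 < X) (p : ℝ) :
    ∀ᵐ t ∂(volume.restrict (Ioi (0 : ℝ))), 0 ≤ density μ X t * Real.exp ((1 - p) * t) := by
  filter_upwards [ae_restrict_mem measurableSet_Ioi] with t ht
  exact mul_nonneg (density_nonneg hμ hX ht) (Real.exp_pos _).le

lemma integrableOn_density_mul_exp (hμ : 0 < μ) (hX : 0 < X) {p : ℝ} (hp : 0 < p) :
    IntegrableOn (fun t => density μ X t * Real.exp ((1 - p) * t)) (Ioi 0) := by
  have hnn := ae_density_mul_exp_nonneg hμ hX p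
  refine ⟨?_, ?_⟩
  · refine ((aemeasurable_ofReal_density hμ hX hp).ennreal_toReal.aestronglyMeasurable).congr ?_
    filter_upwards [hnn] with t ht
    exact ENNReal.toReal_ofReal ht
  · rw [hasFiniteIntegral_iff_ofReal hnn, lintegral_density hμ hX hp]
    exact ENNReal.ofReal_lt_top

lemma integral_density_mul_exp (hμ : 0 < μ) (hX : 0 < X) {p : ℝ} (hp : 0 < p) :
    ∫ t in Ioi (0 : ℝ), density μ X t * Real.exp ((1 - p) * t) =
      Real.exp (-X) * p ^ (-μ) * Real.exp (X / p) := by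
  rw [integral_eq_lintegral_of_nonneg_ae (ae_density_mul_exp_nonneg hμ hX p)
    (integrableOn_density_mul_exp hμ hX hp).1, lintegral_density hμ hX hp,
    ENNReal.toReal_ofReal (by positivity)]

lemma integrableOn_density (hμ : 0 < μ) (hX : 0 < X) :
    IntegrableOn (density μ X) (Ioi 0) := by
  simpa using integrableOn_density_mul_exp hμ hX one_pos

lemma integral_density (hμ : 0 < μ) (hX : 0 < X) :
    ∫ t in Ioi (0 : ℝ), density μ X t = 1 := by
  have := integral_density_mul_exp hμ hX one_pos
  simpa [← Real.exp_add] using this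

lemma P_add_Q (hμ : 0 < μ) (hX : 0 < X) {Y : ℝ} (hY : 0 < Y) : P μ X Y + Q μ X Y = 1 := by
  rw [← integral_density hμ hX, P, Q, ← Ioc_union_Ioi_eq_Ioi hY.le]
  have h := integrableOn_density hμ hX
  exact (setIntegral_union (Ioc_disjoint_Ioi le_rfl) measurableSet_Ioi
    (h.mono_set Ioc_subset_Ioi_self) (h.mono_set (Ioi_subset_Ioi hY.le))).symm

/-- The Laplace transform of the density, for complex arguments. -/
lemma integral_density_mul_cexp (hμ : 0 < μ) (hX : 0 < X) {p : ℂ} (hp : 0 < p.re) :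
    ∫ t in Ioi (0 : ℝ), (density μ X t : ℂ) * Complex.exp ((1 - p) * t) =
      Complex.exp (-X) * p ^ (-μ : ℂ) * Complex.exp (X / p) := by
  -- The transform is the complex moment generating function of `ν` at `1 - p`, analytic on `Re z <
  -- 1` because the real exponential moments exist there.
  set ν : Measure ℝ := (volume.restrict (Ioi (0 : ℝ))).withDensity
    (fun t => ENNReal.ofReal (density μ X t)) with hν
  have hmeas : AEMeasurable (fun t => ENNReal.ofReal (density μ X t))
      (volume.restrict (Ioi (0 : ℝ))) := by
    simpa using aemeasurable_ofReal_density hμ hX one_pos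
  have hint : ∀ f : ℝ → ℂ, ∫ t, f t ∂ν = ∫ t in Ioi (0 : ℝ), (density μ X t : ℂ) * f t := by
    intro f
    rw [hν, integral_withDensity_eq_integral_toReal_smul₀ hmeas
      (Filter.Eventually.of_forall fun t => ENNReal.ofReal_lt_top)]
    refine setIntegral_congr_fun measurableSet_Ioi fun t ht => ?_
    simp only [ENNReal.toReal_ofReal (density_nonneg hμ hX ht), Complex.real_smul]
  have hset : Iio 1 ⊆ ProbabilityTheory.integrableExpSet id ν := by
    intro s hs
    have h1 := integrableOn_density_mul_exp hμ hX (p := 1 - s) (by linarith [mem_Iio.1 hs])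
    rw [sub_sub_cancel] at h1
    rw [ProbabilityTheory.integrableExpSet, mem_ofPred_eq, hν,
      integrable_withDensity_iff_integrable_smul₀' hmeas
      (Filter.Eventually.of_forall fun t => ENNReal.ofReal_lt_top)]
    refine (IntegrableOn.congr_fun h1 (fun t ht => ?_) measurableSet_Ioi)
    simp only [ENNReal.toReal_ofReal (density_nonneg hμ hX ht), id, smul_eq_mul]
  have hinter : Iio 1 ⊆ interior (ProbabilityTheory.integrableExpSet id ν) :=
    interior_maximal hset isOpen_Iio
  set U : Set ℂ := {z | z.re < 1} with hU
  have hUo : IsOpen U := isOpen_lt Complex.continuous_re continuous_const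
  have hf : AnalyticOnNhd ℂ (ProbabilityTheory.complexMGF id ν) U :=
    ProbabilityTheory.analyticOnNhd_complexMGF.mono fun z hz => hinter hz
  set g : ℂ → ℂ := fun z => Complex.exp (-X) * (1 - z) ^ (-μ : ℂ) * Complex.exp (X / (1 - z))
    with hg
  have hgan : AnalyticOnNhd ℂ g U := by
    refine DifferentiableOn.analyticOnNhd (fun z hz => ?_) hUo
    have hz' : (1 : ℂ) - z ∈ Complex.slitPlane := by
      have hz1 : z.re < 1 := hz
      left
      simpa using hz1
    have hz0 := Complex.slitPlane_ne_zero hz'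
    refine DifferentiableAt.differentiableWithinAt ?_
    refine DifferentiableAt.mul (DifferentiableAt.mul (by fun_prop) ?_) ?_
    · exact DifferentiableAt.cpow (by fun_prop) (by fun_prop) hz'
    · refine DifferentiableAt.cexp (DifferentiableAt.div (by fun_prop) (by fun_prop) hz0)
  have hreal : ∀ s : ℝ, s < 1 → ProbabilityTheory.complexMGF id ν s = g s := by
    intro s hs
    have h1 := integral_density_mul_exp hμ hX (p := 1 - s) (by linarith)
    rw [sub_sub_cancel] at h1
    rw [ProbabilityTheory.complexMGF, hint, hg]
    have h2 : ∀ t : ℝ, (density μ X t : ℂ) * Complex.exp (s * (id t : ℝ)) =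
        ((density μ X t * Real.exp (s * t) : ℝ) : ℂ) := by intro t; simp
    simp_rw [h2]
    rw [integral_complex_ofReal, h1]
    push_cast
    rw [Complex.ofReal_cpow (by linarith)]
    push_cast
    rfl
  have heq : EqOn (ProbabilityTheory.complexMGF id ν) g U := by
    refine hf.eqOn_of_preconnected_of_frequently_eq hgan
      (convex_halfSpace_re_lt 1).isPreconnected (z₀ := 0) (show (0 : ℂ).re < 1 by simp) ?_
    -- The two analytic functions agree on the real points `-1 / (n + 1)`, which accumulate at `0`;
    -- the identity theorem extends this to the half-plane.
    have htend : Filter.Tendsto (fun n : ℕ => ((-(1 / ((n : ℝ) + 1)) : ℝ) : ℂ)) Filter.atTop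
        (nhdsWithin 0 {0}ᶜ) := by
      refine tendsto_nhdsWithin_iff.2 ⟨?_, Filter.Eventually.of_forall fun n => ?_⟩
      · have := (tendsto_one_div_add_atTop_nhds_zero_nat (𝕜 := ℝ)).neg
        rw [neg_zero] at this
        exact (Complex.continuous_ofReal.tendsto 0).comp this
      · have : (0 : ℝ) < (n : ℝ) + 1 := by positivity
        simp only [mem_compl_iff, mem_singleton_iff]
        exact_mod_cast (neg_lt_zero.2 (one_div_pos.2 this)).ne
    refine htend.frequently (Filter.Frequently.of_forall fun n => hreal _ ?_)
    have : (0 : ℝ) < 1 / ((n : ℝ) + 1) := by positivity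
    linarith
  have := heq (x := 1 - p) (show (1 - p).re < 1 by simpa using hp)
  rw [ProbabilityTheory.complexMGF, hint, hg] at this
  simpa using this

end Laplace

/-! ### Inversion of the Laplace transform for Q and P -/

section Inversion

variable {μ X Y c : ℝ}

lemma continuousAt_P (hμ : 0 < μ) (hX : 0 < X) (hY : 0 < Y) : ContinuousAt (P μ X) Y := by
  have hint : Integrable ((Ioi (0 : ℝ)).indicator (density μ X)) :=
    (integrableOn_density hμ hX).integrable_indicator measurableSet_Ioi
  refine ((hint.continuous_primitive 0).continuousAt (x := Y)).congr ?_
  filter_upwards [lt_mem_nhds hY] with Z hZ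
  rw [intervalIntegral.integral_of_le hZ.le, P]
  exact setIntegral_congr_fun measurableSet_Ioc fun t ht => indicator_of_mem (mem_Ioi.2 ht.1) _

lemma continuousAt_Q (hμ : 0 < μ) (hX : 0 < X) (hY : 0 < Y) : ContinuousAt (Q μ X) Y := by
  have h : ContinuousAt (fun Z => 1 - P μ X Z) Y :=
    continuousAt_const.sub (continuousAt_P hμ hX hY)
  refine h.congr ?_
  filter_upwards [lt_mem_nhds hY] with Z hZ
  linarith [P_add_Q hμ hX hZ]

/-- The integrand of the Laplace inversion integral of the Marcum functions. -/
def laplaceIntegrand (μ X Y : ℝ) (p : ℂ) : ℂ :=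
  Complex.exp (p * Y - Y - X + X / p) * p ^ (-μ : ℂ) / (1 - p)

/-- Brings `|c + iv|` and `|1 - c - iv|` into the form `1 + |v|`, so that the integrand decays like
`(1 + |v|)^{-(1 + μ)}`, integrable for every `μ > 0`. -/
lemma norm_add_mul_I_ge (a v : ℝ) :
    |a| / (1 + |a|) * (1 + |v|) ≤ ‖(a : ℂ) + v * Complex.I‖ := by
  have h1 : |a| ≤ ‖(a : ℂ) + v * Complex.I‖ := by
    simpa using Complex.abs_re_le_norm ((a : ℂ) + v * Complex.I)
  have h2 : |v| ≤ ‖(a : ℂ) + v * Complex.I‖ := by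
    simpa using Complex.abs_im_le_norm ((a : ℂ) + v * Complex.I)
  rw [div_mul_eq_mul_div, div_le_iff₀ (by positivity)]
  nlinarith [abs_nonneg a, mul_le_mul_of_nonneg_left h2 (abs_nonneg a)]

lemma add_mul_I_mem_slitPlane (hc : 0 < c) (v : ℝ) : (c : ℂ) + v * Complex.I ∈ Complex.slitPlane :=
  Or.inl (by simpa using hc)

lemma one_sub_add_mul_I_ne_zero (hc1 : c ≠ 1) (v : ℝ) : 1 - ((c : ℂ) + v * Complex.I) ≠ 0 := by
  intro h
  have := congrArg Complex.re h
  simp at this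
  exact hc1 (by linarith)

lemma continuous_laplaceIntegrand (hc : 0 < c) (hc1 : c ≠ 1) :
    Continuous fun v : ℝ => laplaceIntegrand μ X Y (c + v * Complex.I) := by
  unfold laplaceIntegrand
  have hp : Continuous fun v : ℝ => (c : ℂ) + v * Complex.I := by fun_prop
  refine Continuous.div (Continuous.mul (Complex.continuous_exp.comp
    ((by fun_prop : Continuous fun v : ℝ => ((c : ℂ) + v * Complex.I) * Y - Y - X).add
      (continuous_const.div hp fun v => ?_))) ?_) (by fun_prop)
    fun v => one_sub_add_mul_I_ne_zero hc1 v
  · exact Complex.slitPlane_ne_zero (add_mul_I_mem_slitPlane hc v)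
  · exact hp.cpow continuous_const fun v => add_mul_I_mem_slitPlane hc v

lemma integrable_laplaceIntegrand (hμ : 0 < μ) (hX : 0 < X) (hc : 0 < c) (hc1 : c ≠ 1) :
    Integrable fun v : ℝ => laplaceIntegrand μ X Y (c + v * Complex.I) := by
  set κ : ℝ := |c| / (1 + |c|) with hκ
  set κ' : ℝ := |1 - c| / (1 + |1 - c|) with hκ'
  have hκ0 : 0 < κ := div_pos (abs_pos.2 hc.ne') (by positivity)
  have hκ0' : 0 < κ' := div_pos (abs_pos.2 (sub_ne_zero.2 hc1.symm)) (by positivity)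
  have hint : Integrable fun v : ℝ => Real.exp (c * Y - Y - X + X / c) * κ ^ (-μ) * κ'⁻¹ *
      (1 + ‖v‖) ^ (-(1 + μ)) :=
    (integrable_one_add_norm (by simpa using hμ)).const_mul _
  refine hint.mono' (continuous_laplaceIntegrand hc hc1).aestronglyMeasurable
    (Filter.Eventually.of_forall fun v => ?_)
  have hp := norm_add_mul_I_ge c v
  have hq : κ' * (1 + |v|) ≤ ‖1 - ((c : ℂ) + v * Complex.I)‖ := by
    have := norm_add_mul_I_ge (1 - c) (-v)
    rw [abs_neg] at this
    convert this using 2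
    push_cast
    ring
  have hv : 0 < 1 + |v| := by positivity
  have h1 : ‖Complex.exp (((c : ℂ) + v * Complex.I) * Y - Y - X + X / (c + v * Complex.I))‖ ≤
      Real.exp (c * Y - Y - X + X / c) := by
    rw [Complex.norm_exp, Real.exp_le_exp]
    have : ((X : ℂ) / (c + v * Complex.I)).re ≤ X / c := by
      refine (Complex.re_le_norm _).trans ?_
      rw [norm_div, Complex.norm_real, Real.norm_of_nonneg hX.le]
      refine div_le_div_of_nonneg_left hX.le hc ?_
      have := Complex.re_le_norm ((c : ℂ) + v * Complex.I)
      simpa using this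
    simpa using this
  have h2 : ‖((c : ℂ) + v * Complex.I) ^ (-μ : ℂ)‖ ≤ κ ^ (-μ) * (1 + |v|) ^ (-μ) := by
    rw [← Complex.ofReal_neg, Complex.norm_cpow_real, ← Real.mul_rpow hκ0.le hv.le]
    exact Real.rpow_le_rpow_of_nonpos (by positivity) hp (by linarith)
  have h3 : ‖(1 - ((c : ℂ) + v * Complex.I))‖⁻¹ ≤ κ'⁻¹ * (1 + |v|)⁻¹ := by
    rw [← mul_inv]
    exact inv_anti₀ (by positivity) hq
  rw [laplaceIntegrand, norm_div, norm_mul, div_eq_mul_inv, Real.norm_eq_abs]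
  calc _ ≤ Real.exp (c * Y - Y - X + X / c) * (κ ^ (-μ) * (1 + |v|) ^ (-μ)) *
        (κ'⁻¹ * (1 + |v|)⁻¹) := by gcongr
    _ = _ := by
      rw [show -(1 + μ) = -μ + -1 by ring, Real.rpow_add hv, Real.rpow_neg_one]
      ring

/-- The exponentially tilted density. -/
def tiltedDensity (μ X c : ℝ) : ℝ → ℂ :=
  (Ioi (0 : ℝ)).indicator fun t => (density μ X t : ℂ) * Complex.exp ((1 - c) * t)

lemma integrable_tiltedDensity (hμ : 0 < μ) (hX : 0 < X) (hc : 0 < c) :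
    Integrable (tiltedDensity μ X c) := by
  refine IntegrableOn.integrable_indicator ?_ measurableSet_Ioi
  have := (integrableOn_density_mul_exp hμ hX hc).ofReal (𝕜 := ℂ)
  refine this.congr (Filter.Eventually.of_forall fun t => ?_)
  simp

lemma fourier_tiltedDensity (hμ : 0 < μ) (hX : 0 < X) (hc : 0 < c) (w : ℝ) :
    FourierTransform.fourier (tiltedDensity μ X c) w =
      Complex.exp (-X) * ((c : ℂ) + (2 * Real.pi * w : ℝ) * Complex.I) ^ (-μ : ℂ) *
        Complex.exp (X / ((c : ℂ) + (2 * Real.pi * w : ℝ) * Complex.I)) := by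
  rw [← integral_density_mul_cexp hμ hX (by simpa using hc),
    Real.fourier_real_eq_integral_exp_smul, ← integral_indicator measurableSet_Ioi]
  refine integral_congr_ae (Filter.Eventually.of_forall fun t => ?_)
  simp only [tiltedDensity, indicator]
  split_ifs
  · rw [smul_eq_mul, mul_left_comm, ← Complex.exp_add]
    congr 2
    push_cast
    ring
  · simp

/-- The kernel `K` divides the transform of the tilted density by `1 - p`, which also gives the
decay needed for Fourier inversion. Pointwise inversion at `Y` then needs only continuity there. The
choice of `K` decides which tail `F` is recovered. -/
lemma laplace_inversion (hμ : 0 < μ) (hX : 0 < X) (hc : 0 < c) (hc1 : c ≠ 1) {K : ℝ → ℂ}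
    (hK : Integrable K)
    (hFK : ∀ w : ℝ, FourierTransform.fourier K w =
      1 / (1 - ((c : ℂ) + (2 * Real.pi * w : ℝ) * Complex.I)))
    {F : ℝ → ℝ} (hF : ContinuousAt F Y)
    (hH : convolution (tiltedDensity μ X c) K (ContinuousLinearMap.mul ℂ ℂ) volume =ᶠ[nhds Y]
      fun Z => Complex.exp ((1 - c) * Z) * F Z) :
    (F Y : ℂ) = 1 / (2 * Real.pi) *
      ∫ v : ℝ, laplaceIntegrand μ X Y (c + v * Complex.I) := by
  set H := convolution (tiltedDensity μ X c) K (ContinuousLinearMap.mul ℂ ℂ) volume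
  have hD := integrable_tiltedDensity hμ hX hc
  have hHint : Integrable H := hD.integrable_convolution _ hK
  have hFH : ∀ w : ℝ, FourierTransform.fourier H w =
      Complex.exp ((1 - (c + (2 * Real.pi * w : ℝ) * Complex.I)) * Y) *
        laplaceIntegrand μ X Y (c + (2 * Real.pi * w : ℝ) * Complex.I) := by
    intro w
    rw [Real.fourier_mul_convolution_eq hD hK, fourier_tiltedDensity hμ hX hc, hFK,
      laplaceIntegrand]
    set p : ℂ := (c : ℂ) + (2 * Real.pi * w : ℝ) * Complex.I
    have h1 : Complex.exp (-X) * Complex.exp (X / p) =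
        Complex.exp ((1 - p) * Y) * Complex.exp (p * Y - Y - X + X / p) := by
      rw [← Complex.exp_add, ← Complex.exp_add]
      congr 1
      ring
    linear_combination (p ^ (-μ : ℂ) / (1 - p)) * h1
  have hscale : Integrable fun w : ℝ =>
      laplaceIntegrand μ X Y (c + (2 * Real.pi * w : ℝ) * Complex.I) :=
    (integrable_laplaceIntegrand hμ hX hc hc1).comp_mul_left' (by positivity)
  have hFHint : Integrable (FourierTransform.fourier H) := by
    rw [show FourierTransform.fourier H = _ from funext hFH]
    refine hscale.bdd_mul (c := Real.exp ((1 - c) * Y)) (Continuous.aestronglyMeasurable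
      (by fun_prop)) (Filter.Eventually.of_forall fun w => ?_)
    rw [Complex.norm_exp]
    simp
  have hcont : ContinuousAt H Y := by
    refine ContinuousAt.congr ?_ hH.symm
    exact ContinuousAt.mul (by fun_prop) (Complex.continuous_ofReal.continuousAt.comp hF)
  have hinv := hHint.fourierInv_fourier_eq hFHint hcont
  rw [hH.self_of_nhds, Real.fourierInv_eq'] at hinv
  have hmain : ∫ w : ℝ, laplaceIntegrand μ X Y (c + (2 * Real.pi * w : ℝ) * Complex.I) = F Y := by
    have h1 : (F Y : ℂ) = Complex.exp (-((1 - c) * Y)) * (Complex.exp ((1 - c) * Y) * F Y) := by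
      rw [← mul_assoc, ← Complex.exp_add]; simp
    beta_reduce at hinv
    rw [h1, ← hinv, ← integral_const_mul]
    refine integral_congr_ae (Filter.Eventually.of_forall fun w => ?_)
    simp only [hFH, smul_eq_mul, ← mul_assoc, ← Complex.exp_add]
    conv_lhs => rw [← one_mul (laplaceIntegrand _ _ _ _), ← Complex.exp_zero]
    congr 2
    simp
    ring
  rw [← hmain]
  have := Measure.integral_comp_mul_left
    (fun v : ℝ => laplaceIntegrand μ X Y (c + v * Complex.I)) (2 * Real.pi)
  rw [this, abs_of_pos (by positivity)]
  simp

/-- For `c < 1` the integrable kernel is the exponential on the negative half-line, whose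
convolution collects the density over `t ≥ Z`. -/
lemma Q_eq_laplace (hμ : 0 < μ) (hX : 0 < X) (hY : 0 < Y) (hc : 0 < c) (hc1 : c < 1) :
    (Q μ X Y : ℂ) = 1 / (2 * Real.pi) *
      ∫ v : ℝ, laplaceIntegrand μ X Y (c + v * Complex.I) := by
  have hre : ∀ w : ℝ, 0 < (1 - ((c : ℂ) + (2 * Real.pi * w : ℝ) * Complex.I)).re := by
    intro w
    simpa using hc1
  refine laplace_inversion hμ hX hc hc1.ne
    (K := (Iic (0 : ℝ)).indicator fun z => Complex.exp ((1 - c) * z)) ?_ ?_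
    (continuousAt_Q hμ hX hY) ?_
  · refine IntegrableOn.integrable_indicator ?_ measurableSet_Iic
    exact integrableOn_exp_mul_complex_Iic (by simpa using hc1) 0
  · intro w
    have h := integral_exp_mul_complex_Iic (hre w) 0
    simp only [Complex.ofReal_zero, mul_zero, Complex.exp_zero] at h
    rw [← h, Real.fourier_real_eq_integral_exp_smul, ← integral_indicator measurableSet_Iic]
    refine integral_congr_ae (Filter.Eventually.of_forall fun t => ?_)
    simp only [indicator]
    split_ifs
    · rw [smul_eq_mul, ← Complex.exp_add]
      congr 1
      push_cast
      ring
    · simp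
  · filter_upwards [lt_mem_nhds hY] with Z hZ
    rw [Q, ← integral_complex_ofReal, ← integral_const_mul, ← integral_Ici_eq_integral_Ioi,
      ← integral_indicator measurableSet_Ici, convolution]
    refine integral_congr_ae (Filter.Eventually.of_forall fun t => ?_)
    simp only [tiltedDensity, indicator, ContinuousLinearMap.mul_apply', mem_Ioi, mem_Iic, mem_Ici,
      sub_nonpos]
    by_cases h1 : Z ≤ t
    · rw [if_pos (hZ.trans_le h1), if_pos h1, if_pos h1, mul_assoc, ← Complex.exp_add, mul_comm]
      congr 2
      push_cast
      ring
    · simp [h1]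

/-- For `c > 1` the integrable kernel with the same transform `1 / (1 - p)` is minus the exponential
on the positive half-line; hence `-P`, the missing `1` being the residue at `p = 1`. -/
lemma P_eq_laplace (hμ : 0 < μ) (hX : 0 < X) (hY : 0 < Y) (hc1 : 1 < c) :
    (-P μ X Y : ℂ) = 1 / (2 * Real.pi) *
      ∫ v : ℝ, laplaceIntegrand μ X Y (c + v * Complex.I) := by
  have hre : ∀ w : ℝ, (1 - ((c : ℂ) + (2 * Real.pi * w : ℝ) * Complex.I)).re < 0 := by
    intro w
    simpa using hc1
  rw [← Complex.ofReal_neg]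
  refine laplace_inversion hμ hX (one_pos.trans hc1) hc1.ne'
    (K := (Ioi (0 : ℝ)).indicator fun z => -Complex.exp ((1 - c) * z))
    (F := fun Z => -P μ X Z) ?_ ?_ (continuousAt_P hμ hX hY).neg ?_
  · refine IntegrableOn.integrable_indicator ?_ measurableSet_Ioi
    exact (integrableOn_exp_mul_complex_Ioi (by simpa using hc1) 0).neg
  · intro w
    have h := integral_exp_mul_complex_Ioi (hre w) 0
    simp only [Complex.ofReal_zero, mul_zero, Complex.exp_zero] at h
    rw [← neg_neg (1 / _), ← neg_div, ← h, Real.fourier_real_eq_integral_exp_smul,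
      ← integral_indicator measurableSet_Ioi, ← integral_neg]
    refine integral_congr_ae (Filter.Eventually.of_forall fun t => ?_)
    simp only [indicator]
    split_ifs
    · rw [smul_eq_mul, mul_neg, ← Complex.exp_add]
      congr 2
      push_cast
      ring
    · simp
  · filter_upwards [lt_mem_nhds hY] with Z hZ
    rw [P, integral_Ioc_eq_integral_Ioo, Complex.ofReal_neg, ← integral_complex_ofReal, mul_neg,
      ← integral_const_mul, ← integral_indicator measurableSet_Ioo, convolution, ← integral_neg]
    refine integral_congr_ae (Filter.Eventually.of_forall fun t => ?_)
    simp only [tiltedDensity, indicator, ContinuousLinearMap.mul_apply', mem_Ioi, mem_Ioo, sub_pos]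
    by_cases h0 : 0 < t
    · by_cases h1 : t < Z
      · rw [if_pos h0, if_pos h1, if_pos ⟨h0, h1⟩, mul_neg, mul_assoc, ← Complex.exp_add, mul_comm]
        congr 3
        push_cast
        ring
      · simp [h1]
    · simp [h0]

end Inversion

/-! ### The contour integral in the variable t = ρ p -/

section Contour

variable {μ x y c : ℝ}

lemma phi_rho_mul (hx : 0 < x) (hy : 0 < y) {p : ℂ} (hp : p ≠ 0) :
    phi x y (rho x y * p) = y * p + x / p - Real.log (rho x y) - Complex.log p := by
  have hρ := rho_pos hx hy
  have h1 : (xi x y : ℂ) * rho x y = 2 * y := by exact_mod_cast xi_mul_rho hx hy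
  have h2 : (xi x y : ℂ) / rho x y = 2 * x := by exact_mod_cast xi_div_rho hx hy
  have hρ' : (rho x y : ℂ) ≠ 0 := by exact_mod_cast hρ.ne'
  rw [phi, Complex.log_ofReal_mul hρ hp]
  have h3 : (xi x y : ℂ) / 2 * (rho x y * p + 1 / (rho x y * p)) =
      (xi x y * rho x y) / 2 * p + (xi x y / rho x y) / 2 / p := by
    field_simp
  rw [h3, h1, h2]
  ring

/-- Since `ξ ρ = 2y` and `ξ / ρ = 2x`, one has `φ(ρ p) = y p + x / p - log ρ - log p`; the last term
yields `p^{-μ}` and the pole moves to `p = 1`. -/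
lemma contourIntegrand_rho_mul (hx : 0 < x) (hy : 0 < y) (hc : 0 < c) (v : ℝ) :
    contourIntegrand μ x y (rho x y * c) (rho x y * v) =
      Complex.exp (μ * phi x y (rho x y)) * Complex.I / rho x y *
        laplaceIntegrand μ (μ * x) (μ * y) (c + v * Complex.I) := by
  have hp := Complex.slitPlane_ne_zero (add_mul_I_mem_slitPlane hc v)
  have hρ' : (rho x y : ℂ) ≠ 0 := by exact_mod_cast (rho_pos hx hy).ne'
  set p : ℂ := (c : ℂ) + v * Complex.I with hpdef
  have h1 : (((rho x y * c : ℝ) : ℂ) + Complex.I * ((rho x y * v : ℝ) : ℂ)) = rho x y * p := by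
    rw [hpdef]; push_cast; ring
  have h2 := phi_rho_mul hx hy (one_ne_zero (α := ℂ))
  rw [mul_one] at h2
  rw [contourIntegrand, h1, phi_rho_mul hx hy hp, h2, laplaceIntegrand, Complex.cpow_def_of_ne_zero
    hp, ← Complex.exp_add, show (rho x y : ℂ) - rho x y * p = rho x y * (1 - p) by ring]
  have h3 : Complex.exp (μ * (y * p + x / p - Real.log (rho x y) - Complex.log p)) =
      Complex.exp (μ * (y * 1 + x / 1 - Real.log (rho x y) - Complex.log 1)) *
      Complex.exp (p * ((μ * y : ℝ) : ℂ) - ((μ * y : ℝ) : ℂ) - ((μ * x : ℝ) : ℂ) +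
        ((μ * x : ℝ) : ℂ) / p + Complex.log p * -μ) := by
    rw [← Complex.exp_add]
    congr 1
    rw [Complex.log_one]
    push_cast
    ring
  rw [h3, div_mul_eq_div_div]
  ring

lemma integrable_contourIntegrand (hμ : 0 < μ) (hx : 0 < x) (hy : 0 < y) (hc : 0 < c)
    (hcρ : c ≠ rho x y) : Integrable fun v : ℝ => contourIntegrand μ x y c v := by
  have hρ := rho_pos hx hy
  have hc1 : c / rho x y ≠ 1 := fun h => hcρ ((div_eq_one_iff_eq hρ.ne').1 h)
  have h := (integrable_laplaceIntegrand (Y := μ * y) hμ (mul_pos hμ hx) (div_pos hc hρ) hc1).const_mul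
    (Complex.exp (μ * phi x y (rho x y)) * Complex.I / rho x y)
  simp_rw [← contourIntegrand_rho_mul hx hy (div_pos hc hρ), mul_div_cancel₀ c hρ.ne'] at h
  exact (integrable_comp_mul_left_iff (fun v : ℝ => contourIntegrand μ x y c v) hρ.ne').1 h

lemma integral_contourIntegrand (hx : 0 < x) (hy : 0 < y) (hc : 0 < c) :
    Complex.exp (-(μ : ℂ) * phi x y (rho x y : ℂ)) / (2 * Real.pi * Complex.I) *
      ∫ v : ℝ, contourIntegrand μ x y c v = 1 / (2 * Real.pi) *
      ∫ v : ℝ, laplaceIntegrand μ (μ * x) (μ * y) ((c / rho x y : ℝ) + v * Complex.I) := by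
  have hρ := rho_pos hx hy
  have h := Measure.integral_comp_mul_left (fun v : ℝ => contourIntegrand μ x y c v) (rho x y)
  have h2 := fun v => contourIntegrand_rho_mul (μ := μ) hx hy (div_pos hc hρ) v
  simp_rw [mul_div_cancel₀ c hρ.ne'] at h2
  simp_rw [h2] at h
  rw [integral_const_mul, abs_of_pos (inv_pos.2 hρ), Complex.real_smul] at h
  have hρ' : (rho x y : ℂ) ≠ 0 := by exact_mod_cast hρ.ne'
  have h3 : ∫ v : ℝ, contourIntegrand μ x y c v = Complex.exp (μ * phi x y (rho x y)) * Complex.I *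
      ∫ v : ℝ, laplaceIntegrand μ (μ * x) (μ * y) ((c / rho x y : ℝ) + v * Complex.I) := by
    rw [Complex.ofReal_inv, inv_mul_eq_div, eq_div_iff hρ'] at h
    rw [← h]
    field_simp
  rw [h3, neg_mul, Complex.exp_neg]
  field_simp [Complex.exp_ne_zero]

theorem Q_eq_contour (hμ : 0 < μ) (hx : 0 < x) (hy : 0 < y) (hc : 0 < c) (hcρ : c < rho x y) :
    (Q μ (μ * x) (μ * y) : ℂ) = Complex.exp (-(μ : ℂ) * phi x y (rho x y : ℂ)) /
      (2 * Real.pi * Complex.I) * ∫ v : ℝ, contourIntegrand μ x y c v := by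
  have hρ := rho_pos hx hy
  rw [integral_contourIntegrand hx hy hc]
  exact Q_eq_laplace hμ (by positivity) (by positivity) (div_pos hc hρ) ((div_lt_one hρ).2 hcρ)

theorem neg_P_eq_contour (hμ : 0 < μ) (hx : 0 < x) (hy : 0 < y) (hcρ : rho x y < c) :
    (-P μ (μ * x) (μ * y) : ℂ) = Complex.exp (-(μ : ℂ) * phi x y (rho x y : ℂ)) /
      (2 * Real.pi * Complex.I) * ∫ v : ℝ, contourIntegrand μ x y c v := by
  have hρ := rho_pos hx hy
  rw [integral_contourIntegrand hx hy (hρ.trans hcρ)]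
  exact P_eq_laplace hμ (by positivity) (by positivity) ((one_lt_div hρ).2 hcρ)

end Contour

/-! ### Primitives near compact sets in the closed upper half-plane -/

section Primitive

/-- The disc about `a + iM` of radius `√(M² + η²)` is `‖t - a‖² < 2M Im t + η²`. Its part with `Im t
≤ 0` stays within `η` of `a`, so `h` is holomorphic on it, and as `M` grows these discs exhaust the
upper half-plane. One of them contains `K`, and on a disc a primitive exists. -/
lemma exists_primitive {h : ℂ → ℂ} {a η : ℝ} (hη : 0 < η)
    (hd : ∀ t : ℂ, 0 < t.im ∨ ‖t - a‖ < η → DifferentiableAt ℂ h t) {K : Set ℂ}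
    (hK : IsCompact K) (hKs : ∀ t ∈ K, t = a ∨ 0 < t.im) :
    ∃ F : ℂ → ℂ, ∀ t ∈ K, HasDerivAt F (h t) t := by
  have hK0 : ∀ t ∈ K, 0 ≤ t.im := by
    intro t ht
    rcases hKs t ht with rfl | h0
    · simp
    · exact h0.le
  obtain ⟨M, hM⟩ := hK.elim_directed_cover
    -- The truncation `max t.im 0` makes the family monotone in `M`; on `K` it is the disc condition
    -- itself.
    (fun M : ℕ => {t : ℂ | ‖t - a‖ ^ 2 < 2 * M * max t.im 0 + η ^ 2})
    (fun M => isOpen_lt (by fun_prop)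
      (((continuous_const.mul (Complex.continuous_im.max continuous_const))).add continuous_const))
    (fun t ht => by
      rw [mem_iUnion]
      rcases hKs t ht with rfl | h0
      · exact ⟨0, show ‖_‖ ^ 2 < _ by simpa using pow_pos hη 2⟩
      · obtain ⟨M, hM⟩ := exists_nat_gt (‖t - a‖ ^ 2 / (2 * t.im))
        refine ⟨M, show ‖_‖ ^ 2 < _ from ?_⟩
        rw [div_lt_iff₀ (by positivity)] at hM
        rw [max_eq_left h0.le]
        nlinarith [pow_pos hη 2])
    (Monotone.directed_le fun M N (hMN : M ≤ N) t ht => show ‖t - a‖ ^ 2 < _ from by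
      have ht' : ‖t - a‖ ^ 2 < 2 * M * max t.im 0 + η ^ 2 := ht
      have : (M : ℝ) * max t.im 0 ≤ N * max t.im 0 :=
        mul_le_mul_of_nonneg_right (by exact_mod_cast hMN) (le_max_right _ _)
      linarith)
  set r : ℝ := Real.sqrt ((M : ℝ) ^ 2 + η ^ 2) with hr
  have hmem : ∀ t : ℂ, t ∈ Metric.ball ((a : ℂ) + M * Complex.I) r ↔
      ‖t - a‖ ^ 2 < 2 * M * t.im + η ^ 2 := by
    intro t
    have h1 : ‖t - (a + M * Complex.I)‖ ^ 2 = ‖t - a‖ ^ 2 - 2 * M * t.im + (M : ℝ) ^ 2 := by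
      rw [Complex.sq_norm, Complex.sq_norm, Complex.normSq_apply, Complex.normSq_apply]
      simp
      ring
    rw [mem_ball_iff_norm, hr, Real.lt_sqrt (norm_nonneg _), h1]
    constructor <;> intro h <;> linarith
  have hdiff : DifferentiableOn ℂ h (Metric.ball ((a : ℂ) + M * Complex.I) r) := by
    intro t ht
    refine (hd t ?_).differentiableWithinAt
    rcases lt_or_ge 0 t.im with h0 | h0
    · exact Or.inl h0
    · right
      rw [hmem] at ht
      refine lt_of_pow_lt_pow_left₀ 2 hη.le (ht.trans_le ?_)
      nlinarith [M.cast_nonneg (α := ℝ)]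
  obtain ⟨F, hF⟩ := hdiff.isExactOn_ball
  refine ⟨F, fun t ht => hF t ?_⟩
  rw [hmem]
  have h1 : ‖t - a‖ ^ 2 < 2 * M * max t.im 0 + η ^ 2 := hM ht
  rwa [max_eq_left (hK0 t ht)] at h1

lemma integral_eq_primitive_sub {h F : ℂ → ℂ} {γ γ' : ℝ → ℂ} {a b : ℝ} (hab : a ≤ b)
    (hγ : ContinuousOn γ (Icc a b)) (hF : ∀ s ∈ Icc a b, HasDerivAt F (h (γ s)) (γ s))
    (hγ' : ∀ s ∈ Ioo a b, HasDerivAt γ (γ' s) s)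
    (hint : IntervalIntegrable (fun s => h (γ s) * γ' s) volume a b) :
    ∫ s in a..b, h (γ s) * γ' s = F (γ b) - F (γ a) := by
  refine intervalIntegral.integral_eq_sub_of_hasDerivAt_of_le (f := fun s => F (γ s)) hab
    (fun s hs => ?_) (fun s hs => ?_) hint
  · exact (hF s hs).continuousAt.comp_continuousWithinAt (hγ s hs)
  · exact (hF s (Ioo_subset_Icc_self hs)).comp s (hγ' s hs)

/-- Reduces the deformation to the upper half-plane, away from the cut of the logarithm and from the
pole on the real axis. -/
lemma integral_eq_sub_conj {f : ℝ → ℂ} (hf : Integrable f)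
    (h : ∀ s, f (-s) = -(starRingEnd ℂ) (f s)) :
    ∫ s, f s = (∫ s in Ioi 0, f s) - (starRingEnd ℂ) (∫ s in Ioi 0, f s) := by
  rw [← intervalIntegral.integral_Iic_add_Ioi (b := 0) hf.integrableOn hf.integrableOn]
  have h1 := integral_comp_neg_Ioi (0 : ℝ) f
  rw [neg_zero] at h1
  simp_rw [← h1, h]
  rw [integral_neg, integral_conj]
  ring

end Primitive

/-! ### The integrand on the path of steepest descent, and its symmetry -/

section Deformation

variable {μ x y : ℝ}

/-- The integrand of the contour integral, as a function of the complex variable. -/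
def kernel (μ x y : ℝ) (t : ℂ) : ℂ := Complex.exp (μ * phi x y t) / (rho x y - t)

/-- The integrand along the path of steepest descent. -/
def pathIntegrand (μ x y σ : ℝ) : ℂ := kernel μ x y (tImag x y σ) * deriv (tImag x y) σ

lemma contourIntegrand_eq (μ x y c v : ℝ) :
    contourIntegrand μ x y c v = kernel μ x y (c + Complex.I * v) * Complex.I := rfl

lemma differentiableAt_kernel {t : ℂ} (ht : t ∈ Complex.slitPlane) (hρ : t ≠ rho x y) :
    DifferentiableAt ℂ (kernel μ x y) t := by
  have h0 := Complex.slitPlane_ne_zero ht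
  unfold kernel phi
  have h1 : DifferentiableAt ℂ Complex.log t := Complex.differentiableAt_log ht
  have h2 : DifferentiableAt ℂ (fun t : ℂ => 1 / t) t :=
    (differentiableAt_const _).div differentiableAt_id h0
  refine DifferentiableAt.div ?_ (by fun_prop) (sub_ne_zero.2 hρ.symm)
  exact (((differentiableAt_const _).mul
    (((differentiableAt_const _).mul (differentiableAt_id.add h2)).sub h1))).cexp

lemma poleCoord_ne_zero (hx : 0 < x) (hy : 0 < y) (hne : saddle x y ≠ rho x y) :
    poleCoord x y ≠ 0 := by
  intro h
  have := rho_eq hx hy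
  rw [h, Real.exp_zero, mul_one] at this
  exact hne this.symm

lemma zeta_ne_zero (hx : 0 < x) (hy : 0 < y) (hne : saddle x y ≠ rho x y) : zeta x y ≠ 0 := by
  have hA := (one_lt_amp hx hy).le
  rw [zeta_eq hx hy]
  rcases lt_or_gt_of_ne (poleCoord_ne_zero hx hy hne) with h | h
  · exact (sReal_neg hA h).ne
  · exact (sReal_pos hA h).ne'

lemma pathIntegrand_eq (hx : 0 < x) (hy : 0 < y) {σ : ℝ} (hσ : σ ≠ 0) :
    pathIntegrand μ x y σ = Complex.exp (μ * phi x y (saddle x y)) * Complex.I *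
      (((Real.exp (-(μ / 2) * σ ^ 2) : ℝ) : ℂ) * (1 / (zeta x y - Complex.I * σ)) -
        ((Real.exp (-(μ / 2) * σ ^ 2) : ℝ) : ℂ) * gImag x y σ) := by
  have h1 : Complex.exp (μ * phi x y (tImag x y σ)) =
      Complex.exp (μ * phi x y (saddle x y)) * ((Real.exp (-(μ / 2) * σ ^ 2) : ℝ) : ℂ) := by
    rw [phi_tImag hx hy, Complex.ofReal_exp, ← Complex.exp_add]
    congr 1
    push_cast
    ring
  have h2 := gImag_eq_sub (x := x) (y := y) hσ
  rw [pathIntegrand, kernel, h1, h2]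
  field_simp
  ring

/-- The bound `|z - iσ| ≥ |z|` is where the case `ρ = t₀`, that is `ζ = 0`, has to be set aside. -/
lemma integrable_gaussian_div (hμ : 0 < μ) {z : ℝ} (hz : z ≠ 0) :
    Integrable fun σ : ℝ =>
      ((Real.exp (-(μ / 2) * σ ^ 2) : ℝ) : ℂ) * (1 / (z - Complex.I * σ)) := by
  have h0 : Integrable fun σ : ℝ => ((Real.exp (-(μ / 2) * σ ^ 2) : ℝ) : ℂ) :=
    (integrable_exp_neg_mul_sq (half_pos hμ)).ofReal
  have hne : ∀ σ : ℝ, (z : ℂ) - Complex.I * σ ≠ 0 := by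
    intro σ h
    have := congrArg Complex.re h
    simp at this
    exact hz this
  refine h0.mul_bdd (c := |z|⁻¹)
    (Continuous.div continuous_const (by fun_prop) hne).aestronglyMeasurable
    (Filter.Eventually.of_forall fun σ => ?_)
  rw [one_div, norm_inv]
  refine inv_anti₀ (abs_pos.2 hz) ?_
  have := Complex.abs_re_le_norm ((z : ℂ) - Complex.I * σ)
  simpa using this

lemma integrable_pathIntegrand (hμ : 0 < μ) (hx : 0 < x) (hy : 0 < y)
    (hne : saddle x y ≠ rho x y) : Integrable (pathIntegrand μ x y) := by
  refine (((integrable_gaussian_div hμ (zeta_ne_zero hx hy hne)).sub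
    (integrable_gaussian_mul_gImag hμ hx hy)).const_mul
    (Complex.exp (μ * phi x y (saddle x y)) * Complex.I)).congr ?_
  filter_upwards [ae_ne_zero] with σ hσ
  rw [pathIntegrand_eq hx hy hσ]
  rfl

lemma continuous_tImag (hx : 0 < x) (hy : 0 < y) : Continuous (tImag x y) := by
  have h := continuous_pathFun hx hy
  rw [show tImag x y = _ from funext (tImag_eq hx hy)]
  fun_prop

lemma tImag_zero (hx : 0 < x) (hy : 0 < y) : tImag x y 0 = saddle x y := by
  rw [tImag_eq hx hy, pathFun_zero hx hy, Complex.exp_zero, mul_one]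

lemma tImag_polar (x y σ : ℝ) : tImag x y σ =
    pathRadius x y (pathArg x y σ) * Complex.exp ((pathArg x y σ : ℂ) * Complex.I) := rfl

lemma tImag_im_pos (hx : 0 < x) (hy : 0 < y) {σ : ℝ} (hσ : 0 < σ) : 0 < (tImag x y σ).im := by
  rw [tImag_polar, Complex.im_ofReal_mul, Complex.exp_ofReal_mul_I_im]
  exact mul_pos (pathRadius_pos _ _ _)
    (Real.sin_pos_of_pos_of_lt_pi (pathArg_pos hx hy hσ) (pathArg_mem hx hy σ).2)

lemma tImag_neg (hx : 0 < x) (hy : 0 < y) (σ : ℝ) :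
    tImag x y (-σ) = (starRingEnd ℂ) (tImag x y σ) := by
  rw [tImag_polar, tImag_polar, pathArg_neg hx hy, map_mul, Complex.conj_ofReal,
    ← Complex.exp_conj, map_mul, Complex.conj_I, Complex.conj_ofReal, ← exp_pathLog,
    pathLog_neg, exp_pathLog]
  push_cast
  ring_nf

lemma phi_conj {t : ℂ} (ht : t ∈ Complex.slitPlane) :
    phi x y ((starRingEnd ℂ) t) = (starRingEnd ℂ) (phi x y t) := by
  rw [phi, phi, Complex.log_conj _ (Complex.slitPlane_arg_ne_pi ht)]
  simp [map_ofNat]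

lemma kernel_conj {t : ℂ} (ht : t ∈ Complex.slitPlane) :
    kernel μ x y ((starRingEnd ℂ) t) = (starRingEnd ℂ) (kernel μ x y t) := by
  rw [kernel, kernel, phi_conj ht, map_div₀, ← Complex.exp_conj]
  simp

lemma tImag_mem_slitPlane (hx : 0 < x) (hy : 0 < y) (σ : ℝ) :
    tImag x y σ ∈ Complex.slitPlane := by
  rw [Complex.mem_slitPlane_iff_arg]
  refine ⟨?_, tImag_ne_zero hx hy σ⟩
  have h := pathArg_mem hx hy σ
  rw [tImag_polar, Complex.exp_mul_I,
    Complex.arg_mul_cos_add_sin_mul_I (pathRadius_pos _ _ _) ⟨h.1, h.2.le⟩]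
  exact h.2.ne

lemma pathIntegrand_neg (hx : 0 < x) (hy : 0 < y) (σ : ℝ) :
    pathIntegrand μ x y (-σ) = -(starRingEnd ℂ) (pathIntegrand μ x y σ) := by
  have h1 : deriv (tImag x y) (-σ) = -(starRingEnd ℂ) (deriv (tImag x y) σ) := by
    have h2 := deriv_comp_neg (f := tImag x y) σ
    have h3 : (fun σ => tImag x y (-σ)) = fun σ => star (tImag x y σ) :=
      funext fun σ => tImag_neg hx hy σ
    rw [h3, deriv.star] at h2
    rw [← neg_neg (deriv (tImag x y) (-σ)), ← h2]
    rfl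
  rw [pathIntegrand, pathIntegrand, h1, tImag_neg hx hy, kernel_conj (tImag_mem_slitPlane hx hy σ),
    map_mul]
  ring

lemma contourIntegrand_neg {c : ℝ} (hc : 0 < c) (v : ℝ) :
    contourIntegrand μ x y c (-v) = -(starRingEnd ℂ) (contourIntegrand μ x y c v) := by
  have h1 : (c : ℂ) + Complex.I * v ∈ Complex.slitPlane := Or.inl (by simpa using hc)
  have h2 : (c : ℂ) + Complex.I * (-v : ℝ) = (starRingEnd ℂ) ((c : ℂ) + Complex.I * v) := by
    simp
  rw [contourIntegrand_eq, contourIntegrand_eq, h2, kernel_conj h1, map_mul, Complex.conj_I]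
  ring

end Deformation

/-! ### Closing the contour by a large arc -/

section Deformation

variable {μ x y : ℝ}

lemma differentiableAt_kernel_of_im {t : ℂ}
    (ht : 0 < t.im ∨ ‖t - saddle x y‖ < min (saddle x y) |rho x y - saddle x y|) :
    DifferentiableAt ℂ (kernel μ x y) t := by
  rcases ht with ht | ht
  · refine differentiableAt_kernel (Or.inr ht.ne') ?_
    rintro rfl
    simp at ht
  · refine differentiableAt_kernel (Or.inl ?_) ?_
    · have h1 := (Complex.abs_re_le_norm (t - saddle x y)).trans_lt (ht.trans_le (min_le_left _ _))
      rw [Complex.sub_re, Complex.ofReal_re] at h1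
      linarith [(abs_lt.1 h1).1]
    · rintro rfl
      have h1 := ht.trans_le (min_le_right _ _)
      rw [← Complex.ofReal_sub, Complex.norm_real, Real.norm_eq_abs] at h1
      exact lt_irrefl _ h1

/-- A single primitive serves the path up to `t(iτ)`, the vertical segment up to modulus `R`, and
the arc of radius `R` joining their ends. The line `Re t = t₀` meets the circle at argument `arccos
(t₀ / R)`. -/
lemma deformation_finite (hμ : 0 < μ) (hx : 0 < x) (hy : 0 < y) (hne : saddle x y ≠ rho x y)
    {τ R : ℝ} (hτ : 0 < τ) (hR : ‖tImag x y τ‖ = R) (hR0 : saddle x y < R)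
    (hθ : Real.pi / 2 ≤ pathArg x y τ) :
    (∫ σ in (0 : ℝ)..τ, pathIntegrand μ x y σ) -
      ∫ v in (0 : ℝ)..(Real.sqrt (R ^ 2 - saddle x y ^ 2)), contourIntegrand μ x y (saddle x y) v =
      ∫ α in (Real.arccos (saddle x y / R))..(pathArg x y τ),
        kernel μ x y (R * Complex.exp (α * Complex.I)) *
          (R * Complex.exp (α * Complex.I) * Complex.I) := by
  have ht0 := saddle_pos hx hy
  have hRpos : 0 < R := ht0.trans hR0
  set t₀ := saddle x y with ht₀
  set V := Real.sqrt (R ^ 2 - t₀ ^ 2) with hV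
  set α₀ := Real.arccos (t₀ / R) with hα₀
  set θ := pathArg x y τ with hθdef
  have hV0 : 0 ≤ V := Real.sqrt_nonneg _
  have hα₀pos : 0 < α₀ := Real.arccos_pos.2 ((div_lt_one hRpos).2 hR0)
  have hα₀le : α₀ ≤ θ := (Real.arccos_le_pi_div_two.2 (by positivity)).trans hθ
  have hθpi : θ < Real.pi := (pathArg_mem hx hy τ).2
  have hend : (R : ℂ) * Complex.exp (θ * Complex.I) = tImag x y τ := by
    rw [tImag_polar, ← hR, tImag_polar, norm_mul, Complex.norm_exp_ofReal_mul_I, mul_one,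
      Complex.norm_real, Real.norm_of_nonneg (pathRadius_pos _ _ _).le]
  have hstart : (R : ℂ) * Complex.exp (α₀ * Complex.I) = t₀ + Complex.I * V := by
    have h1 : R * Real.cos α₀ = t₀ := by
      rw [Real.cos_arccos (by linarith [div_pos ht0 hRpos]) ((div_lt_one hRpos).2 hR0).le]
      field_simp
    have h2 : R * Real.sin α₀ = V := by
      rw [Real.sin_arccos, hV, ← Real.sqrt_sq hRpos.le, ← Real.sqrt_mul (by positivity),
        Real.sqrt_sq hRpos.le]
      congr 1
      field_simp
    rw [Complex.exp_mul_I, ← Complex.ofReal_cos, ← Complex.ofReal_sin, ← h1, ← h2]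
    push_cast
    ring
  have hγc : Continuous fun v : ℝ => (t₀ : ℂ) + Complex.I * v := by fun_prop
  have hac : Continuous fun α : ℝ => (R : ℂ) * Complex.exp (α * Complex.I) := by fun_prop
  have himarc : ∀ α ∈ Icc α₀ θ, 0 < ((R : ℂ) * Complex.exp (α * Complex.I)).im := by
    intro α hα
    rw [Complex.im_ofReal_mul, Complex.exp_ofReal_mul_I_im]
    exact mul_pos hRpos (Real.sin_pos_of_pos_of_lt_pi (hα₀pos.trans_le hα.1)
      (hα.2.trans_lt hθpi))
  have hη : 0 < min t₀ |rho x y - t₀| := lt_min ht0 (abs_pos.2 (sub_ne_zero.2 hne.symm))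
  obtain ⟨F, hF⟩ := exists_primitive (h := kernel μ x y) (a := t₀) hη
    (fun t ht => differentiableAt_kernel_of_im ht)
    (K := (tImag x y '' Icc 0 τ ∪ (fun v : ℝ => (t₀ : ℂ) + Complex.I * v) '' Icc 0 V) ∪
      (fun α : ℝ => (R : ℂ) * Complex.exp (α * Complex.I)) '' Icc α₀ θ)
    (((isCompact_Icc.image (continuous_tImag hx hy)).union (isCompact_Icc.image hγc)).union
      (isCompact_Icc.image hac)) (by
      rintro t ((⟨σ, hσ, rfl⟩ | ⟨v, hv, rfl⟩) | ⟨α, hα, rfl⟩)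
      · rcases hσ.1.eq_or_lt with h0 | h0
        · left; rw [← h0, tImag_zero hx hy]
        · exact Or.inr (tImag_im_pos hx hy h0)
      · rcases hv.1.eq_or_lt with h0 | h0
        · left; simp [← h0]
        · right; simpa using h0
      · exact Or.inr (himarc α hα))
  have hFpath : ∀ σ ∈ Icc 0 τ, HasDerivAt F (kernel μ x y (tImag x y σ)) (tImag x y σ) :=
    fun σ hσ => hF _ (Or.inl (Or.inl (mem_image_of_mem _ hσ)))
  have hFline : ∀ v ∈ Icc 0 V, HasDerivAt F (kernel μ x y ((t₀ : ℂ) + Complex.I * v))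
      ((t₀ : ℂ) + Complex.I * v) :=
    fun v hv => hF _ (Or.inl (Or.inr ⟨v, hv, rfl⟩))
  have hFarc : ∀ α ∈ Icc α₀ θ, HasDerivAt F (kernel μ x y ((R : ℂ) * Complex.exp (α * Complex.I)))
      ((R : ℂ) * Complex.exp (α * Complex.I)) :=
    fun α hα => hF _ (Or.inr ⟨α, hα, rfl⟩)
  have e1 : ∫ σ in (0 : ℝ)..τ, pathIntegrand μ x y σ = F (tImag x y τ) - F (tImag x y 0) := by
    refine integral_eq_primitive_sub hτ.le (continuous_tImag hx hy).continuousOn hFpath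
      (fun σ hσ => ?_) (integrable_pathIntegrand hμ hx hy hne).intervalIntegrable
    exact (hasDerivAt_tImag hx hy hσ.1.ne').differentiableAt.hasDerivAt
  have e2 : ∫ v in (0 : ℝ)..V, contourIntegrand μ x y t₀ v =
      F ((t₀ : ℂ) + Complex.I * V) - F ((t₀ : ℂ) + Complex.I * (0 : ℝ)) := by
    refine integral_eq_primitive_sub (γ' := fun _ => Complex.I) hV0 hγc.continuousOn hFline
      (fun v hv => ?_) (integrable_contourIntegrand hμ hx hy ht0 hne).intervalIntegrable
    simpa using (((hasDerivAt_id v).ofReal_comp).const_mul Complex.I).const_add (t₀ : ℂ)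
  have e3 : ∫ α in α₀..θ, kernel μ x y (R * Complex.exp (α * Complex.I)) *
      (R * Complex.exp (α * Complex.I) * Complex.I) =
      F (R * Complex.exp (θ * Complex.I)) - F (R * Complex.exp (α₀ * Complex.I)) := by
    refine integral_eq_primitive_sub
      (γ' := fun α : ℝ => R * Complex.exp (α * Complex.I) * Complex.I) hα₀le hac.continuousOn
      hFarc (fun α hα => ?_) ?_
    · have h1 : HasDerivAt (fun α : ℝ => (α : ℂ) * Complex.I) Complex.I α := by
        simpa using ((hasDerivAt_id α).ofReal_comp).mul_const Complex.I
      have := h1.cexp.const_mul (R : ℂ)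
      rwa [← mul_assoc] at this
    · refine ContinuousOn.intervalIntegrable (ContinuousOn.mul (fun α hα => ?_)
        (by fun_prop))
      rw [uIcc_of_le hα₀le] at hα ⊢
      exact ContinuousAt.comp_continuousWithinAt (f := fun α : ℝ => (R : ℂ) *
        Complex.exp (α * Complex.I)) (g := kernel μ x y)
        (differentiableAt_kernel_of_im (Or.inl (himarc α hα))).continuousAt
        hac.continuousWithinAt
  rw [e1, e2, e3, hend, hstart, tImag_zero hx hy, Complex.ofReal_zero, mul_zero, add_zero]
  ring

/-- On the arc `R cos α ≤ t₀`, and `(R + 1/R) / 2 ≤ R`, so `Re φ ≤ ξ t₀ - log R`. The factor `R`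
from `dt` is cancelled by `‖ρ - t‖ ≥ R/2`, leaving `R^{-μ}`. -/
lemma norm_arc_le (hμ : 0 < μ) (hx : 0 < x) (hy : 0 < y) {R θ : ℝ} (hR0 : saddle x y < R)
    (hR1 : 1 ≤ R) (hR2 : 2 * rho x y ≤ R) (h1 : Real.arccos (saddle x y / R) ≤ θ)
    (h2 : θ < Real.pi) :
    ‖∫ α in (Real.arccos (saddle x y / R))..θ, kernel μ x y (R * Complex.exp (α * Complex.I)) *
      (R * Complex.exp (α * Complex.I) * Complex.I)‖ ≤
      2 * Real.exp (μ * (xi x y * saddle x y)) * Real.pi * R ^ (-μ) := by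
  have ht0 := saddle_pos hx hy
  have hRpos : 0 < R := ht0.trans hR0
  have hxi := xi_pos hx hy
  have hα₀ := Real.arccos_nonneg (saddle x y / R)
  have hbound : ∀ α ∈ uIoc (Real.arccos (saddle x y / R)) θ,
      ‖kernel μ x y (R * Complex.exp (α * Complex.I)) *
        (R * Complex.exp (α * Complex.I) * Complex.I)‖ ≤
        2 * Real.exp (μ * (xi x y * saddle x y)) * R ^ (-μ) := by
    intro α hα
    rw [uIoc_of_le h1] at hα
    have hexp : (R : ℂ) * Complex.exp (α * Complex.I) =
        Complex.exp (Real.log R + α * Complex.I) := by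
      rw [Complex.exp_add, ← Complex.ofReal_exp, Real.exp_log hRpos]
    have hphi : (phi x y (R * Complex.exp (α * Complex.I))).re ≤
        xi x y * saddle x y - Real.log R := by
      rw [hexp, phi_exp x y (by simp; linarith [hα.1, Real.pi_pos])
        (by simp; linarith [hα.2]), Complex.sub_re, Complex.re_ofReal_mul, cosh_add_mul_I_re,
        Real.cosh_log hRpos]
      have hcos : Real.cos α ≤ saddle x y / R := by
        have := Real.cos_le_cos_of_nonneg_of_le_pi hα₀ (hα.2.trans h2.le) hα.1.le
        rwa [Real.cos_arccos (by linarith [div_pos ht0 hRpos])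
          ((div_lt_one hRpos).2 hR0).le] at this
      have hinv : R⁻¹ ≤ R := (inv_le_one_of_one_le₀ hR1).trans hR1
      have hinv0 : 0 < R⁻¹ := inv_pos.2 hRpos
      have h3 : (R + R⁻¹) / 2 * Real.cos α ≤ saddle x y := by
        calc (R + R⁻¹) / 2 * Real.cos α ≤ (R + R⁻¹) / 2 * (saddle x y / R) := by gcongr
          _ ≤ R * (saddle x y / R) := by gcongr; linarith
          _ = saddle x y := by field_simp
      have h4 := mul_le_mul_of_nonneg_left h3 hxi.le
      simpa using h4
    have hnum : ‖Complex.exp (μ * phi x y (R * Complex.exp (α * Complex.I)))‖ ≤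
        Real.exp (μ * (xi x y * saddle x y)) * R ^ (-μ) := by
      rw [Complex.norm_exp, Complex.re_ofReal_mul, Real.rpow_def_of_pos hRpos, ← Real.exp_add,
        Real.exp_le_exp]
      nlinarith [mul_le_mul_of_nonneg_left hphi hμ.le]
    have hnorm : ‖(R : ℂ) * Complex.exp (α * Complex.I)‖ = R := by
      rw [norm_mul, Complex.norm_exp_ofReal_mul_I, mul_one, Complex.norm_real,
        Real.norm_of_nonneg hRpos.le]
    have hden : R / 2 ≤ ‖(rho x y : ℂ) - R * Complex.exp (α * Complex.I)‖ := by
      have h5 := norm_sub_norm_le ((R : ℂ) * Complex.exp (α * Complex.I)) (rho x y)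
      rw [hnorm, Complex.norm_real, Real.norm_of_nonneg (rho_pos hx hy).le, norm_sub_rev] at h5
      linarith
    rw [norm_mul, norm_mul, hnorm, Complex.norm_I, mul_one, kernel, norm_div]
    calc _ ≤ Real.exp (μ * (xi x y * saddle x y)) * R ^ (-μ) / (R / 2) * R := by gcongr
      _ = _ := by field_simp
  refine (intervalIntegral.norm_integral_le_of_norm_le_const hbound).trans ?_
  rw [abs_of_nonneg (by linarith)]
  have hC : 0 ≤ 2 * Real.exp (μ * (xi x y * saddle x y)) * R ^ (-μ) := by positivity
  calc _ ≤ 2 * Real.exp (μ * (xi x y * saddle x y)) * R ^ (-μ) * Real.pi := by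
        gcongr; linarith
    _ = _ := by ring

lemma tendsto_norm_tImag (hx : 0 < x) (hy : 0 < y) :
    Filter.Tendsto (fun σ => ‖tImag x y σ‖) Filter.atTop Filter.atTop := by
  have h := (Real.tendsto_exp_atTop.comp (tendsto_pathLog_pi hx hy)).comp (tendsto_pathArg hx hy)
  refine h.congr fun σ => ?_
  rw [tImag_polar, norm_mul, Complex.norm_exp_ofReal_mul_I, mul_one,
    Complex.norm_real, Real.norm_of_nonneg (pathRadius_pos _ _ _).le, ← exp_pathLog]
  rfl

lemma integral_Ioi_deformation (hμ : 0 < μ) (hx : 0 < x) (hy : 0 < y)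
    (hne : saddle x y ≠ rho x y) :
    ∫ σ in Ioi (0 : ℝ), pathIntegrand μ x y σ =
      ∫ v in Ioi (0 : ℝ), contourIntegrand μ x y (saddle x y) v := by
  have ht0 := saddle_pos hx hy
  have hR := tendsto_norm_tImag hx hy
  have hV : Filter.Tendsto (fun σ => Real.sqrt (‖tImag x y σ‖ ^ 2 - saddle x y ^ 2))
      Filter.atTop Filter.atTop := by
    refine Filter.tendsto_atTop_mono' _ ?_
      (Filter.tendsto_atTop_add_const_right _ (-saddle x y) hR)
    filter_upwards [hR.eventually_ge_atTop (saddle x y)] with σ hσ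
    refine Real.le_sqrt_of_sq_le ?_
    nlinarith
  have h1 := intervalIntegral_tendsto_integral_Ioi 0
    (integrable_pathIntegrand hμ hx hy hne).integrableOn Filter.tendsto_id
  have h2 := intervalIntegral_tendsto_integral_Ioi 0
    (integrable_contourIntegrand hμ hx hy ht0 hne).integrableOn hV
  rw [← sub_eq_zero]
  refine tendsto_nhds_unique (h1.sub h2) ?_
  have h3 : Filter.Tendsto (fun σ => 2 * Real.exp (μ * (xi x y * saddle x y)) * Real.pi *
      ‖tImag x y σ‖ ^ (-μ)) Filter.atTop (nhds 0) := by
    have := ((tendsto_rpow_neg_atTop hμ).comp hR).const_mul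
      (2 * Real.exp (μ * (xi x y * saddle x y)) * Real.pi)
    rwa [mul_zero] at this
  refine squeeze_zero_norm' ?_ h3
  have hθ := (tendsto_nhdsWithin_iff.1 (tendsto_pathArg hx hy)).1.eventually_const_le
    (show Real.pi / 2 < Real.pi by linarith [Real.pi_pos])
  filter_upwards [hR.eventually_gt_atTop (saddle x y), hR.eventually_ge_atTop 1,
    hR.eventually_ge_atTop (2 * rho x y), hθ, Filter.eventually_gt_atTop 0] with σ g1 g2 g3 g4 g5
  rw [id, deformation_finite hμ hx hy hne g5 rfl g1 g4]
  refine norm_arc_le hμ hx hy g1 g2 g3 ?_ (pathArg_mem hx hy σ).2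
  exact (Real.arccos_le_pi_div_two.2 (by positivity)).trans g4

theorem integral_deformation (hμ : 0 < μ) (hx : 0 < x) (hy : 0 < y)
    (hne : saddle x y ≠ rho x y) :
    ∫ σ : ℝ, pathIntegrand μ x y σ = ∫ v : ℝ, contourIntegrand μ x y (saddle x y) v := by
  rw [integral_eq_sub_conj (integrable_pathIntegrand hμ hx hy hne) (pathIntegrand_neg hx hy),
    integral_eq_sub_conj (integrable_contourIntegrand hμ hx hy (saddle_pos hx hy) hne)
      (contourIntegrand_neg (saddle_pos hx hy)), integral_Ioi_deformation hμ hx hy hne]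

end Deformation

/-! ### The complementary error function as a Gaussian integral with a pole -/

section Erfc

lemma integrable_exp_neg_sq : Integrable fun t : ℝ => Real.exp (-t ^ 2) := by
  simpa using integrable_exp_neg_mul_sq (b := 1) one_pos

lemma erfc_add_erfc_neg (z : ℝ) : erfc z + erfc (-z) = 2 := by
  have h1 : ∫ t in Ioi (-z), Real.exp (-t ^ 2) = ∫ t in Iic z, Real.exp (-t ^ 2) := by
    rw [← neg_neg z, ← integral_comp_neg_Ioi, neg_neg]
    simp
  have h2 := intervalIntegral.integral_Iic_add_Ioi (b := z) integrable_exp_neg_sq.integrableOn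
    integrable_exp_neg_sq.integrableOn
  have h3 : ∫ t : ℝ, Real.exp (-t ^ 2) = Real.sqrt Real.pi := by
    simpa using integral_gaussian 1
  have hpi : Real.sqrt Real.pi ≠ 0 := (Real.sqrt_pos.2 Real.pi_pos).ne'
  rw [erfc, erfc, h1, ← mul_add, add_comm, h2, h3]
  field_simp

lemma continuous_erfc : Continuous erfc := by
  have h : erfc = fun z => 2 / Real.sqrt Real.pi *
      ((∫ t in Ioi 0, Real.exp (-t ^ 2)) - ∫ t in (0 : ℝ)..z, Real.exp (-t ^ 2)) := by
    funext z
    rw [erfc, ← intervalIntegral.integral_Ioi_sub_Ioi' integrable_exp_neg_sq.integrableOn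
      integrable_exp_neg_sq.integrableOn, sub_sub_cancel]
  rw [h]
  exact continuous_const.mul (continuous_const.sub (integrable_exp_neg_sq.continuous_primitive 0))

lemma integral_Ioi_add_right (f : ℝ → ℝ) (a : ℝ) :
    ∫ t in Ioi 0, f (t + a) = ∫ t in Ioi a, f t := by
  rw [← integral_indicator measurableSet_Ioi, ← integral_indicator measurableSet_Ioi,
    ← integral_add_right_eq_self ((Ioi a).indicator f) a]
  refine integral_congr_ae (Filter.Eventually.of_forall fun t => ?_)
  simp [indicator]

lemma integral_exp_neg_sq_affine {q : ℝ} (hq : 0 < q) (w : ℝ) :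
    ∫ r in Ioi (0 : ℝ), Real.exp (-(r / (2 * q) + w) ^ 2) =
      2 * q * ∫ t in Ioi w, Real.exp (-t ^ 2) := by
  have h := integral_comp_mul_left_Ioi (fun s => Real.exp (-(s + w) ^ 2)) 0
    (inv_pos.2 (show 0 < 2 * q by positivity))
  simp_rw [div_eq_inv_mul]
  rw [h, inv_inv, mul_zero, smul_eq_mul,
    integral_Ioi_add_right (fun t => Real.exp (-t ^ 2)) w]

lemma one_div_sub_I_mul {z : ℝ} (hz : 0 < z) (σ : ℝ) :
    1 / ((z : ℂ) - Complex.I * σ) =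
      ∫ r in Ioi (0 : ℝ), Complex.exp (-(z - Complex.I * σ) * r) := by
  rw [integral_exp_mul_complex_Ioi (by simpa using hz), Complex.ofReal_zero, mul_zero,
    Complex.exp_zero, neg_div_neg_eq]

lemma integral_gaussian_mul_cexp {q : ℝ} (hq : 0 < q) (r : ℝ) :
    ∫ σ : ℝ, ((Real.exp (-q ^ 2 * σ ^ 2) : ℝ) : ℂ) * Complex.exp (Complex.I * σ * r) =
      ((Real.sqrt Real.pi / q * Real.exp (-(r / (2 * q)) ^ 2) : ℝ) : ℂ) := by
  have hq2 : 0 < ((q : ℂ) ^ 2).re := by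
    rw [← Complex.ofReal_pow, Complex.ofReal_re]
    positivity
  have h := fourierIntegral_gaussian hq2 (r : ℂ)
  have e1 : ((Real.pi : ℂ) / (q : ℂ) ^ 2) ^ (1 / 2 : ℂ) = ((Real.sqrt Real.pi / q : ℝ) : ℂ) := by
    have : Real.sqrt Real.pi / q = (Real.pi / q ^ 2) ^ (1 / 2 : ℝ) := by
      rw [← Real.sqrt_eq_rpow, Real.sqrt_div Real.pi_pos.le, Real.sqrt_sq hq.le]
    rw [this, Complex.ofReal_cpow (by positivity)]
    push_cast
    rfl
  rw [e1] at h
  rw [Complex.ofReal_mul]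
  convert h using 1
  · refine integral_congr_ae (Filter.Eventually.of_forall fun σ => ?_)
    simp only
    rw [mul_comm]
    push_cast
    congr 2
    ring
  · push_cast
    congr 2
    field_simp
    ring

/-- Write `1 / (z - iσ)` as `∫ e^{-(z - iσ) r} dr` over `r > 0`, exchange the integrals, use the
Fourier transform of the Gaussian and complete the square in `r`. -/
lemma integral_gaussian_div_of_pos {q z : ℝ} (hq : 0 < q) (hz : 0 < z) :
    ∫ σ : ℝ, ((Real.exp (-q ^ 2 * σ ^ 2) : ℝ) : ℂ) * (1 / ((z : ℂ) - Complex.I * σ)) =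
      ((Real.pi * Real.exp (z ^ 2 * q ^ 2) * erfc (z * q) : ℝ) : ℂ) := by
  have hswap : Integrable (Function.uncurry fun (σ r : ℝ) =>
      ((Real.exp (-q ^ 2 * σ ^ 2) : ℝ) : ℂ) * Complex.exp (-(z - Complex.I * σ) * r))
      (volume.prod (volume.restrict (Ioi 0))) := by
    have h1 : Integrable fun σ : ℝ => ((Real.exp (-q ^ 2 * σ ^ 2) : ℝ) : ℂ) :=
      (integrable_exp_neg_mul_sq (pow_pos hq 2)).ofReal
    have h2 : Integrable (fun r : ℝ => ((Real.exp (-z * r) : ℝ) : ℂ))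
        (volume.restrict (Ioi 0)) := (exp_neg_integrableOn_Ioi 0 hz).ofReal
    refine ((h1.mul_prod h2).mul_bdd (c := 1)
      (g := fun p : ℝ × ℝ => Complex.exp (((p.1 * p.2 : ℝ) : ℂ) * Complex.I))
      (Continuous.aestronglyMeasurable (by fun_prop))
      (Filter.Eventually.of_forall fun p => (Complex.norm_exp_ofReal_mul_I _).le)).congr
      (Filter.Eventually.of_forall fun p => ?_)
    simp only [Function.uncurry]
    rw [mul_assoc, Complex.ofReal_exp (-z * p.2), ← Complex.exp_add]
    congr 2
    push_cast
    ring
  calc ∫ σ : ℝ, ((Real.exp (-q ^ 2 * σ ^ 2) : ℝ) : ℂ) * (1 / ((z : ℂ) - Complex.I * σ))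
      = ∫ σ : ℝ, ∫ r in Ioi (0 : ℝ), ((Real.exp (-q ^ 2 * σ ^ 2) : ℝ) : ℂ) *
          Complex.exp (-(z - Complex.I * σ) * r) := by
        simp_rw [one_div_sub_I_mul hz, integral_const_mul]
    _ = ∫ r in Ioi (0 : ℝ), ∫ σ : ℝ, ((Real.exp (-q ^ 2 * σ ^ 2) : ℝ) : ℂ) *
          Complex.exp (-(z - Complex.I * σ) * r) := integral_integral_swap hswap
    _ = ∫ r in Ioi (0 : ℝ), ((Real.sqrt Real.pi / q * Real.exp (z ^ 2 * q ^ 2) *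
          Real.exp (-(r / (2 * q) + z * q) ^ 2) : ℝ) : ℂ) := by
        refine integral_congr_ae (Filter.Eventually.of_forall fun r => ?_)
        have h1 : ∀ σ : ℝ, ((Real.exp (-q ^ 2 * σ ^ 2) : ℝ) : ℂ) *
            Complex.exp (-(z - Complex.I * σ) * r) = ((Real.exp (-z * r) : ℝ) : ℂ) *
            (((Real.exp (-q ^ 2 * σ ^ 2) : ℝ) : ℂ) * Complex.exp (Complex.I * σ * r)) := by
          intro σ
          rw [mul_left_comm, Complex.ofReal_exp (-z * r), ← Complex.exp_add]
          congr 2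
          push_cast
          ring
        simp_rw [h1]
        rw [integral_const_mul, integral_gaussian_mul_cexp hq, ← Complex.ofReal_mul]
        congr 1
        rw [mul_left_comm, ← Real.exp_add, mul_assoc, ← Real.exp_add]
        congr 2
        field_simp
        ring
    _ = _ := by
        rw [integral_complex_ofReal, integral_const_mul, integral_exp_neg_sq_affine hq, erfc]
        congr 1
        have hpi := Real.sq_sqrt Real.pi_pos.le
        have hpi0 : Real.sqrt Real.pi ≠ 0 := (Real.sqrt_pos.2 Real.pi_pos).ne'
        field_simp
        rw [hpi]
        ring

lemma integral_gaussian_div_of_neg {q z : ℝ} (hq : 0 < q) (hz : z < 0) :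
    ∫ σ : ℝ, ((Real.exp (-q ^ 2 * σ ^ 2) : ℝ) : ℂ) * (1 / ((z : ℂ) - Complex.I * σ)) =
      -((Real.pi * Real.exp (z ^ 2 * q ^ 2) * erfc (-z * q) : ℝ) : ℂ) := by
  have h := integral_gaussian_div_of_pos hq (neg_pos.2 hz)
  rw [neg_sq] at h
  rw [← h, ← integral_neg, ← integral_neg_eq_self]
  refine integral_congr_ae (Filter.Eventually.of_forall fun σ => ?_)
  simp only [neg_sq]
  rw [← mul_neg, ← div_neg]
  congr 2
  push_cast
  ring

end Erfc

/-! ### The exact representation when pole and saddle are distinct -/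

section Representation

variable {μ x y : ℝ}

lemma phi_rho (hx : 0 < x) (hy : 0 < y) :
    phi x y (rho x y) = phi x y (saddle x y) + (zeta x y ^ 2 / 2 : ℝ) := by
  have h := phi_saddle_mul_exp hx hy (v := (poleCoord x y : ℂ)) (by simp [Real.pi_pos])
    (by simp [Real.pi_pos.le])
  rw [zeta_sq hx hy, ← psi_ofReal, ← h, rho_eq hx hy]
  push_cast
  rfl

/-- The contour integral over the vertical line through the saddle point, in terms of the
remainder. -/
lemma contour_eq_sub_remainder (hμ : 0 < μ) (hx : 0 < x) (hy : 0 < y)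
    (hne : saddle x y ≠ rho x y) :
    Complex.exp (-(μ : ℂ) * phi x y (rho x y : ℂ)) / (2 * Real.pi * Complex.I) *
      ∫ v : ℝ, contourIntegrand μ x y (saddle x y) v =
      (Real.exp (-(μ * zeta x y ^ 2 / 2)) : ℂ) / (2 * Real.pi) *
        (∫ σ : ℝ, ((Real.exp (-(μ / 2) * σ ^ 2) : ℝ) : ℂ) * (1 / (zeta x y - Complex.I * σ))) -
      remainderIntegral μ x y := by
  have h1 : ∫ σ : ℝ, pathIntegrand μ x y σ =
      Complex.exp (μ * phi x y (saddle x y)) * Complex.I *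
        ((∫ σ : ℝ, ((Real.exp (-(μ / 2) * σ ^ 2) : ℝ) : ℂ) * (1 / (zeta x y - Complex.I * σ))) -
          ∫ σ : ℝ, ((Real.exp (-(μ / 2) * σ ^ 2) : ℝ) : ℂ) * gImag x y σ) := by
    rw [← integral_sub (integrable_gaussian_div hμ (zeta_ne_zero hx hy hne))
      (integrable_gaussian_mul_gImag hμ hx hy), ← integral_const_mul]
    refine integral_congr_ae ?_
    filter_upwards [ae_ne_zero] with σ hσ
    exact pathIntegrand_eq hx hy hσ
  have h2 : Complex.exp (-(μ : ℂ) * phi x y (rho x y : ℂ)) =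
      Complex.exp (-(μ * phi x y (saddle x y))) * (Real.exp (-(μ * zeta x y ^ 2 / 2)) : ℂ) := by
    rw [phi_rho hx hy, Complex.ofReal_exp, ← Complex.exp_add]
    congr 1
    push_cast
    ring
  rw [← integral_deformation hμ hx hy hne, h1, h2, remainderIntegral_eq, Complex.exp_neg]
  have hI := Complex.I_ne_zero
  have hpi : (Real.pi : ℂ) ≠ 0 := by exact_mod_cast Real.pi_ne_zero
  have he := Complex.exp_ne_zero (μ * phi x y (saddle x y))
  field_simp

lemma gaussian_exponent (hμ : 0 < μ) : -(μ / 2) = -Real.sqrt (μ / 2) ^ 2 := by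
  rw [Real.sq_sqrt (half_pos hμ).le]

lemma exp_mul_exp_zeta (hμ : 0 < μ) (z : ℝ) :
    Real.exp (-(μ * z ^ 2 / 2)) * Real.exp (z ^ 2 * Real.sqrt (μ / 2) ^ 2) = 1 := by
  rw [← Real.exp_add, Real.sq_sqrt (half_pos hμ).le, ← Real.exp_zero]
  congr 1
  ring

/-- The line through `t₀` lies to the left of the pole, so it represents `Q`, and `ζ > 0`. -/
lemma remainderIntegral_of_saddle_lt (hμ : 0 < μ) (hx : 0 < x) (hy : 0 < y)
    (h : saddle x y < rho x y) :
    remainderIntegral μ x y =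
      ((1 / 2 * erfc (zeta x y * Real.sqrt (μ / 2)) - Q μ (μ * x) (μ * y) : ℝ) : ℂ) := by
  have hA := (one_lt_amp hx hy).le
  have hq := Real.sqrt_pos.2 (half_pos hμ)
  have hz : 0 < zeta x y := by
    rw [zeta_eq hx hy]
    refine sReal_pos hA (Real.log_pos ?_)
    rwa [one_lt_div (saddle_pos hx hy)]
  have h1 := contour_eq_sub_remainder hμ hx hy h.ne
  rw [← Q_eq_contour hμ hx hy (saddle_pos hx hy) h, gaussian_exponent hμ,
    integral_gaussian_div_of_pos hq hz] at h1
  have h2 : (Real.exp (-(μ * zeta x y ^ 2 / 2)) : ℂ) / (2 * Real.pi) *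
      ((Real.pi * Real.exp (zeta x y ^ 2 * Real.sqrt (μ / 2) ^ 2) *
        erfc (zeta x y * Real.sqrt (μ / 2)) : ℝ) : ℂ) =
      ((1 / 2 * erfc (zeta x y * Real.sqrt (μ / 2)) : ℝ) : ℂ) := by
    have he : ((Real.exp (-(μ * zeta x y ^ 2 / 2)) *
        Real.exp (zeta x y ^ 2 * Real.sqrt (μ / 2) ^ 2) : ℝ) : ℂ) = 1 := by
      rw [exp_mul_exp_zeta hμ, Complex.ofReal_one]
    have hpi : (Real.pi : ℂ) ≠ 0 := by exact_mod_cast Real.pi_ne_zero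
    rw [Complex.ofReal_mul] at he
    simp only [Complex.ofReal_mul, Complex.ofReal_div, Complex.ofReal_one,
      Complex.ofReal_ofNat]
    field_simp
    linear_combination ((erfc (zeta x y * Real.sqrt (μ / 2)) : ℂ)) * he
  rw [h2] at h1
  rw [Complex.ofReal_sub, h1]
  ring

/-- The line through `t₀` lies to the right of the pole, so it represents `-P`. The reflection of
the error function and `P + Q = 1` give the same formula as on the other side. -/
lemma remainderIntegral_of_rho_lt (hμ : 0 < μ) (hx : 0 < x) (hy : 0 < y)
    (h : rho x y < saddle x y) :
    remainderIntegral μ x y =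
      ((1 / 2 * erfc (zeta x y * Real.sqrt (μ / 2)) - Q μ (μ * x) (μ * y) : ℝ) : ℂ) := by
  have hA := (one_lt_amp hx hy).le
  have hq := Real.sqrt_pos.2 (half_pos hμ)
  have hz : zeta x y < 0 := by
    rw [zeta_eq hx hy]
    refine sReal_neg hA (Real.log_neg (div_pos (rho_pos hx hy) (saddle_pos hx hy)) ?_)
    rwa [div_lt_one (saddle_pos hx hy)]
  have h1 := contour_eq_sub_remainder hμ hx hy h.ne'
  rw [← neg_P_eq_contour hμ hx hy h, gaussian_exponent hμ,
    integral_gaussian_div_of_neg hq hz] at h1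
  have h2 : (Real.exp (-(μ * zeta x y ^ 2 / 2)) : ℂ) / (2 * Real.pi) *
      -((Real.pi * Real.exp (zeta x y ^ 2 * Real.sqrt (μ / 2) ^ 2) *
        erfc (-zeta x y * Real.sqrt (μ / 2)) : ℝ) : ℂ) =
      ((-(1 / 2 * erfc (-zeta x y * Real.sqrt (μ / 2))) : ℝ) : ℂ) := by
    have he : ((Real.exp (-(μ * zeta x y ^ 2 / 2)) *
        Real.exp (zeta x y ^ 2 * Real.sqrt (μ / 2) ^ 2) : ℝ) : ℂ) = 1 := by
      rw [exp_mul_exp_zeta hμ, Complex.ofReal_one]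
    have hpi : (Real.pi : ℂ) ≠ 0 := by exact_mod_cast Real.pi_ne_zero
    rw [Complex.ofReal_mul] at he
    simp only [Complex.ofReal_mul, Complex.ofReal_neg, Complex.ofReal_div, Complex.ofReal_one,
      Complex.ofReal_ofNat]
    field_simp
    linear_combination (-(erfc (-(zeta x y * Real.sqrt (μ / 2))) : ℂ)) * he
  rw [h2] at h1
  have h3 := erfc_add_erfc_neg (zeta x y * Real.sqrt (μ / 2))
  have h4 := P_add_Q hμ (mul_pos hμ hx) (mul_pos hμ hy)
  rw [← neg_mul] at h3
  have h5 : 1 / 2 * erfc (zeta x y * Real.sqrt (μ / 2)) - Q μ (μ * x) (μ * y) =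
      -(1 / 2 * erfc (-zeta x y * Real.sqrt (μ / 2))) - (-P μ (μ * x) (μ * y)) := by linarith
  rw [h5, Complex.ofReal_sub, Complex.ofReal_neg (P _ _ _), h1]
  ring

end Representation

/-! ### The limit in which the pole meets the saddle -/

section Coalescence

variable {μ x y x' y' : ℝ}

lemma phi_congr (h : xi x y = xi x' y') : phi x y = phi x' y' := by
  funext t; rw [phi, phi, h]

lemma saddle_congr (h : xi x y = xi x' y') : saddle x y = saddle x' y' := by
  rw [saddle, saddle, h]

lemma tImag_congr (h : xi x y = xi x' y') : tImag x y = tImag x' y' := by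
  have h1 : pathRadius x y = pathRadius x' y' := by
    funext θ; rw [pathRadius, pathRadius, h]
  have h2 : path x y = path x' y' := by
    funext θ; rw [path, path, h1]
  have h3 : pathCoord x y = pathCoord x' y' := by
    funext θ; rw [pathCoord, pathCoord, h2, phi_congr h, saddle_congr h]
  funext σ
  rw [tImag, tImag, h2, h3]

lemma amp_congr (hx : 0 < x) (hy : 0 < y) (hx' : 0 < x') (hy' : 0 < y')
    (h : xi x y = xi x' y') : amp x y = amp x' y' := by
  rw [amp, amp, ← xi_sq hx hy, ← xi_sq hx' hy', h]

/-- The pair `(ξ / (2r), ξ r / 2)` has the given `ξ` and `ρ = r`. Along this curve the phase, the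
saddle and the whole path stay fixed while only the pole moves. -/
lemma xi_div_mul {ξ r : ℝ} (hξ : 0 < ξ) (hr : 0 < r) : xi (ξ / (2 * r)) (ξ * r / 2) = ξ := by
  rw [xi, show ξ / (2 * r) * (ξ * r / 2) = (ξ / 2) ^ 2 by field_simp,
    Real.sqrt_sq (by positivity)]
  ring

lemma rho_div_mul {ξ r : ℝ} (hξ : 0 < ξ) (hr : 0 < r) : rho (ξ / (2 * r)) (ξ * r / 2) = r := by
  rw [rho, show ξ * r / 2 / (ξ / (2 * r)) = r ^ 2 by field_simp, Real.sqrt_sq hr.le]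

lemma tendsto_zeta_coalescence (hx : 0 < x) (hy : 0 < y) :
    Filter.Tendsto (fun r => zeta (xi x y / (2 * r)) (xi x y * r / 2))
      (nhdsWithin (saddle x y) (Ioi (saddle x y))) (nhds 0) := by
  have hξ := xi_pos hx hy
  have ht0 := saddle_pos hx hy
  have h1 : Filter.Tendsto (fun r => Real.log (r / saddle x y)) (nhds (saddle x y)) (nhds 0) := by
    have : ContinuousAt (fun r => Real.log (r / saddle x y)) (saddle x y) := by
      refine ContinuousAt.log (by fun_prop) ?_
      rw [div_self ht0.ne']
      exact one_ne_zero
    have h2 := this.tendsto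
    rwa [div_self ht0.ne', Real.log_one] at h2
  refine ((((tendsto_sReal_zero (one_lt_amp hx hy).le).comp h1).mono_left
    nhdsWithin_le_nhds)).congr' ?_
  filter_upwards [self_mem_nhdsWithin] with r hr
  have hr0 : 0 < r := ht0.trans hr
  have hx' : 0 < xi x y / (2 * r) := by positivity
  have hy' : 0 < xi x y * r / 2 := by positivity
  have hc := xi_div_mul hξ hr0
  rw [zeta_eq hx' hy', amp_congr hx' hy' hx hy hc, poleCoord, saddle_congr hc,
    rho_div_mul hξ hr0]
  rfl

/-- For fixed `σ ≠ 0` only `ρ` and `ζ` vary in `gImag`, with nonvanishing limits of the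
denominators. The bound of `norm_gImag_le`, uniform in the parameters, supplies the dominating
function. -/
lemma tendsto_integral_gImag (hμ : 0 < μ) (hx : 0 < x) (hy : 0 < y)
    (h : saddle x y = rho x y) :
    Filter.Tendsto (fun r => ∫ σ : ℝ, ((Real.exp (-(μ / 2) * σ ^ 2) : ℝ) : ℂ) *
      gImag (xi x y / (2 * r)) (xi x y * r / 2) σ)
      (nhdsWithin (saddle x y) (Ioi (saddle x y)))
      (nhds (∫ σ : ℝ, ((Real.exp (-(μ / 2) * σ ^ 2) : ℝ) : ℂ) * gImag x y σ)) := by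
  have hξ := xi_pos hx hy
  have ht0 := saddle_pos hx hy
  have hpos : ∀ᶠ r in nhdsWithin (saddle x y) (Ioi (saddle x y)), 0 < r := by
    filter_upwards [self_mem_nhdsWithin] with r hr using ht0.trans hr
  have hz0 : zeta x y = 0 := by
    rw [zeta_eq hx hy, poleCoord, ← h, div_self ht0.ne', Real.log_one, sReal_zero]
  refine tendsto_integral_filter_of_dominated_convergence
    (fun σ => 405000 * (Real.exp (-(μ / 2) * σ ^ 2) + |σ| * Real.exp (-(μ / 2) * σ ^ 2)))
    ?_ ?_ ?_ ?_
  · filter_upwards [hpos] with r hr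
    exact (integrable_gaussian_mul_gImag hμ (by positivity) (by positivity)).1
  · filter_upwards [hpos] with r hr
    filter_upwards [ae_ne_zero] with σ hσ
    rw [norm_mul, Complex.norm_real, Real.norm_of_nonneg (Real.exp_pos _).le]
    have hx' : 0 < xi x y / (2 * r) := by positivity
    have hy' : 0 < xi x y * r / 2 := by positivity
    have := norm_gImag_le hx' hy' hσ
    calc _ ≤ Real.exp (-(μ / 2) * σ ^ 2) * (405000 * (1 + |σ|)) := by gcongr
      _ = _ := by ring
  · have h0 := integrable_pow_mul_gaussian hμ 0
    have h1 := (integrable_pow_mul_gaussian hμ 1).norm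
    simp only [pow_zero, one_mul, pow_one, norm_mul, Real.norm_eq_abs, Real.abs_exp] at h0 h1
    exact (h0.add h1).const_mul _
  · filter_upwards [ae_ne_zero] with σ hσ
    refine Filter.Tendsto.const_mul _ ?_
    rw [gImag_eq_sub hσ]
    have hρ : Filter.Tendsto (fun r : ℝ => (r : ℂ))
        (nhdsWithin (saddle x y) (Ioi (saddle x y))) (nhds (rho x y : ℂ)) := by
      rw [← h]
      exact (Complex.continuous_ofReal.tendsto _).mono_left nhdsWithin_le_nhds
    have hζ : Filter.Tendsto (fun r => (zeta (xi x y / (2 * r)) (xi x y * r / 2) : ℂ))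
        (nhdsWithin (saddle x y) (Ioi (saddle x y))) (nhds (zeta x y : ℂ)) := by
      rw [hz0]
      exact (Complex.continuous_ofReal.tendsto 0).comp (tendsto_zeta_coalescence hx hy)
    have hne : (rho x y : ℂ) - tImag x y σ ≠ 0 := by
      rw [rho_sub_tImag hx hy]
      exact mul_ne_zero (tImag_ne_zero hx hy σ) (exp_sub_pathFun_ne_one hx hy _ hσ)
    refine ((tendsto_const_nhds.div (hζ.sub_const _)
      (ofReal_sub_I_mul_ne_zero (zeta x y) hσ)).sub
      (((tendsto_const_nhds (x := deriv (tImag x y) σ)).div (hρ.sub_const (tImag x y σ))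
        hne).div_const Complex.I)).congr' ?_
    filter_upwards [hpos] with r hr
    have hc := xi_div_mul hξ hr
    rw [gImag_eq_sub hσ, tImag_congr hc, rho_div_mul hξ hr]
    rfl

/-- The line `Re t = t₀/2` stays to the left of all the poles. Approaching from `r > t₀` only
increases the distance `|r - t|`, so the limiting integrand dominates. -/
lemma tendsto_Q_coalescence (hμ : 0 < μ) (hx : 0 < x) (hy : 0 < y)
    (h : saddle x y = rho x y) :
    Filter.Tendsto (fun r => (Q μ (μ * (xi x y / (2 * r))) (μ * (xi x y * r / 2)) : ℂ))
      (nhdsWithin (saddle x y) (Ioi (saddle x y))) (nhds (Q μ (μ * x) (μ * y) : ℂ)) := by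
  have hξ := xi_pos hx hy
  have ht0 := saddle_pos hx hy
  have hc0 : 0 < saddle x y / 2 := half_pos ht0
  have hcρ : saddle x y / 2 < rho x y := by rw [← h]; exact half_lt_self ht0
  have hmem : ∀ᶠ r in nhdsWithin (saddle x y) (Ioi (saddle x y)), saddle x y < r :=
    self_mem_nhdsWithin
  have hρ : Filter.Tendsto (fun r : ℝ => (r : ℂ))
      (nhdsWithin (saddle x y) (Ioi (saddle x y))) (nhds (rho x y : ℂ)) := by
    rw [← h]
    exact (Complex.continuous_ofReal.tendsto _).mono_left nhdsWithin_le_nhds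
  have hslit : (rho x y : ℂ) ∈ Complex.slitPlane := Or.inl (by simpa using rho_pos hx hy)
  have hphi : Filter.Tendsto (fun r : ℝ => phi x y (r : ℂ))
      (nhdsWithin (saddle x y) (Ioi (saddle x y))) (nhds (phi x y (rho x y))) := by
    refine Filter.Tendsto.comp (g := phi x y) ?_ hρ
    have : ContinuousAt (phi x y) (rho x y) := by
      unfold phi
      refine ContinuousAt.sub (continuousAt_const.mul (continuousAt_id.add
        (continuousAt_const.div continuousAt_id ?_))) (continuousAt_clog hslit)
      exact Complex.slitPlane_ne_zero hslit
    exact this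
  have hint : Filter.Tendsto (fun r => ∫ v : ℝ,
      contourIntegrand μ (xi x y / (2 * r)) (xi x y * r / 2) (saddle x y / 2) v)
      (nhdsWithin (saddle x y) (Ioi (saddle x y)))
      (nhds (∫ v : ℝ, contourIntegrand μ x y (saddle x y / 2) v)) := by
    refine tendsto_integral_filter_of_dominated_convergence
      (fun v => ‖contourIntegrand μ x y (saddle x y / 2) v‖) ?_ ?_
      (integrable_contourIntegrand hμ hx hy hc0 hcρ.ne).norm ?_
    · filter_upwards [hmem] with r hr
      have hr0 := ht0.trans hr
      refine (integrable_contourIntegrand hμ (by positivity) (by positivity) hc0 ?_).1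
      rw [rho_div_mul hξ hr0]
      linarith
    · filter_upwards [hmem] with r hr
      refine Filter.Eventually.of_forall fun v => ?_
      have hr0 := ht0.trans hr
      rw [contourIntegrand, contourIntegrand, norm_mul, norm_mul, norm_div, norm_div,
        phi_congr (xi_div_mul hξ hr0), rho_div_mul hξ hr0]
      have hpos : 0 < ‖(rho x y : ℂ) - (((saddle x y / 2 : ℝ) : ℂ) + Complex.I * v)‖ := by
        refine norm_pos_iff.2 fun h0 => ?_
        have := congrArg Complex.re h0
        simp at this
        linarith
      have hle : ‖(rho x y : ℂ) - (((saddle x y / 2 : ℝ) : ℂ) + Complex.I * v)‖ ≤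
          ‖(r : ℂ) - (((saddle x y / 2 : ℝ) : ℂ) + Complex.I * v)‖ := by
        rw [Complex.norm_def, Complex.norm_def]
        refine Real.sqrt_le_sqrt ?_
        rw [Complex.normSq_apply, Complex.normSq_apply]
        simp
        nlinarith
      gcongr
    · refine Filter.Eventually.of_forall fun v => ?_
      have hne : (rho x y : ℂ) - (((saddle x y / 2 : ℝ) : ℂ) + Complex.I * v) ≠ 0 := by
        intro h0
        have := congrArg Complex.re h0
        simp at this
        linarith
      refine (((tendsto_const_nhds (x := Complex.exp ((μ : ℂ) *
        phi x y (((saddle x y / 2 : ℝ) : ℂ) + Complex.I * v)))).div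
        (hρ.sub_const _) hne).mul_const Complex.I).congr' ?_
      filter_upwards [hmem] with r hr
      have hr0 := ht0.trans hr
      rw [contourIntegrand, phi_congr (xi_div_mul hξ hr0), rho_div_mul hξ hr0]
      rfl
  rw [Q_eq_contour hμ hx hy hc0 hcρ]
  refine ((((hphi.const_mul (-(μ : ℂ))).cexp).div_const _).mul hint).congr' ?_
  filter_upwards [hmem] with r hr
  have hr0 := ht0.trans hr
  have hcr : saddle x y / 2 < rho (xi x y / (2 * r)) (xi x y * r / 2) := by
    rw [rho_div_mul hξ hr0]
    linarith
  rw [Q_eq_contour hμ (by positivity) (by positivity) hc0 hcr, rho_div_mul hξ hr0,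
    phi_congr (xi_div_mul hξ hr0)]

/-- Both sides are continuous along the curve of fixed `ξ`, and the identity holds there for `r >
t₀`. -/
lemma remainderIntegral_of_saddle_eq (hμ : 0 < μ) (hx : 0 < x) (hy : 0 < y)
    (h : saddle x y = rho x y) :
    remainderIntegral μ x y =
      ((1 / 2 * erfc (zeta x y * Real.sqrt (μ / 2)) - Q μ (μ * x) (μ * y) : ℝ) : ℂ) := by
  have hξ := xi_pos hx hy
  have ht0 := saddle_pos hx hy
  have hz0 : zeta x y = 0 := by
    rw [zeta_eq hx hy, poleCoord, ← h, div_self ht0.ne', Real.log_one, sReal_zero]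
  have hζ := tendsto_zeta_coalescence hx hy
  have hleft : Filter.Tendsto (fun r => remainderIntegral μ (xi x y / (2 * r)) (xi x y * r / 2))
      (nhdsWithin (saddle x y) (Ioi (saddle x y))) (nhds (remainderIntegral μ x y)) := by
    simp_rw [remainderIntegral_eq]
    refine Filter.Tendsto.mul (Filter.Tendsto.div_const ?_ _) (tendsto_integral_gImag hμ hx hy h)
    refine (Complex.continuous_ofReal.tendsto _).comp ?_
    rw [hz0]
    exact ((by fun_prop : Continuous fun z : ℝ => Real.exp (-(μ * z ^ 2 / 2))).tendsto 0).comp hζ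
  have hright : Filter.Tendsto (fun r => (((1 / 2 * erfc (zeta (xi x y / (2 * r))
      (xi x y * r / 2) * Real.sqrt (μ / 2)) : ℝ) : ℂ) -
        (Q μ (μ * (xi x y / (2 * r))) (μ * (xi x y * r / 2)) : ℂ)))
      (nhdsWithin (saddle x y) (Ioi (saddle x y)))
      (nhds (((1 / 2 * erfc (zeta x y * Real.sqrt (μ / 2)) : ℝ) : ℂ) -
        (Q μ (μ * x) (μ * y) : ℂ))) := by
    refine Filter.Tendsto.sub ((Complex.continuous_ofReal.tendsto _).comp ?_)
      (tendsto_Q_coalescence hμ hx hy h)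
    rw [hz0]
    have := continuous_erfc
    exact ((by fun_prop : Continuous fun z : ℝ =>
      1 / 2 * erfc (z * Real.sqrt (μ / 2))).tendsto 0).comp hζ
  rw [Complex.ofReal_sub]
  refine tendsto_nhds_unique (hleft.congr' ?_) hright
  filter_upwards [self_mem_nhdsWithin] with r hr
  have hr0 : 0 < r := ht0.trans hr
  rw [remainderIntegral_of_saddle_lt hμ (by positivity) (by positivity), Complex.ofReal_sub]
  rw [saddle_congr (xi_div_mul hξ hr0), rho_div_mul hξ hr0]
  exact hr

theorem remainderIntegral_eq_erfc_sub_Q (hμ : 0 < μ) (hx : 0 < x) (hy : 0 < y) :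
    remainderIntegral μ x y =
      ((1 / 2 * erfc (zeta x y * Real.sqrt (μ / 2)) - Q μ (μ * x) (μ * y) : ℝ) : ℂ) := by
  rcases lt_trichotomy (saddle x y) (rho x y) with h | h | h
  · exact remainderIntegral_of_saddle_lt hμ hx hy h
  · exact remainderIntegral_of_saddle_eq hμ hx hy h
  · exact remainderIntegral_of_rho_lt hμ hx hy h

end Coalescence

end Marcum

end

/-! ### Assembly -/

theorem mainTheorem1 :
    -- the quantity `ζ`
    (∀ x y : ℝ, 0 < x → 0 < y →
      Marcum.zeta x y ^ 2 / 2 = x + y - Real.sqrt (1 + 4 * x * y)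
          + Real.log ((1 + Real.sqrt (1 + 4 * x * y)) / (2 * y)) ∧
      Real.sign (Marcum.zeta x y) = Real.sign (y - x - 1)) ∧
    -- the contour integral for `Q`
    (∀ μ x y c : ℝ, 0 < μ → 0 < x → 0 < y → 0 < c → c < Marcum.rho x y →
      MeasureTheory.Integrable (fun v : ℝ => Marcum.contourIntegrand μ x y c v) ∧
      (Marcum.Q μ (μ * x) (μ * y) : ℂ) =
        Complex.exp (-(μ : ℂ) * Marcum.phi x y (Marcum.rho x y : ℂ))
          / (2 * Real.pi * Complex.I) * ∫ v : ℝ, Marcum.contourIntegrand μ x y c v) ∧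
    -- the exact representations of `Q` and `P`, with the same remainder
    (∀ μ x y : ℝ, 0 < μ → 0 < x → 0 < y →
      MeasureTheory.Integrable (fun σ : ℝ =>
        Complex.exp ((μ : ℂ) * (Complex.I * σ) ^ 2 / 2) * Marcum.gImag x y σ * Complex.I) ∧
      (Marcum.R μ x y : ℂ) = Marcum.remainderIntegral μ x y ∧
      Marcum.Q μ (μ * x) (μ * y) =
        1 / 2 * Marcum.erfc (Marcum.zeta x y * Real.sqrt (μ / 2)) - Marcum.R μ x y ∧
      Marcum.P μ (μ * x) (μ * y) =
        1 / 2 * Marcum.erfc (-(Marcum.zeta x y) * Real.sqrt (μ / 2)) + Marcum.R μ x y ∧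
      Marcum.R μ x y =
        Real.exp (-(μ * Marcum.zeta x y ^ 2 / 2)) / Real.sqrt (2 * Real.pi * μ)
          * Marcum.S μ x y) ∧
    -- the asymptotic expansion of `S` as `μ → ∞`, uniformly in `x, y > 0`
    (∀ N : ℕ, ∃ C μ₀ : ℝ, 0 < μ₀ ∧ ∀ μ x y : ℝ, μ₀ ≤ μ → 0 < x → 0 < y →
      |Marcum.S μ x y - ∑ n ∈ Finset.range N, Marcum.d n x y / μ ^ n| ≤ C / μ ^ N) ∧
    -- the first coefficient
    (∀ x y : ℝ, 0 < x → 0 < y → y ≠ x + 1 →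
      Marcum.d 0 x y = 1 / Marcum.zeta x y
        - (1 + 2 * x + Real.sqrt (1 + 4 * x * y))
          / (2 * (y - x - 1) * (1 + 4 * x * y) ^ (1 / 4 : ℝ))) := by
  refine ⟨fun x y hx hy => ⟨?_, ?_⟩, fun μ x y c hμ hx hy hc hcρ => ⟨?_, ?_⟩,
    fun μ x y hμ hx hy => ⟨?_, ?_, ?_, ?_, ?_⟩, fun N => ⟨_, 1, one_pos,
      fun μ x y hμ hx hy => Marcum.abs_S_sub_le N hμ hx hy⟩, ?_⟩
  · rw [Marcum.zeta_sq hx hy, ← Marcum.halfZetaSq_eq hx hy, Marcum.halfZetaSq]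
  · rw [Marcum.sign_zeta hx hy, Marcum.sign_poleCoord hx hy]
  · exact Marcum.integrable_contourIntegrand hμ hx hy hc hcρ.ne
  · exact Marcum.Q_eq_contour hμ hx hy hc hcρ
  · exact Marcum.integrable_remainder hμ hx hy
  -- Reality of the remainder is not proved by symmetry: the integral equals a difference of real
  -- quantities.
  · rw [Marcum.R, Marcum.remainderIntegral_eq_erfc_sub_Q hμ hx hy, Complex.ofReal_re]
  · rw [Marcum.R, Marcum.remainderIntegral_eq_erfc_sub_Q hμ hx hy, Complex.ofReal_re,
      sub_sub_cancel]
  · have h1 := Marcum.P_add_Q hμ (mul_pos hμ hx) (mul_pos hμ hy)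
    have h2 := Marcum.erfc_add_erfc_neg (Marcum.zeta x y * Real.sqrt (μ / 2))
    rw [← neg_mul] at h2
    rw [Marcum.R, Marcum.remainderIntegral_eq_erfc_sub_Q hμ hx hy, Complex.ofReal_re]
    linarith
  · have h1 : Real.sqrt (2 * Real.pi * μ) ≠ 0 := by positivity
    rw [Marcum.S, Real.exp_neg]
    field_simp
  · exact fun x y hx hy hne => Marcum.d_zero_eq hx hy hne
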